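/- Let $E$ be a complex Banach space, and write $B_R=\{x:\|x\|<R\}$. \emph{Metric currents.} A $k$-dimensional metric current on $E$ is a functional $T(f,\pi_1,\dots,\pi_k)\in\mathbb C$, for $f:E\to\mathbb C$ bounded Lipschitz and $\pi_i:E\to\mathbb C$ Lipschitz, that is multilinear; continuous under pointwise convergence of the $\pi_i$ with uniformly bounded Lipschitz constants; local ($T(f,\pi)=0$ if some $\pi_i$ is constant on a neighbourhood of $\operatorname{supp} f$); and of finite mass: $|T(f,\pi)|\le\prod_i\mathrm{Lip}(\pi_i)\int_E|f|\,d\mu$ for some finite Radon measure $\mu$. Its mass $M(T)$ is the supremum of the finite sums $\sum_j|T(f_j,\pi^j)|$ with $\sum_j|f_j|\le1$ and $\mathrm{Lip}(\pi^j_i)\le1$; its support is the intersection of all closed sets $C$ such that $T(f,\pi)=0$ whenever $\operatorname{supp} f\cap C=\emptyset$. Its boundary is $dT(f,\pi)=T(1,f,\pi)$ (and $dT=0$ if $k=0$); $T$ is normal, $T\in N_k(E)$, if $dT$ is a metric current as well. \emph{Quasi-local metric currents.} These are functionals $U(f,\pi_1,\dots,\pi_k)$, for $f$ Lipschitz with bounded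 support and $\pi_i$ Lipschitz on every ball $B_R$, that are multilinear; local in the same sense; continuous under pointwise convergence of $f$ and of the $\pi_i$, with uniformly bounded Lipschitz constants and supports in a common ball for the $f$'s, and Lipschitz constants uniformly bounded on each ball for the $\pi_i$'s; and such that for every $R>0$ there is a finite Radon measure $\mu_R$ with $|U(f,\pi)|\le\prod_i\mathrm{Lip}(\pi_i|_{B_R})\int_{B_R}|f|\,d\mu_R$ whenever $\operatorname{supp} f\subset B_R$. The mass $M_{B_R}(U)$ is the supremum of the finite sums $\sum_j|U(f_j,\pi^j)|$ with $\operatorname{supp} f_j\subset B_R$, $\sum_j|f_j|\le 1$ and $\mathrm{Lip}(\pi^j_i|_{B_R})\le1$. The boundary is $dU(f,\pi)=U(\sigma,f,\pi)$, with $\sigma$ Lipschitz of bounded support, equal to $1$ near $\operatorname{supp} f$ (and $dU=0$ if $k=0$). A metric current $T$ is regarded as a quasi-local one through $T(f,\pi)=T(f,\sigma\pi_1,\dots,\sigma\pi_k)$. \emph{Bidimension and $\overline\partial$.} A $k$-dimensional current of either kind, $k=p+q$ with $p,q\in\mathbb Z$, is a $(p,q)$-current if it vanishes on $(f,\pi)$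 whenever more than $p$ of the $\pi_i$ are holomorphic, or more than $q$ of them are antiholomorphic, on a neighbourhood of $\operatorname{supp} f$ (so only $0$ is a $(p,q)$-current if $p<0$ or $q<0$). For a $(p,q)$-current $T$, $\overline\partial T=S$ means that $S$ is a $(p,q-1)$-current and $dT-S$ is a $(p-1,q)$-current, of the same kind as $T$. \textbf{Theorem.} Let $p,q\ge0$, $k=p+q$, and let $K\subset E$ be a bounded set at positive distance from $0$. There are functions $A,B:(0,\infty)\to[0,\infty)$ such that for every $(p,q)$-current $T\in N_k(E)$ with $\overline\partial T=0$ and $\operatorname{supp}T\subset K$ there is a quasi-local metric $(p,q+1)$-current $U$ whose boundary $dU$ is also a quasi-local metric current, with $$\overline\partial U=T$$ as quasi-local currents, and, for every $R>0$, $$M_{B_R}(U)+M_{B_R}(dU)\le A(R)\,M(T)+B(R)\,M(dT).$$ -/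

import Mathlib

open MeasureTheory Filter Topology
open scoped NNReal ENNReal

namespace MetricCurrents

/-- A functional on `(k+1)`-tuples `(f, π₁, …, π_k)` of complex-valued functions. Only its values on
the admissible forms of the class of currents under consideration are ever used. -/
abbrev Functional (E : Type*) (k : ℕ) : Type _ := (E → ℂ) → (Fin k → E → ℂ) → ℂ

section General

variable {E : Type*} [NormedAddCommGroup E]

/-- `T` is linear in each of its `k + 1` arguments, for `f ∈ F` and `π_i ∈ P`. -/
structure IsMultilinearOn (F P : Set (E → ℂ)) {k : ℕ} (T : Functional E k) : Prop where
  add_left : ∀ f ∈ F, ∀ g ∈ F, ∀ π : Fin k → E → ℂ, (∀ i, π i ∈ P) →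
    T (f + g) π = T f π + T g π
  smul_left : ∀ (c : ℂ), ∀ f ∈ F, ∀ π : Fin k → E → ℂ, (∀ i, π i ∈ P) →
    T (c • f) π = c * T f π
  add_right : ∀ f ∈ F, ∀ π : Fin k → E → ℂ, (∀ i, π i ∈ P) → ∀ (i : Fin k), ∀ u ∈ P, ∀ v ∈ P,
    T f (Function.update π i (u + v)) =
      T f (Function.update π i u) + T f (Function.update π i v)
  smul_right : ∀ (c : ℂ), ∀ f ∈ F, ∀ π : Fin k → E → ℂ, (∀ i, π i ∈ P) → ∀ (i : Fin k), ∀ u ∈ P,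
    T f (Function.update π i (c • u)) = c * T f (Function.update π i u)

/-- Locality: `T (f, π) = 0` whenever some `π_i` is constant on a neighbourhood of `supp f`. -/
def IsLocalOn (F P : Set (E → ℂ)) {k : ℕ} (T : Functional E k) : Prop :=
  ∀ f ∈ F, ∀ π : Fin k → E → ℂ, (∀ i, π i ∈ P) →
    (∃ (i : Fin k) (c : ℂ) (W : Set E), IsOpen W ∧ tsupport f ⊆ W ∧ ∀ x ∈ W, π i x = c) →
    T f π = 0

/-- The mass of `T` on the set `V`: the supremum of `∑ |T (f_j, π^j)|` over finite families with
`supp f_j ⊆ V`, `∑ |f_j| ≤ 1` and every `π^j_i` Lipschitz on `V` with constant `1`. -/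
noncomputable def massOn (F P : Set (E → ℂ)) (V : Set E) {k : ℕ} (T : Functional E k) : ℝ≥0∞ :=
  ⨆ (n : ℕ) (f : Fin n → E → ℂ) (π : Fin n → Fin k → E → ℂ)
    (_ : (∀ j, f j ∈ F ∧ tsupport (f j) ⊆ V) ∧
      (∀ j i, π j i ∈ P ∧ LipschitzOnWith 1 (π j i) V) ∧
      (∀ x, ∑ j, ‖f j x‖ ≤ 1)),
    ∑ j, ‖T (f j) (π j)‖ₑ

/-- `g` is holomorphic on a neighbourhood of `s`. -/
def HolomorphicNear [NormedSpace ℂ E] (g : E → ℂ) (s : Set E) : Prop :=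
  ∃ W : Set E, IsOpen W ∧ s ⊆ W ∧ DifferentiableOn ℂ g W

/-- `g` is antiholomorphic on a neighbourhood of `s`. -/
def AntiholomorphicNear [NormedSpace ℂ E] (g : E → ℂ) (s : Set E) : Prop :=
  HolomorphicNear (fun x => starRingEnd ℂ (g x)) s

/-- `T` is of bidimension `(p, q)`: it vanishes on every form `(f, π)` for which more than `p` of the
`π_i` are holomorphic near `supp f`, or more than `q` of them are antiholomorphic near `supp f`.
The indices are integers, so that for `p < 0` or `q < 0` only the zero current qualifies. -/
def HasBidimension [NormedSpace ℂ E] (F P : Set (E → ℂ)) (p q : ℤ) {k : ℕ}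
    (T : Functional E k) : Prop :=
  ∀ f ∈ F, ∀ π : Fin k → E → ℂ, (∀ i, π i ∈ P) → ∀ I : Finset (Fin k),
    ((p < (I.card : ℤ) ∧ ∀ i ∈ I, HolomorphicNear (π i) (tsupport f)) ∨
      (q < (I.card : ℤ) ∧ ∀ i ∈ I, AntiholomorphicNear (π i) (tsupport f))) →
    T f π = 0

/-! ### Metric currents (of finite mass, in the sense of Ambrosio and Kirchheim) -/

variable (E) in
/-- Lipschitz functions. -/
def lip : Set (E → ℂ) := {g | ∃ K : ℝ≥0, LipschitzWith K g}

variable (E) in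
/-- Bounded Lipschitz functions. -/
def lipB : Set (E → ℂ) := {f | f ∈ lip E ∧ ∃ C : ℝ, ∀ x, ‖f x‖ ≤ C}

/-- `T` is a `k`-dimensional metric current on `E`. In the mass condition, the product of the least
Lipschitz constants is expressed by quantifying over all admissible constants `L i`. -/
structure IsMetricCurrent [MeasurableSpace E] {k : ℕ} (T : Functional E k) : Prop where
  multilinear : IsMultilinearOn (lipB E) (lip E) T
  continuous : ∀ f ∈ lipB E, ∀ (πs : ℕ → Fin k → E → ℂ) (π : Fin k → E → ℂ),
    (∀ i, ∃ C : ℝ≥0, LipschitzWith C (π i) ∧ ∀ n, LipschitzWith C (πs n i)) →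
    (∀ i x, Tendsto (fun n => πs n i x) atTop (𝓝 (π i x))) →
    Tendsto (fun n => T f (πs n)) atTop (𝓝 (T f π))
  isLocal : IsLocalOn (lipB E) (lip E) T
  finite_mass : ∃ μ : Measure E, IsFiniteMeasure μ ∧ μ.InnerRegular ∧
    ∀ f ∈ lipB E, ∀ (π : Fin k → E → ℂ) (L : Fin k → ℝ≥0), (∀ i, LipschitzWith (L i) (π i)) →
      ‖T f π‖ ≤ (∏ i, (L i : ℝ)) * ∫ x, ‖f x‖ ∂μ

/-- The boundary `dT (f, π) = T (1, f, π)`; it is zero for `0`-dimensional currents. -/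
def boundary : {k : ℕ} → Functional E k → Functional E (k - 1)
  | 0, _ => fun _ _ => 0
  | _ + 1, T => fun f π => T (fun _ => 1) (Fin.cons (α := fun _ => E → ℂ) f π)

/-- Normal currents: `T` and `dT` are metric currents. -/
def IsNormal [MeasurableSpace E] {k : ℕ} (T : Functional E k) : Prop :=
  IsMetricCurrent T ∧ IsMetricCurrent (boundary T)

/-- The support of a metric current: the intersection of all closed `C` such that `T (f, π) = 0`
whenever `supp f` does not meet `C`. -/
def supp {k : ℕ} (T : Functional E k) : Set E :=
  ⋂₀ {C | IsClosed C ∧ ∀ f ∈ lipB E, ∀ π : Fin k → E → ℂ, (∀ i, π i ∈ lip E) →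
    Disjoint (tsupport f) C → T f π = 0}

/-- The total mass of a metric current. -/
noncomputable def mass {k : ℕ} (T : Functional E k) : ℝ≥0∞ :=
  massOn (lipB E) (lip E) Set.univ T

/-- `∂̄T = S` for a metric `(p, q)`-current `T`: in the decomposition `dT = S + (dT - S)`, the first
summand is a current of bidimension `(p, q - 1)`, the second one of bidimension `(p - 1, q)`. -/
structure IsDbar [NormedSpace ℂ E] [MeasurableSpace E] (p q : ℤ) {k : ℕ} (T : Functional E k)
    (S : Functional E (k - 1)) : Prop where
  current_dbar : IsMetricCurrent S
  bidim_dbar : HasBidimension (lipB E) (lip E) p (q - 1) S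
  current_del : IsMetricCurrent (boundary T - S)
  bidim_del : HasBidimension (lipB E) (lip E) (p - 1) q (boundary T - S)

/-! ### Quasi-local metric currents -/

variable (E) in
/-- Lipschitz functions with bounded support. -/
def qTest : Set (E → ℂ) :=
  {f | (∃ K : ℝ≥0, LipschitzWith K f) ∧ ∃ R : ℝ, 0 < R ∧ tsupport f ⊆ Metric.ball 0 R}

variable (E) in
/-- Functions that are Lipschitz on every ball. -/
def qLip : Set (E → ℂ) :=
  {g | ∀ R : ℝ, 0 < R → ∃ K : ℝ≥0, LipschitzOnWith K g (Metric.ball 0 R)}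

/-- `T` is a `k`-dimensional quasi-local metric current on `E`. -/
structure IsQLocCurrent [MeasurableSpace E] {k : ℕ} (T : Functional E k) : Prop where
  multilinear : IsMultilinearOn (qTest E) (qLip E) T
  continuous : ∀ (fs : ℕ → E → ℂ) (f : E → ℂ) (πs : ℕ → Fin k → E → ℂ) (π : Fin k → E → ℂ),
    (∃ C : ℝ≥0, LipschitzWith C f ∧ ∀ n, LipschitzWith C (fs n)) →
    (∃ R : ℝ, 0 < R ∧ tsupport f ⊆ Metric.ball 0 R ∧ ∀ n, tsupport (fs n) ⊆ Metric.ball 0 R) →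
    (∀ x, Tendsto (fun n => fs n x) atTop (𝓝 (f x))) →
    (∀ i, ∀ R : ℝ, 0 < R → ∃ C : ℝ≥0, LipschitzOnWith C (π i) (Metric.ball 0 R) ∧
      ∀ n, LipschitzOnWith C (πs n i) (Metric.ball 0 R)) →
    (∀ i x, Tendsto (fun n => πs n i x) atTop (𝓝 (π i x))) →
    Tendsto (fun n => T (fs n) (πs n)) atTop (𝓝 (T f π))
  isLocal : IsLocalOn (qTest E) (qLip E) T
  locally_finite_mass : ∀ R : ℝ, 0 < R → ∃ μ : Measure E, IsFiniteMeasure μ ∧ μ.InnerRegular ∧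
    ∀ f ∈ qTest E, tsupport f ⊆ Metric.ball 0 R → ∀ π : Fin k → E → ℂ, (∀ i, π i ∈ qLip E) →
      ∀ L : Fin k → ℝ≥0, (∀ i, LipschitzOnWith (L i) (π i) (Metric.ball 0 R)) →
        ‖T f π‖ ≤ (∏ i, (L i : ℝ)) * ∫ x in Metric.ball 0 R, ‖f x‖ ∂μ

/-- A Lipschitz function with bounded support which is `1` on a neighbourhood of `supp f`, for `f`
with bounded support: with `ρ = sup {‖x‖ : x ∈ supp f}`, it is `1` for `‖x‖ ≤ ρ + 1` and `0` for
`‖x‖ ≥ ρ + 2`. -/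
noncomputable def cutoff (f : E → ℂ) (x : E) : ℂ :=
  ((max 0 (min 1 (sSup (norm '' tsupport f) + 2 - ‖x‖)) : ℝ) : ℂ)

/-- The boundary of a quasi-local current: `dT (f, π) = T (σ, f, π)`, where `σ` has bounded support
and is `1` near `supp f` (by locality the choice of `σ` does not matter). -/
noncomputable def qBoundary : {k : ℕ} → Functional E k → Functional E (k - 1)
  | 0, _ => fun _ _ => 0
  | _ + 1, T => fun f π => T (cutoff f) (Fin.cons (α := fun _ => E → ℂ) f π)

/-- A metric current seen as a quasi-local current: the `π_i`, which are Lipschitz on bounded sets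
only, are multiplied by a cutoff that is `1` near `supp f` (by locality its choice does not
matter). -/
noncomputable def toQLoc {k : ℕ} (T : Functional E k) : Functional E k :=
  fun f π => T f (fun i x => cutoff f x * π i x)

/-- Quasi-locally normal currents. -/
def IsQLocNormal [MeasurableSpace E] {k : ℕ} (T : Functional E k) : Prop :=
  IsQLocCurrent T ∧ IsQLocCurrent (qBoundary T)

/-- The mass of a quasi-local current on the ball of centre `0` and radius `R`. -/
noncomputable def qMass (R : ℝ) {k : ℕ} (T : Functional E k) : ℝ≥0∞ :=
  massOn (qTest E) (qLip E) (Metric.ball 0 R) T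

/-- `∂̄T = S` for a quasi-local metric `(p, q)`-current `T`. -/
structure IsQLocDbar [NormedSpace ℂ E] [MeasurableSpace E] (p q : ℤ) {k : ℕ} (T : Functional E k)
    (S : Functional E (k - 1)) : Prop where
  current_dbar : IsQLocCurrent S
  bidim_dbar : HasBidimension (qTest E) (qLip E) p (q - 1) S
  current_del : IsQLocCurrent (qBoundary T - S)
  bidim_del : HasBidimension (qTest E) (qLip E) (p - 1) q (qBoundary T - S)

end General

end MetricCurrents

/-! The primitive is a Cauchy transform along the complex lines through the origin. For a Lipschitz
function `F` vanishing far from `1`, the Cauchy-Pompeiu formula in polar coordinates ζ = 1 + r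
exp(iθ) reads F(1) = -(1/2π) ∬ (∂_r + (i/r) ∂_θ) F dr dθ, because the kernel 1/(ζ - 1) absorbs the
Jacobian r (`tendsto_integral_polar`). It is applied to F(ζ) = T(f∘ζ, π∘ζ), where ζ stands for the
dilation x ↦ ζx. As T stays away from the origin and f has bounded support, F vanishes for large r;
this is also why the result is only quasi-local.

Write D = ∂_r + (i/r) ∂_θ. The cone C(T)(f, π_0, …, π_k) = -(1/2π) ∬ Σ_i (-1)^i T((f∘ζ) Dπ_i,
(π_j∘ζ)_{j≠i}) dr dθ satisfies dC(T) = T - C(dT), by the product rule and the Cauchy formula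
(`NormalForm.cone_cons`). Since D kills holomorphic functions, C raises bidimension (p, q) to (p, q
+ 1) (`NormalForm.bidimQ_cone`). If ∂̄T = 0, then dT has bidimension (p - 1, q), so for U = C(T) the
difference dU - T = -C(dT) has bidimension (p - 1, q + 1), which says ∂̄U = T. The angular
derivative is O(r), so the integrand is bounded and the mass bounds are those of T and dT times a
factor depending on R.

Two analytic points need care. First, Dπ_i exists only almost everywhere and is not Lipschitz, so it
is no admissible argument of T. It is replaced by difference quotients, which converge for almost
every (r, θ) and μ-almost every x by one-dimensional differentiability and Fubini; the L¹ bound of T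
in its first argument turns this into convergence of values. Secondly, continuity of U in the π_i is
not visible from the formula. It follows from the finite local mass of dU, by the device S(f, …, g,
…) = S(1, …, fg, …) - S(g, …, f, …), a case of the product rule (`qCont_of_bound`).

Throughout, T is first replaced by an alternating form on the algebra `qLipAlg E`
(`exists_normalForm`). Alternation and the product rule are derived from locality, finite mass and
continuity, as in the theory of Ambrosio and Kirchheim. -/

namespace MetricCurrents

/-! ### The algebra of functions that are Lipschitz on every ball. -/

section Algebra

variable {E : Type*} [NormedAddCommGroup E]

theorem exists_bound_of_mem_qLip {g : E → ℂ} (hg : g ∈ qLip E) (R : ℝ) :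
    ∃ M : ℝ≥0, ∀ x, ‖x‖ ≤ R → ‖g x‖ ≤ M := by
  obtain ⟨K, hK⟩ := hg (|R| + 1) (by positivity)
  refine ⟨‖g 0‖₊ + K * (|R| + 1).toNNReal, fun x hx => ?_⟩
  have hxR : x ∈ Metric.ball (0 : E) (|R| + 1) := by
    rw [mem_ball_zero_iff]; linarith [le_abs_self R]
  have h0R : (0 : E) ∈ Metric.ball (0 : E) (|R| + 1) := by simpa using by positivity
  have h := hK.dist_le_mul x hxR 0 h0R
  rw [dist_eq_norm, dist_zero_right] at h
  have h2 : ‖g x‖ ≤ ‖g 0‖ + ‖g x - g 0‖ := by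
    simpa using norm_add_le (g 0) (g x - g 0)
  have h3 : (K : ℝ) * ‖x‖ ≤ K * (|R| + 1) := by
    gcongr; linarith [le_abs_self R]
  push_cast
  rw [Real.coe_toNNReal _ (by positivity)]
  linarith

theorem lipschitzOnWith_mul {X : Type*} [PseudoMetricSpace X] {s : Set X} {f g : X → ℂ}
    {K L M N : ℝ≥0} (hf : LipschitzOnWith K f s) (hg : LipschitzOnWith L g s)
    (hM : ∀ x ∈ s, ‖f x‖ ≤ M) (hN : ∀ x ∈ s, ‖g x‖ ≤ N) :
    LipschitzOnWith (M * L + N * K) (f * g) s := by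
  refine LipschitzOnWith.of_dist_le_mul fun x hx y hy => ?_
  have h1 := hf.dist_le_mul x hx y hy
  have h2 := hg.dist_le_mul x hx y hy
  rw [dist_eq_norm] at h1 h2 ⊢
  have : (f * g) x - (f * g) y = f x * (g x - g y) + (f x - f y) * g y := by
    simp only [Pi.mul_apply]; ring
  rw [this]
  refine (norm_add_le _ _).trans ?_
  rw [norm_mul, norm_mul]
  have h3 : ‖f x‖ * ‖g x - g y‖ ≤ M * (L * dist x y) := by
    gcongr; exact hM x hx
  have h4 : ‖f x - f y‖ * ‖g y‖ ≤ (K * dist x y) * N := by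
    gcongr; exact hN y hy
  push_cast
  linarith

variable (E) in
/-- The algebra of functions that are Lipschitz on every ball. -/
def qLipAlg : Subalgebra ℂ (E → ℂ) where
  carrier := qLip E
  mul_mem' := by
    intro f g hf hg R hR
    obtain ⟨K, hK⟩ := hf R hR
    obtain ⟨L, hL⟩ := hg R hR
    obtain ⟨M, hM⟩ := exists_bound_of_mem_qLip hf R
    obtain ⟨N, hN⟩ := exists_bound_of_mem_qLip hg R
    exact ⟨_, lipschitzOnWith_mul hK hL
      (fun x hx => hM x (mem_ball_zero_iff.1 hx).le) (fun x hx => hN x (mem_ball_zero_iff.1 hx).le)⟩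
  add_mem' := by
    intro f g hf hg R hR
    obtain ⟨K, hK⟩ := hf R hR
    obtain ⟨L, hL⟩ := hg R hR
    exact ⟨K + L, hK.add hL⟩
  algebraMap_mem' c R _ := ⟨0, (LipschitzWith.const c).lipschitzOnWith⟩

theorem mem_qLip_of_lip {g : E → ℂ} (hg : g ∈ lip E) : g ∈ qLip E :=
  fun _ _ => hg.imp fun _ h => h.lipschitzOnWith

theorem mem_qLip_of_lipB {g : E → ℂ} (hg : g ∈ lipB E) : g ∈ qLip E := mem_qLip_of_lip hg.1

theorem mem_qLip_of_qTest {g : E → ℂ} (hg : g ∈ qTest E) : g ∈ qLip E := mem_qLip_of_lip hg.1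

theorem qLip.continuous {g : E → ℂ} (hg : g ∈ qLip E) : Continuous g := by
  refine continuous_iff_continuousAt.2 fun x => ?_
  obtain ⟨K, hK⟩ := hg (‖x‖ + 1) (by positivity)
  exact hK.continuousOn.continuousAt (Metric.isOpen_ball.mem_nhds (by simp))

theorem continuousQ (g : qLipAlg E) : Continuous (g : E → ℂ) := qLip.continuous g.2

theorem exists_boundQ (g : qLipAlg E) (R : ℝ) :
    ∃ M : ℝ≥0, ∀ x, ‖x‖ ≤ R → ‖(g : E → ℂ) x‖ ≤ M := exists_bound_of_mem_qLip g.2 R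

theorem exists_lipQ (g : qLipAlg E) (R : ℝ) :
    ∃ L : ℝ≥0, LipschitzOnWith L (g : E → ℂ) (Metric.ball 0 R) := by
  obtain ⟨L, hL⟩ := g.2 (|R| + 1) (by positivity)
  exact ⟨L, hL.mono (Metric.ball_subset_ball (by linarith [le_abs_self R]))⟩

/-- A function that is Lipschitz on a ball agrees there with a globally Lipschitz one. -/
theorem exists_extensionQ {g : E → ℂ} {L : ℝ≥0} {R : ℝ}
    (hg : LipschitzOnWith L g (Metric.ball 0 R)) :
    ∃ g' : qLipAlg E, LipschitzWith (lipschitzExtensionConstant ℂ * L) (g' : E → ℂ) ∧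
      ∀ x ∈ Metric.ball (0 : E) R, (g' : E → ℂ) x = g x := by
  obtain ⟨g', h1, h2⟩ := hg.extend_finite_dimension
  exact ⟨⟨g', mem_qLip_of_lip ⟨_, h1⟩⟩, h1, fun x hx => (h2 hx).symm⟩

theorem lipschitzWith_re : LipschitzWith 1 Complex.re :=
  LipschitzWith.of_dist_le_mul fun z w => by
    rw [dist_eq_norm, dist_eq_norm, NNReal.coe_one, one_mul, ← Complex.sub_re]
    exact Complex.abs_re_le_norm _

/-- Composition of a real-valued function of the algebra with a Lipschitz function. -/
def compQ (ψ : ℝ → ℂ) (K : ℝ≥0) (hψ : LipschitzWith K ψ) (a : qLipAlg E) : qLipAlg E :=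
  ⟨fun x => ψ ((a : E → ℂ) x).re, fun R hR => by
    obtain ⟨L, hL⟩ := a.2 R hR
    refine ⟨K * (1 * L), hψ.comp_lipschitzOnWith ?_⟩
    exact lipschitzWith_re.comp_lipschitzOnWith hL⟩

@[simp] theorem compQ_apply (ψ : ℝ → ℂ) (K : ℝ≥0) (hψ : LipschitzWith K ψ) (a : qLipAlg E)
    (x : E) : (compQ ψ K hψ a : E → ℂ) x = ψ ((a : E → ℂ) x).re := rfl

theorem compQ_lip {ψ : ℝ → ℂ} {K K' : ℝ≥0} (hψ : LipschitzWith K ψ) (a : qLipAlg E) {R : ℝ}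
    {L : ℝ≥0} (hψ' : LipschitzWith K' ψ)
    (hL : LipschitzOnWith L (a : E → ℂ) (Metric.ball 0 R)) :
    LipschitzOnWith (K' * L) (compQ ψ K hψ a : E → ℂ) (Metric.ball 0 R) := by
  refine hψ'.comp_lipschitzOnWith ?_
  rw [← one_mul L]
  exact lipschitzWith_re.comp_lipschitzOnWith hL

/-- The real part, as an element of the algebra. -/
noncomputable def reQ (a : qLipAlg E) : qLipAlg E :=
  compQ (fun t => (t : ℂ)) 1 (LipschitzWith.of_dist_le_mul fun z w => by
        simp [Complex.dist_eq, Real.dist_eq, ← Complex.ofReal_sub]) a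

/-- The imaginary part, as an element of the algebra. -/
noncomputable def imQ (a : qLipAlg E) : qLipAlg E := reQ (-(Complex.I • a))

/-- Real-valued elements of the algebra. -/
def IsRealQ (a : qLipAlg E) : Prop := ∀ x, (a : E → ℂ) x = (((a : E → ℂ) x).re : ℂ)

theorem isRealQ_reQ (a : qLipAlg E) : IsRealQ (reQ a) := fun x => by
  simp [reQ]

theorem isRealQ_imQ (a : qLipAlg E) : IsRealQ (imQ a) := isRealQ_reQ _

theorem isRealQ_add {a b : qLipAlg E} (ha : IsRealQ a) (hb : IsRealQ b) : IsRealQ (a + b) :=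
  fun x => by
    have h1 := ha x
    have h2 := hb x
    simp only [Subalgebra.coe_add, Pi.add_apply, Complex.add_re, Complex.ofReal_add]
    rw [← h1, ← h2]

theorem reQ_add_imQ (a : qLipAlg E) : a = reQ a + Complex.I • imQ a := by
  ext x
  simp only [reQ, imQ, Subalgebra.coe_add, Pi.add_apply, compQ_apply,
    Subalgebra.coe_smul, Pi.smul_apply, smul_eq_mul, Subalgebra.coe_neg, Pi.neg_apply]
  apply Complex.ext <;> simp

/-- A bilinear form that vanishes on the diagonal of the real-valued functions vanishes on the
diagonal. -/
theorem bilin_diag_eq_zero (B : qLipAlg E →ₗ[ℂ] qLipAlg E →ₗ[ℂ] ℂ)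
    (h : ∀ a : qLipAlg E, IsRealQ a → B a a = 0) (u : qLipAlg E) : B u u = 0 := by
  have h1 := h _ (isRealQ_reQ u)
  have h2 := h _ (isRealQ_imQ u)
  -- The diagonal value at `Re u + Im u` forces the two cross terms to cancel; they are all that
  -- survives in `B u u`.
  have h3 := h _ (isRealQ_add (isRealQ_reQ u) (isRealQ_imQ u))
  simp only [map_add, LinearMap.add_apply, h1, h2] at h3
  rw [reQ_add_imQ u]
  simp only [map_add, LinearMap.add_apply, map_smul, LinearMap.smul_apply, h1, h2, smul_eq_mul]
  linear_combination Complex.I * h3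

end Algebra

/-! ### Inner regularity of finite measures through tightness. -/

section Measure

variable {E : Type*} [NormedAddCommGroup E] [MeasurableSpace E] [BorelSpace E]

theorem exists_isCompact_measure_compl_le (μ : Measure E) [IsFiniteMeasure μ] [μ.InnerRegular]
    {ε : ℝ≥0∞} (hε : ε ≠ 0) : ∃ C : Set E, IsCompact C ∧ μ Cᶜ ≤ ε := by
  obtain ⟨C, -, hC, h⟩ := (MeasurableSet.univ (α := E)).exists_isCompact_sdiff_lt
    (measure_ne_top μ _) hε
  exact ⟨C, hC, by simpa [Set.compl_eq_univ_sdiff] using h.le⟩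

/-- A finite Borel measure on a metric space is always inner regular for closed sets, so cutting a
closed set with a compact set of almost full measure suffices. Tightness is easy to check for sums,
restrictions and images, and `E` need not be separable. -/
theorem innerRegular_of_tight (μ : Measure E) [IsFiniteMeasure μ]
    (h : ∀ ε : ℝ≥0∞, ε ≠ 0 → ∃ C : Set E, IsCompact C ∧ μ Cᶜ ≤ ε) : μ.InnerRegular := by
  refine ⟨fun A hA r hr => ?_⟩
  obtain ⟨F, hFA, hF, hrF⟩ := MeasurableSet.exists_lt_isClosed_of_ne_top hA (measure_ne_top μ A) hr
  have hδ : μ F - r ≠ 0 := (tsub_pos_of_lt hrF).ne'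
  obtain ⟨C, hC, hμC⟩ := h ((μ F - r) / 2) (by simpa using hδ)
  refine ⟨F ∩ C, Set.inter_subset_left.trans hFA, hC.inter_left hF, ?_⟩
  have h1 : μ F ≤ μ (F ∩ C) + μ Cᶜ := by
    refine (measure_mono ?_).trans (measure_union_le _ _)
    intro x hx
    by_cases hxC : x ∈ C
    · exact Or.inl ⟨hx, hxC⟩
    · exact Or.inr hxC
  have hfin : μ F - r ≠ ∞ := (tsub_le_self.trans_lt (measure_lt_top μ F)).ne
  have h2 : μ Cᶜ < μ F - r := hμC.trans_lt (ENNReal.half_lt_self hδ hfin)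
  by_contra hcon
  push Not at hcon
  have h3 : μ (F ∩ C) + μ Cᶜ < r + (μ F - r) :=
    ENNReal.add_lt_add_of_le_of_lt (hcon.trans_lt (hrF.trans (measure_lt_top μ F))).ne hcon h2
  rw [add_tsub_cancel_of_le hrF.le] at h3
  exact absurd (h1.trans_lt h3) (lt_irrefl _)

theorem innerRegular_add (μ ν : Measure E) [IsFiniteMeasure μ] [IsFiniteMeasure ν] [μ.InnerRegular]
    [ν.InnerRegular] : (μ + ν).InnerRegular := by
  refine innerRegular_of_tight _ fun ε hε => ?_
  obtain ⟨C, hC, h1⟩ := exists_isCompact_measure_compl_le μ (ε := ε / 2) (by simpa using hε)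
  obtain ⟨D, hD, h2⟩ := exists_isCompact_measure_compl_le ν (ε := ε / 2) (by simpa using hε)
  refine ⟨C ∪ D, hC.union hD, ?_⟩
  rw [Measure.add_apply, ← ENNReal.add_halves ε]
  gcongr
  · exact (measure_mono (Set.compl_subset_compl.2 Set.subset_union_left)).trans h1
  · exact (measure_mono (Set.compl_subset_compl.2 Set.subset_union_right)).trans h2

end Measure

/-! ### Chain rule and product rule for local functionals of finite mass. -/

section Chain

variable {E : Type*} [NormedAddCommGroup E] [MeasurableSpace E] [BorelSpace E]

theorem aestronglyMeasurable_of_continuous_of_ae {μ : Measure E} {g : E → ℂ} (hg : Continuous g) :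
    AEStronglyMeasurable g μ := hg.measurable.aestronglyMeasurable

theorem integrableQ {μ : Measure E} [IsFiniteMeasure μ] {ρ : ℝ} (hμ : ∀ᵐ x ∂μ, ‖x‖ < ρ)
    (f : qLipAlg E) : Integrable (f : E → ℂ) μ := by
  obtain ⟨M, hM⟩ := exists_boundQ f ρ
  refine Integrable.of_bound (C := M)
    (aestronglyMeasurable_of_continuous_of_ae (continuousQ f)) ?_
  filter_upwards [hμ] with x hx using hM x hx.le

/-- The mass bound of a functional `Φ (f, g)`, linear in both arguments, and its locality in `g`. -/
structure BilinTame (Φ : qLipAlg E →ₗ[ℂ] qLipAlg E →ₗ[ℂ] ℂ) (ρ C : ℝ) (μ : Measure E) : Prop where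
  bound : ∀ (f g : qLipAlg E) (L : ℝ≥0), LipschitzOnWith L (g : E → ℂ) (Metric.ball 0 ρ) →
    ‖Φ f g‖ ≤ C * L * ∫ x, ‖(f : E → ℂ) x‖ ∂μ
  loc : ∀ (f g : qLipAlg E) (c : ℂ) (W : Set E), IsOpen W → tsupport (f : E → ℂ) ⊆ W →
    (∀ x ∈ W, (g : E → ℂ) x = c) → Φ f g = 0

variable {Φ : qLipAlg E →ₗ[ℂ] qLipAlg E →ₗ[ℂ] ℂ} {ρ C : ℝ} {μ : Measure E}

omit [BorelSpace E] in
theorem BilinTame.congr_left (h : BilinTame Φ ρ C μ) (hμ : ∀ᵐ x ∂μ, ‖x‖ < ρ) {f f' : qLipAlg E}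
    (hf : ∀ x, ‖x‖ < ρ → (f : E → ℂ) x = (f' : E → ℂ) x) (g : qLipAlg E) : Φ f g = Φ f' g := by
  rw [← sub_eq_zero, ← LinearMap.sub_apply, ← map_sub]
  obtain ⟨L, hL⟩ := exists_lipQ g ρ
  have h1 := h.bound (f - f') g L hL
  have h2 : ∫ x, ‖((f - f' : qLipAlg E) : E → ℂ) x‖ ∂μ = 0 := by
    rw [integral_eq_zero_of_ae]
    filter_upwards [hμ] with x hx
    simp [hf x hx]
  rw [h2, mul_zero] at h1
  exact norm_le_zero_iff.1 h1

/-- On an interval of radius `h` the error of linearisation has Lipschitz constant `O(h)`. This gain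
is what makes the chain rule exact in the limit. -/
theorem lipschitzOnWith_taylor {ψ ψ' : ℝ → ℂ} {K : ℝ≥0} (hψ : ∀ t, HasDerivAt ψ (ψ' t) t)
    (hK : LipschitzWith K ψ') (c : ℝ) (h : ℝ≥0) :
    LipschitzOnWith (K * h) (fun s => ψ s - ψ' c * s) (Set.Icc (c - h) (c + h)) := by
  refine (convex_Icc _ _).lipschitzOnWith_of_nnnorm_hasDerivWithin_le
    (f' := fun s => ψ' s - ψ' c) (fun s _ => ?_) fun s hs => ?_
  · have := (hψ s).sub (((hasDerivAt_id s).ofReal_comp).const_mul (ψ' c))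
    rw [Complex.ofReal_one, mul_one] at this
    exact this.hasDerivWithinAt
  · rw [← NNReal.coe_le_coe, coe_nnnorm, ← dist_eq_norm]
    refine (hK.dist_le_mul s c).trans ?_
    push_cast
    gcongr
    rw [Real.dist_eq, abs_le]
    constructor <;> linarith [hs.1, hs.2]

/-- Where `a` is within `h` of `c`, the function `ψ ∘ a` is replaced by `ψ' c • a`. The constant 3
is 2 for the Lipschitz constant of the linearisation error on the interval of radius `2h`, plus 1
for the change of `ψ' ∘ a` into `ψ' c` on the support of `f`. -/
theorem BilinTame.chain_local (hΦ : BilinTame Φ ρ C μ) (hC : 0 ≤ C) [IsFiniteMeasure μ]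
    (hμ : ∀ᵐ x ∂μ, ‖x‖ < ρ)
    {ψ ψ' : ℝ → ℂ} {K : ℝ≥0} (hψ : ∀ t, HasDerivAt ψ (ψ' t) t) (hK : LipschitzWith K ψ')
    {a pa dpa : qLipAlg E} (ha : IsRealQ a) {L : ℝ≥0}
    (hL : LipschitzOnWith L (a : E → ℂ) (Metric.ball 0 ρ))
    (hpa : ∀ x, (pa : E → ℂ) x = ψ ((a : E → ℂ) x).re)
    (hdpa : ∀ x, (dpa : E → ℂ) x = ψ' ((a : E → ℂ) x).re) {h : ℝ≥0} (hh : 0 < h) (c : ℝ)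
    (f : qLipAlg E) (hf : ∀ x, (f : E → ℂ) x ≠ 0 → |((a : E → ℂ) x).re - c| ≤ h) :
    ‖Φ f pa - Φ (f * dpa) a‖ ≤ C * (3 * K * L) * h * ∫ x, ‖(f : E → ℂ) x‖ ∂μ := by
  have hacont : Continuous fun x => |((a : E → ℂ) x).re - c| :=
    ((Complex.continuous_re.comp (continuousQ a)).sub continuous_const).abs
  have hsupp : tsupport (f : E → ℂ) ⊆ {x | |((a : E → ℂ) x).re - c| ≤ h} :=
    closure_minimal (fun x hx => hf x hx) (isClosed_le hacont continuous_const)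
  -- The doubled radius leaves an open neighbourhood of `supp f`, as locality requires. Extending
  -- the error by constants off the interval makes it globally Lipschitz.
  have hlip := (lipschitzOnWith_taylor hψ hK c (2 * h))
  have hle : c - (2 * h : ℝ≥0) ≤ c + (2 * h : ℝ≥0) := by
    have : (0 : ℝ) ≤ (2 * h : ℝ≥0) := NNReal.coe_nonneg _
    linarith
  have hext : LipschitzWith (K * (2 * h))
      (Set.IccExtend hle ((Set.Icc (c - (2 * h : ℝ≥0)) (c + (2 * h : ℝ≥0))).domRestrict
        fun s => ψ s - ψ' c * s)) := by
    have := (lipschitzOnWith_iff_restrict.1 hlip).comp (LipschitzWith.projIcc hle)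
    rwa [mul_one] at this
  set g' := compQ _ _ hext a with hg'
  have h1 : Φ f (pa - ψ' c • a) = Φ f g' := by
    rw [← sub_eq_zero, ← map_sub]
    refine hΦ.loc f _ 0 {x | |((a : E → ℂ) x).re - c| < 2 * h}
      (isOpen_lt hacont continuous_const) (hsupp.trans fun x hx => ?_) fun x hx => ?_
    · have : (0 : ℝ) < h := hh
      simp only [Set.mem_ofPred_eq] at hx ⊢
      linarith
    · have hmem : ((a : E → ℂ) x).re ∈ Set.Icc (c - (2 * h : ℝ≥0)) (c + (2 * h : ℝ≥0)) := by
        simp only [Set.mem_ofPred_eq, abs_lt] at hx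
        push_cast
        constructor <;> linarith [hx.1, hx.2]
      simp only [Subalgebra.coe_sub, Pi.sub_apply, Subalgebra.coe_smul, Pi.smul_apply, smul_eq_mul,
        hpa, hg', compQ_apply]
      rw [Set.IccExtend_of_mem _ _ hmem]
      simp only [Set.domRestrict_apply]
      rw [sub_eq_zero]
      congr 2
      exact ha x
  have h2 : Φ f pa - Φ (f * dpa) a = Φ f g' - Φ (f * dpa - ψ' c • f) a := by
    rw [← h1]
    simp only [map_sub, map_smul, LinearMap.sub_apply, LinearMap.smul_apply]
    ring
  rw [h2]
  refine (norm_sub_le _ _).trans ?_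
  have h3 := hΦ.bound f g' _ (compQ_lip hext a hext hL)
  have h4 := hΦ.bound (f * dpa - ψ' c • f) a L hL
  have h5 : ∫ x, ‖((f * dpa - ψ' c • f : qLipAlg E) : E → ℂ) x‖ ∂μ ≤
      K * h * ∫ x, ‖(f : E → ℂ) x‖ ∂μ := by
    rw [← integral_const_mul]
    refine integral_mono (integrableQ hμ _).norm ((integrableQ hμ _).norm.const_mul _) fun x => ?_
    simp only [Subalgebra.coe_sub, Pi.sub_apply, Subalgebra.coe_smul, Pi.smul_apply, smul_eq_mul,
        Subalgebra.coe_mul, Pi.mul_apply, hdpa]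
    by_cases hx : (f : E → ℂ) x = 0
    · simp [hx]
    · rw [mul_comm (ψ' c), ← mul_sub, norm_mul, mul_comm]
      gcongr
      rw [← dist_eq_norm]
      refine (hK.dist_le_mul _ _).trans ?_
      gcongr
      exact hf x hx
  have h6 : C * L * ∫ x, ‖((f * dpa - ψ' c • f : qLipAlg E) : E → ℂ) x‖ ∂μ ≤
      C * L * (K * h * ∫ x, ‖(f : E → ℂ) x‖ ∂μ) := by gcongr
  refine (add_le_add h3 (h4.trans h6)).trans (le_of_eq ?_)
  push_cast
  ring

/-- The ramp function from `0` at `j` to `1` at `j + 1`. -/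
noncomputable def ramp (j t : ℝ) : ℝ := max 0 (min 1 (t - j))

theorem ramp_eq_one {j t : ℝ} (h : j + 1 ≤ t) : ramp j t = 1 := by
  rw [ramp, min_eq_left (by linarith), max_eq_right zero_le_one]

theorem ramp_eq_zero {j t : ℝ} (h : t ≤ j) : ramp j t = 0 := by
  rw [ramp, max_eq_left]
  exact (min_le_right _ _).trans (by linarith)

theorem ramp_anti (t : ℝ) {j j' : ℝ} (h : j ≤ j') : ramp j' t ≤ ramp j t := by
  unfold ramp
  gcongr

theorem lipschitzWith_ramp (j : ℝ) : LipschitzWith 1 (ramp j) :=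
  ((LipschitzWith.id.sub (LipschitzWith.const j)).const_min 1 |>.const_max 0).weaken (by simp)

omit [MeasurableSpace E] [BorelSpace E] in
-- The members are tent functions of `Re a`, differences of consecutive ramps, so that their sum
-- telescopes. The shift by 1 inside the ramps makes the first ramp equal to 1 on the whole ball,
-- and `N` is so large that the last one is 0 there.
theorem exists_partition (a : qLipAlg E) (ρ : ℝ) {h : ℝ≥0} (hh : 0 < h) :
    ∃ (N : ℕ) (T : ℕ → qLipAlg E) (τ : ℕ → E → ℝ) (c : ℕ → ℝ),
      (∀ k x, (T k : E → ℂ) x = (τ k x : ℂ)) ∧ (∀ k x, 0 ≤ τ k x) ∧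
      (∀ k x, τ k x ≠ 0 → |((a : E → ℂ) x).re - c k| ≤ h) ∧
      ∀ x, ‖x‖ < ρ → ∑ k ∈ Finset.range N, τ k x = 1 := by
  obtain ⟨M, hM⟩ := exists_boundQ a ρ
  have hh' : (0 : ℝ) < h := hh
  obtain ⟨N, hN⟩ := exists_nat_ge (2 * M / h + 1 : ℝ)
  have hlip : ∀ k : ℕ, ∃ K, LipschitzWith K
      (fun s : ℝ => ((ramp k ((s + M) / h + 1) - ramp (k + 1 : ℕ) ((s + M) / h + 1) : ℝ) : ℂ)) := by
    intro k
    have h0 : LipschitzWith h⁻¹ fun s : ℝ => (s + M) / h + 1 := by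
      refine LipschitzWith.of_dist_le_mul fun s t => ?_
      rw [Real.dist_eq, Real.dist_eq]
      have : (s + M) / h + 1 - ((t + M) / h + 1) = (h : ℝ)⁻¹ * (s - t) := by
        field_simp; ring
      rw [this, abs_mul, abs_of_pos (inv_pos.2 hh'), NNReal.coe_inv]
    have h1 := ((lipschitzWith_ramp k).comp h0).sub ((lipschitzWith_ramp (k + 1 : ℕ)).comp h0)
    refine ⟨1 * h⁻¹ + 1 * h⁻¹, LipschitzWith.of_dist_le_mul fun s t => ?_⟩
    rw [Complex.dist_eq, ← Complex.ofReal_sub, Complex.norm_real, ← dist_eq_norm]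
    exact h1.dist_le_mul s t
  choose K hK using hlip
  refine ⟨N, fun k => compQ _ _ (hK k) a, fun k x =>
    ramp k ((((a : E → ℂ) x).re + M) / h + 1) - ramp (k + 1 : ℕ) ((((a : E → ℂ) x).re + M) / h + 1),
    fun k => k * h - M, fun k x => rfl, fun k x => ?_, fun k x hx => ?_, fun x hx => ?_⟩
  · exact sub_nonneg.2 (ramp_anti _ (by push_cast; linarith))
  · set s := ((a : E → ℂ) x).re
    by_contra hcon
    apply hx
    have hs : (s + M) / h = k + (s - (k * h - M)) / h := by field_simp; ring
    rcases lt_abs.1 (not_le.1 hcon) with h1 | h1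
    · have : 1 < (s - (k * h - M)) / h := (one_lt_div hh').2 h1
      simp only
      rw [ramp_eq_one (by rw [hs]; linarith),
        ramp_eq_one (by rw [hs]; push_cast; linarith), sub_self]
    · have : (s - (k * h - M)) / h < -1 := by
        rw [div_lt_iff₀ hh']; linarith
      simp only
      rw [ramp_eq_zero (by rw [hs]; linarith),
        ramp_eq_zero (by rw [hs]; push_cast; linarith), sub_self]
  · have hb := (Complex.abs_re_le_norm _).trans (hM x hx.le)
    rw [abs_le] at hb
    rw [Finset.sum_range_sub' (fun k : ℕ => ramp k ((((a : E → ℂ) x).re + M) / h + 1)),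
      ramp_eq_one, ramp_eq_zero, sub_zero]
    · refine le_trans ?_ hN
      gcongr
      linarith
    · have : 0 ≤ (((a : E → ℂ) x).re + M) / h := div_nonneg (by linarith) hh'.le
      push_cast; linarith

/-- The local estimates are summed over a partition into level slabs of `a` of width `h`. The tents
are nonnegative with sum 1, so the total error is `O(h)` times `∫ ‖f‖`, with no factor for the
number of slabs; then `h → 0`. -/
theorem BilinTame.chain (hΦ : BilinTame Φ ρ C μ) (hC : 0 ≤ C) [IsFiniteMeasure μ]
    (hμ : ∀ᵐ x ∂μ, ‖x‖ < ρ)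
    {ψ ψ' : ℝ → ℂ} {K : ℝ≥0} (hψ : ∀ t, HasDerivAt ψ (ψ' t) t) (hK : LipschitzWith K ψ')
    {a pa dpa : qLipAlg E} (ha : IsRealQ a)
    (hpa : ∀ x, (pa : E → ℂ) x = ψ ((a : E → ℂ) x).re)
    (hdpa : ∀ x, (dpa : E → ℂ) x = ψ' ((a : E → ℂ) x).re) (f : qLipAlg E) :
    Φ f pa = Φ (f * dpa) a := by
  obtain ⟨L, hL⟩ := exists_lipQ a ρ
  set I := ∫ x, ‖(f : E → ℂ) x‖ ∂μ
  have key : ∀ h : ℝ≥0, 0 < h → ‖Φ f pa - Φ (f * dpa) a‖ ≤ C * (3 * K * L) * I * h := by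
    intro h hh
    obtain ⟨N, T, τ, c, hT, hτ0, hτc, hτ1⟩ := exists_partition a ρ hh
    have hsum : ∀ x, ‖x‖ < ρ →
        (f : E → ℂ) x = ((∑ k ∈ Finset.range N, f * T k : qLipAlg E) : E → ℂ) x := by
      intro x hx
      rw [← Finset.mul_sum]
      simp only [Subalgebra.coe_mul, Pi.mul_apply, AddSubmonoidClass.coe_finsetSum,
        Finset.sum_apply, hT]
      rw [← Complex.ofReal_sum, hτ1 x hx, Complex.ofReal_one, mul_one]
    have hsum' : ∀ x, ‖x‖ < ρ → ((f * dpa : qLipAlg E) : E → ℂ) x =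
        (((∑ k ∈ Finset.range N, f * T k) * dpa : qLipAlg E) : E → ℂ) x := by
      intro x hx
      simp only [Subalgebra.coe_mul, Pi.mul_apply]
      rw [hsum x hx]
    rw [hΦ.congr_left hμ hsum, hΦ.congr_left hμ hsum', Finset.sum_mul, map_sum, map_sum,
      LinearMap.sum_apply, LinearMap.sum_apply, ← Finset.sum_sub_distrib]
    refine (norm_sum_le _ _).trans ?_
    have h1 : ∀ k ∈ Finset.range N, ‖Φ (f * T k) pa - Φ (f * T k * dpa) a‖ ≤
        C * (3 * K * L) * h * ∫ x, ‖((f * T k : qLipAlg E) : E → ℂ) x‖ ∂μ := by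
      intro k _
      refine hΦ.chain_local hC hμ hψ hK ha hL hpa hdpa hh (c k) _ fun x hx => hτc k x ?_
      intro h0
      simp [hT, h0] at hx
    refine (Finset.sum_le_sum h1).trans ?_
    rw [← Finset.mul_sum, ← integral_finsetSum _ fun k _ => (integrableQ hμ _).norm]
    have h2 : ∫ x, ∑ k ∈ Finset.range N, ‖((f * T k : qLipAlg E) : E → ℂ) x‖ ∂μ = I := by
      refine integral_congr_ae ?_
      filter_upwards [hμ] with x hx
      have : ∀ k, ‖((f * T k : qLipAlg E) : E → ℂ) x‖ = ‖(f : E → ℂ) x‖ * τ k x := by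
        intro k
        simp [hT, abs_of_nonneg (hτ0 k x)]
      simp only [this]
      rw [← Finset.mul_sum, hτ1 x hx, mul_one]
    rw [h2]
    apply le_of_eq; ring
  have hlim : Tendsto (fun n : ℕ => C * (3 * K * L) * I * (1 / ((n : ℝ) + 1))) atTop (𝓝 0) := by
    simpa using tendsto_one_div_add_atTop_nhds_zero_nat.const_mul (C * (3 * K * L) * I)
  have := ge_of_tendsto' hlim (b := ‖Φ f pa - Φ (f * dpa) a‖) fun n => by
    have := key (1 / ((n : ℝ≥0) + 1)) (by positivity)
    simpa using this
  exact sub_eq_zero.1 (norm_le_zero_iff.1 this)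

/-- The product rule. -/
theorem BilinTame.leibniz (hΦ : BilinTame Φ ρ C μ) (hC : 0 ≤ C) [IsFiniteMeasure μ]
    (hμ : ∀ᵐ x ∂μ, ‖x‖ < ρ) (f u v : qLipAlg E) :
    Φ f (u * v) = Φ (f * u) v + Φ (f * v) u := by
  -- `B` is the defect of the product rule. The chain rule for `t ↦ t²` kills it on the diagonal of
  -- real-valued functions, hence on the whole diagonal; being symmetric, it vanishes by
  -- polarisation.
  let B : qLipAlg E →ₗ[ℂ] qLipAlg E →ₗ[ℂ] ℂ := LinearMap.mk₂ ℂ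
    (fun u v => Φ f (u * v) - (Φ (f * u) v + Φ (f * v) u))
    (fun u u' v => by simp only [add_mul, mul_add, map_add, LinearMap.add_apply]; ring)
    (fun c u v => by
      simp only [smul_mul_assoc, mul_smul_comm, map_smul, LinearMap.smul_apply, smul_eq_mul]; ring)
    (fun u v v' => by simp only [mul_add, map_add, LinearMap.add_apply]; ring)
    (fun c u v => by
      simp only [mul_smul_comm, map_smul, LinearMap.smul_apply, smul_eq_mul]; ring)
  have hB : ∀ u v, B u v = Φ f (u * v) - (Φ (f * u) v + Φ (f * v) u) := fun _ _ => rfl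
  have hreal : ∀ a : qLipAlg E, IsRealQ a → B a a = 0 := by
    intro a ha
    have hK : LipschitzWith 2 fun t : ℝ => (2 * t : ℂ) := by
      refine LipschitzWith.of_dist_le_mul fun s t => ?_
      rw [dist_eq_norm, ← mul_sub, norm_mul, ← Complex.ofReal_sub, Complex.norm_real, Real.dist_eq]
      simp
    have := hΦ.chain hC hμ (ψ := fun t => (t : ℂ) ^ 2) (ψ' := fun t => 2 * t) (K := 2)
      (fun t => by
        have h := ((hasDerivAt_id t).ofReal_comp).pow 2
        have e : ((2 : ℕ) : ℂ) * ((id t : ℝ) : ℂ) ^ (2 - 1) * ((1 : ℝ) : ℂ) = 2 * t := by simp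
        rw [e] at h
        exact h) hK
      (a := a) (pa := a * a) (dpa := (2 : ℂ) • a) ha
      (fun x => by
        have := ha x
        simp only [Subalgebra.coe_mul, Pi.mul_apply]
        rw [← this]; ring)
      (fun x => by
        have := ha x
        simp only [Subalgebra.coe_smul, Pi.smul_apply, smul_eq_mul]
        rw [← this]) f
    rw [hB, this]
    simp only [mul_smul_comm, map_smul, LinearMap.smul_apply, smul_eq_mul]
    ring
  have hdiag := bilin_diag_eq_zero B hreal
  have h1 := hdiag (u + v)
  simp only [map_add, LinearMap.add_apply, hdiag] at h1
  have hsymm : B u v = B v u := by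
    rw [hB, hB, mul_comm u v]; ring
  have h2 : B u v = 0 := by
    rw [← hsymm] at h1
    have : 2 * B u v = 0 := by linear_combination h1
    simpa using this
  rw [hB] at h2
  exact sub_eq_zero.1 h2

end Chain

/-! ### Forms on the algebra, and why currents are alternating. -/

section Forms

variable {E : Type*} [NormedAddCommGroup E] [MeasurableSpace E] [BorelSpace E]

/-- Functionals on `(f, π₁, …, π_k)`, linear in `f` and alternating in the `π_i`, for functions that
are Lipschitz on every ball. -/
abbrev Form (E : Type*) [NormedAddCommGroup E] (k : ℕ) : Type _ :=
  qLipAlg E →ₗ[ℂ] (qLipAlg E [⋀^Fin k]→ₗ[ℂ] ℂ)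

/-- Equi-Lipschitz on every ball. -/
def EquiLip {k : ℕ} (πs : ℕ → Fin k → qLipAlg E) : Prop :=
  ∀ i (R : ℝ), ∃ C : ℝ≥0, ∀ n, LipschitzOnWith C (πs n i : E → ℂ) (Metric.ball 0 R)

/-- Pointwise convergence. -/
def TendsPt {k : ℕ} (πs : ℕ → Fin k → qLipAlg E) (π : Fin k → qLipAlg E) : Prop :=
  ∀ i x, Tendsto (fun n => (πs n i : E → ℂ) x) atTop (𝓝 ((π i : E → ℂ) x))

/-- Sequential continuity in the `π_i`. -/
def SeqCont {k : ℕ} (G : qLipAlg E → (Fin k → qLipAlg E) → ℂ) : Prop :=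
  ∀ f πs π, EquiLip πs → TendsPt πs π → Tendsto (fun n => G f (πs n)) atTop (𝓝 (G f π))

/-- A functional that is local and has finite mass, carried by a bounded set. -/
structure Tame {k : ℕ} (G : qLipAlg E → (Fin k → qLipAlg E) → ℂ) (ρ : ℝ) (μ : Measure E) :
    Prop where
  finite : IsFiniteMeasure μ
  inner : μ.InnerRegular
  conc : ∀ᵐ x ∂μ, ‖x‖ < ρ
  bound : ∀ (f : qLipAlg E) (π : Fin k → qLipAlg E) (L : Fin k → ℝ≥0),
    (∀ i, LipschitzOnWith (L i) (π i : E → ℂ) (Metric.ball 0 ρ)) →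
      ‖G f π‖ ≤ (∏ i, (L i : ℝ)) * ∫ x, ‖(f : E → ℂ) x‖ ∂μ
  loc : ∀ (f : qLipAlg E) (π : Fin k → qLipAlg E) (i : Fin k) (c : ℂ) (W : Set E), IsOpen W →
    tsupport (f : E → ℂ) ⊆ W → (∀ x ∈ W, (π i : E → ℂ) x = c) → G f π = 0

variable {k : ℕ} {ρ : ℝ} {μ : Measure E}

/-- The bilinear functional obtained by fixing all slots but one. -/
def slot (M : qLipAlg E →ₗ[ℂ] MultilinearMap ℂ (fun _ : Fin k => qLipAlg E) ℂ)
    (π : Fin k → qLipAlg E) (i : Fin k) : qLipAlg E →ₗ[ℂ] qLipAlg E →ₗ[ℂ] ℂ :=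
  LinearMap.mk₂ ℂ (fun f g => M f (Function.update π i g))
    (fun f f' g => by simp) (fun c f g => by simp) (fun f g g' => by simp) (fun c f g => by simp)

omit [MeasurableSpace E] [BorelSpace E] in
@[simp] theorem slot_apply (M : qLipAlg E →ₗ[ℂ] MultilinearMap ℂ (fun _ : Fin k => qLipAlg E) ℂ)
    (π : Fin k → qLipAlg E) (i : Fin k) (f g : qLipAlg E) :
    slot M π i f g = M f (Function.update π i g) := rfl

omit [MeasurableSpace E] [BorelSpace E] in
theorem lip_update {π : Fin k → qLipAlg E} {L : Fin k → ℝ≥0}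
    (hL : ∀ i, LipschitzOnWith (L i) (π i : E → ℂ) (Metric.ball 0 ρ)) {i : Fin k} {g : qLipAlg E}
    {Lg : ℝ≥0} (hg : LipschitzOnWith Lg (g : E → ℂ) (Metric.ball 0 ρ)) (j : Fin k) :
    LipschitzOnWith (Function.update L i Lg j) (Function.update π i g j : E → ℂ)
      (Metric.ball 0 ρ) := by
  by_cases hj : j = i
  · subst hj; simpa using hg
  · simpa [Function.update_of_ne hj] using hL j

theorem prod_update_coe (L : Fin k → ℝ≥0) (i : Fin k) (Lg : ℝ≥0) :
    ∏ j, (Function.update L i Lg j : ℝ) = Lg * ∏ j ∈ Finset.univ \ {i}, (L j : ℝ) := by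
  have := Finset.prod_update_of_mem (Finset.mem_univ i) L Lg
  exact_mod_cast this

omit [BorelSpace E] in
theorem Tame.slot {M : qLipAlg E →ₗ[ℂ] MultilinearMap ℂ (fun _ : Fin k => qLipAlg E) ℂ}
    (hM : Tame (fun f => ⇑(M f)) ρ μ) {π : Fin k → qLipAlg E} {L : Fin k → ℝ≥0}
    (hL : ∀ i, LipschitzOnWith (L i) (π i : E → ℂ) (Metric.ball 0 ρ)) (i : Fin k) :
    BilinTame (MetricCurrents.slot M π i) ρ (∏ j ∈ Finset.univ \ {i}, (L j : ℝ)) μ where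
  bound f g Lg hg := by
    have := hM.bound f _ _ (lip_update hL (i := i) hg)
    rw [prod_update_coe] at this
    rw [slot_apply]
    linarith
  loc f g c W hW hf hg := hM.loc f _ i c W hW hf (by simpa using hg)

theorem lipschitzWith_exp (s : ℝ) : LipschitzWith ‖s‖₊ fun t : ℝ => Complex.exp (Complex.I * (s * t)) := by
  refine LipschitzWith.of_dist_le_mul fun t u => ?_
  have h : Complex.exp (Complex.I * (s * t)) - Complex.exp (Complex.I * (s * u)) =
      Complex.exp (Complex.I * (s * u : ℝ)) *
        (Complex.exp (Complex.I * (s * (t - u) : ℝ)) - 1) := by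
    rw [mul_sub, ← Complex.exp_add, mul_one]
    congr 2 <;> push_cast <;> ring
  rw [dist_eq_norm, h, norm_mul, mul_comm Complex.I, Complex.norm_exp_ofReal_mul_I, one_mul]
  refine Real.norm_exp_I_mul_ofReal_sub_one_le.trans ?_
  rw [norm_mul, Real.dist_eq, coe_nnnorm, Real.norm_eq_abs (t - u)]

/-- The function `exp (i σ m a) / m`, for real-valued `a`. -/
noncomputable def wave (σ m : ℝ) (a : qLipAlg E) : qLipAlg E :=
  (1 / m : ℂ) • compQ _ _ (lipschitzWith_exp (σ * m)) a

omit [MeasurableSpace E] [BorelSpace E] in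
theorem wave_apply (σ m : ℝ) (a : qLipAlg E) (x : E) : (wave σ m a : E → ℂ) x =
    (1 / m : ℂ) * Complex.exp (Complex.I * ((σ * m : ℝ) * ((a : E → ℂ) x).re)) := rfl

theorem wave_chain {Φ : qLipAlg E →ₗ[ℂ] qLipAlg E →ₗ[ℂ] ℂ} {C : ℝ} (hΦ : BilinTame Φ ρ C μ)
    (hC : 0 ≤ C) [IsFiniteMeasure μ] (hμ : ∀ᵐ x ∂μ, ‖x‖ < ρ) {a : qLipAlg E} (ha : IsRealQ a)
    (σ m : ℝ) (hm : 0 < m) (f : qLipAlg E) :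
    Φ f (wave σ m a) = Φ (f * ((Complex.I * σ * m) • wave σ m a)) a := by
  have hm' : (m : ℂ) ≠ 0 := by exact_mod_cast hm.ne'
  refine hΦ.chain hC hμ
    (ψ := fun t => (1 / m : ℂ) * Complex.exp (Complex.I * ((σ * m : ℝ) * t)))
    (ψ' := fun t => Complex.I * σ * Complex.exp (Complex.I * ((σ * m : ℝ) * t)))
    (K := ‖Complex.I * σ‖₊ * ‖σ * m‖₊) (fun t => ?_) ?_ ha (fun x => rfl) (fun x => ?_) f
  · have h1 := ((((hasDerivAt_id t).ofReal_comp).const_mul ((σ * m : ℝ) : ℂ)).const_mul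
      Complex.I).cexp.const_mul (1 / m : ℂ)
    have e : Complex.I * σ * Complex.exp (Complex.I * ((σ * m : ℝ) * t)) = (1 / m : ℂ) *
        (Complex.exp (Complex.I * ((σ * m : ℝ) * t)) *
          (Complex.I * (((σ * m : ℝ) : ℂ) * ((1 : ℝ) : ℂ)))) := by
      push_cast
      field_simp
    simp only [e]
    exact h1
  · refine LipschitzWith.of_dist_le_mul fun s t => ?_
    rw [dist_eq_norm, ← mul_sub, norm_mul, ← dist_eq_norm, NNReal.coe_mul, mul_assoc]
    exact mul_le_mul_of_nonneg_left ((lipschitzWith_exp (σ * m)).dist_le_mul s t) (norm_nonneg _)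
  · simp only [Subalgebra.coe_smul, Pi.smul_apply, wave_apply, smul_eq_mul]
    field_simp

omit [MeasurableSpace E] [BorelSpace E] in
theorem equiLip_const (π : Fin k → qLipAlg E) : EquiLip fun _ => π := fun i R =>
  (exists_lipQ (π i) R).imp fun _ h _ => h

omit [MeasurableSpace E] [BorelSpace E] in
theorem EquiLip.update {πs : ℕ → Fin k → qLipAlg E} (h : EquiLip πs) {i : Fin k}
    {gs : ℕ → qLipAlg E}
    (hg : ∀ R : ℝ, ∃ C : ℝ≥0, ∀ n, LipschitzOnWith C (gs n : E → ℂ) (Metric.ball 0 R)) :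
    EquiLip fun n => Function.update (πs n) i (gs n) := by
  intro j R
  by_cases hj : j = i
  · subst hj; simpa using hg R
  · simpa [Function.update_of_ne hj] using h j R

omit [MeasurableSpace E] [BorelSpace E] in
theorem TendsPt.update {πs : ℕ → Fin k → qLipAlg E} {π : Fin k → qLipAlg E} (h : TendsPt πs π)
    {i : Fin k} {gs : ℕ → qLipAlg E} {g : qLipAlg E}
    (hg : ∀ x, Tendsto (fun n => (gs n : E → ℂ) x) atTop (𝓝 ((g : E → ℂ) x))) :
    TendsPt (fun n => Function.update (πs n) i (gs n)) (Function.update π i g) := by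
  intro j x
  by_cases hj : j = i
  · subst hj; simpa using hg x
  · simpa [Function.update_of_ne hj] using h j x

omit [MeasurableSpace E] [BorelSpace E] in
-- The factor `1/m` compensates the frequency `m`: the waves stay equi-Lipschitz on balls although
-- they tend to 0, which is the mode of convergence that currents respect.
theorem wave_lip (a : qLipAlg E) {σ : ℝ} (hσ : |σ| = 1) (R : ℝ) : ∃ C : ℝ≥0, ∀ n : ℕ,
    LipschitzOnWith C (wave σ (n + 1) a : E → ℂ) (Metric.ball 0 R) := by
  obtain ⟨L, hL⟩ := exists_lipQ a R
  refine ⟨L, fun n => LipschitzOnWith.of_dist_le_mul fun x hx y hy => ?_⟩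
  have h := (compQ_lip (lipschitzWith_exp (σ * (n + 1))) a (lipschitzWith_exp (σ * (n + 1)))
    hL).dist_le_mul x hx y hy
  have hn : (0 : ℝ) < n + 1 := by positivity
  have e : (wave σ (n + 1) a : E → ℂ) = (1 / ((n + 1 : ℝ) : ℂ)) •
    (compQ _ _ (lipschitzWith_exp (σ * (n + 1))) a : E → ℂ) := by
      simp [wave]
  rw [e, dist_eq_norm, Pi.smul_apply, Pi.smul_apply, ← smul_sub, norm_smul, ← dist_eq_norm]
  have e2 : ‖(1 / ((n + 1 : ℝ) : ℂ))‖ = 1 / (n + 1) := by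
    rw [show (1 / ((n + 1 : ℝ) : ℂ)) = ((1 / (n + 1) : ℝ) : ℂ) by push_cast; rfl,
      Complex.norm_real, Real.norm_of_nonneg (by positivity)]
  rw [e2]
  have e3 : ((‖σ * (n + 1)‖₊ * L : ℝ≥0) : ℝ) = (n + 1) * L := by
    rw [NNReal.coe_mul, coe_nnnorm, norm_mul, Real.norm_eq_abs, hσ, one_mul,
      Real.norm_of_nonneg hn.le]
  rw [e3] at h
  calc 1 / ((n : ℝ) + 1) * _ ≤ 1 / ((n : ℝ) + 1) * ((n + 1) * L * dist x y) := by gcongr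
    _ = L * dist x y := by field_simp

omit [MeasurableSpace E] [BorelSpace E] in
theorem wave_tendsto (a : qLipAlg E) (σ : ℝ) (x : E) :
    Tendsto (fun n : ℕ => (wave σ (n + 1) a : E → ℂ) x) atTop (𝓝 0) := by
  refine squeeze_zero_norm (fun n => ?_) tendsto_one_div_add_atTop_nhds_zero_nat
  have hn : (0 : ℝ) < n + 1 := by positivity
  rw [wave_apply, norm_mul, show ∀ y : ℂ, Complex.exp (Complex.I * y) = Complex.exp (y * Complex.I)
    from fun y => by rw [mul_comm], ← Complex.ofReal_mul, Complex.norm_exp_ofReal_mul_I, mul_one,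
    show ((1 : ℂ) / ((n + 1 : ℝ) : ℂ)) = ((1 / (n + 1) : ℝ) : ℂ) by push_cast; rfl,
      Complex.norm_real, Real.norm_of_nonneg (by positivity)]

/-- A continuous multilinear functional that is local and has finite mass is alternating. -/
theorem map_eq_zero_of_eq_of_tame
    {M : qLipAlg E →ₗ[ℂ] MultilinearMap ℂ (fun _ : Fin k => qLipAlg E) ℂ}
    (hM : Tame (fun f => ⇑(M f)) ρ μ) (hc : SeqCont fun f => ⇑(M f)) (f : qLipAlg E)
    (π : Fin k → qLipAlg E) (i j : Fin k) (hπ : π i = π j) (hij : i ≠ j) : M f π = 0 := by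
  have := hM.finite
  let B : qLipAlg E →ₗ[ℂ] qLipAlg E →ₗ[ℂ] ℂ := LinearMap.mk₂ ℂ
    (fun u v => M f (Function.update (Function.update π i u) j v))
    (fun u u' v => by simp [Function.update_comm hij])
    (fun c u v => by simp [Function.update_comm hij])
    (fun u v v' => by simp) (fun c u v => by simp)
  have hB : ∀ u v, B u v = M f (Function.update (Function.update π i u) j v) := fun _ _ => rfl
  have hreal : ∀ a : qLipAlg E, IsRealQ a → B a a = 0 := by
    intro a ha
    -- By the chain rule the two waves contribute the factors `i m w₊` and `-i m w₋`, whose product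
    -- is `m² · m⁻² = 1`. So inserting the waves gives the same value as inserting `a` twice, for
    -- every `m`, while continuity sends it to 0.
    have key : ∀ n : ℕ, B (wave 1 (n + 1) a) (wave (-1) (n + 1) a) = B a a := by
      intro n
      have hn : (0 : ℝ) < n + 1 := by positivity
      choose L hL using fun l => exists_lipQ (Function.update π i (wave 1 (n + 1) a) l) ρ
      choose L' hL' using fun l => exists_lipQ (Function.update π j a l) ρ
      have h1 := wave_chain (hM.slot hL j) (by positivity) hM.conc ha (-1) (n + 1) hn f
      rw [slot_apply, slot_apply, Function.update_comm hij] at h1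
      have h2 := wave_chain (hM.slot hL' i) (by positivity) hM.conc ha 1 (n + 1) hn
        (f * ((Complex.I * (-1 : ℝ) * ((n + 1 : ℝ) : ℂ)) • wave (-1) (n + 1) a))
      rw [slot_apply, slot_apply] at h2
      rw [hB, Function.update_comm hij, h1, Function.update_comm hij, h2, hB,
        Function.update_comm hij]
      congr 2
      rw [mul_assoc]
      convert mul_one f
      ext x
      have hne : ((n + 1 : ℝ) : ℂ) ≠ 0 := by exact_mod_cast hn.ne'
      simp only [Subalgebra.coe_mul, Subalgebra.coe_smul, Pi.mul_apply, Pi.smul_apply, wave_apply,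
        smul_eq_mul, Subalgebra.coe_one, Pi.one_apply]
      have hexp : Complex.exp (Complex.I * ((-1 * (n + 1) : ℝ) * ((a : E → ℂ) x).re)) *
          Complex.exp (Complex.I * ((1 * (n + 1) : ℝ) * ((a : E → ℂ) x).re)) = 1 := by
        rw [← Complex.exp_add, Complex.exp_eq_one_iff]
        exact ⟨0, by push_cast; ring⟩
      have hI := Complex.I_mul_I
      calc _ = -(Complex.I * Complex.I) * (((n + 1 : ℝ) : ℂ) * (1 / ((n + 1 : ℝ) : ℂ))) *
            (((n + 1 : ℝ) : ℂ) * (1 / ((n + 1 : ℝ) : ℂ))) *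
            (Complex.exp (Complex.I * ((-1 * (n + 1) : ℝ) * ((a : E → ℂ) x).re)) *
            Complex.exp (Complex.I * ((1 * (n + 1) : ℝ) * ((a : E → ℂ) x).re))) := by
            push_cast; ring
        _ = 1 := by rw [hexp, hI, mul_one_div_cancel hne]; ring
    have hE : EquiLip fun n : ℕ =>
        Function.update (Function.update π i (wave 1 (n + 1) a)) j (wave (-1) (n + 1) a) :=
      ((equiLip_const π).update (wave_lip a (σ := 1) (by simp))).update
        (wave_lip a (σ := -1) (by simp))
    have hT : TendsPt (fun n : ℕ =>
        Function.update (Function.update π i (wave 1 (n + 1) a)) j (wave (-1) (n + 1) a))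
        (Function.update (Function.update π i 0) j 0) := by
      have h0 : TendsPt (fun _ : ℕ => π) π := fun _ _ => tendsto_const_nhds
      exact (h0.update (g := 0) (wave_tendsto a 1)).update (g := 0) (wave_tendsto a (-1))
    have hlim := hc f _ _ hE hT
    simp only [MultilinearMap.map_update_zero] at hlim
    have : ∀ n : ℕ, M f (Function.update (Function.update π i (wave 1 (n + 1) a)) j
        (wave (-1) (n + 1) a)) = B a a := key
    simp only [this] at hlim
    exact tendsto_nhds_unique tendsto_const_nhds hlim
  have := bilin_diag_eq_zero B hreal (π i)
  rw [hB, Function.update_eq_self] at this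
  rwa [hπ, Function.update_eq_self] at this

/-- The multilinear map underlying a form. -/
def Form.toMulti (S : Form E k) : qLipAlg E →ₗ[ℂ] MultilinearMap ℂ (fun _ : Fin k => qLipAlg E) ℂ :=
  AlternatingMap.toMultilinearMapLM (S := ℂ) ∘ₗ S

theorem Tame.leibniz {S : Form E k} (hS : Tame (fun f => ⇑(S f)) ρ μ) (i : Fin k)
    (π : Fin k → qLipAlg E) (f u v : qLipAlg E) :
    S f (Function.update π i (u * v)) =
      S (f * u) (Function.update π i v) + S (f * v) (Function.update π i u) := by
  have := hS.finite
  choose L hL using fun l => exists_lipQ (π l) ρ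
  have h : Tame (fun f => ⇑(S.toMulti f)) ρ μ := ⟨hS.1, hS.2, hS.3, hS.4, hS.5⟩
  exact (h.slot hL i).leibniz (by positivity) hS.conc f u v

end Forms

/-! ### Functionals bounded in L¹, along sequences converging almost everywhere. -/

section L1

variable {E : Type*} [NormedAddCommGroup E] [MeasurableSpace E] [BorelSpace E]
  {μ : Measure E} [IsFiniteMeasure μ]

omit [NormedAddCommGroup E] [BorelSpace E] in
-- `δ n` is the L¹ distance to the almost everywhere limit. That limit is only measurable, so the
-- statement is phrased without it, as a Cauchy estimate.
theorem exists_L1_cauchy {g : ℕ → E → ℂ} (hg : ∀ n, AEStronglyMeasurable (g n) μ) {M : ℝ}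
    (hM : ∀ n, ∀ᵐ x ∂μ, ‖g n x‖ ≤ M)
    (hlim : ∀ᵐ x ∂μ, ∃ l, Tendsto (fun n => g n x) atTop (𝓝 l)) :
    ∃ δ : ℕ → ℝ, Tendsto δ atTop (𝓝 0) ∧ ∀ s t, ∫ x, ‖g s x - g t x‖ ∂μ ≤ δ s + δ t := by
  obtain ⟨G, hGm, hG⟩ := exists_stronglyMeasurable_limit_of_tendsto_ae hg hlim
  have hGM : ∀ᵐ x ∂μ, ‖G x‖ ≤ M := by
    filter_upwards [hG, ae_all_iff.2 hM] with x hx hxM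
    exact le_of_tendsto' hx.norm hxM
  have hgi : ∀ n, Integrable (g n) μ := fun n => Integrable.of_bound (hg n) M (hM n)
  have hGi : Integrable G μ := Integrable.of_bound hGm.aestronglyMeasurable M hGM
  refine ⟨fun n => ∫ x, ‖g n x - G x‖ ∂μ, ?_, fun s t => ?_⟩
  · have := tendsto_integral_of_dominated_convergence (μ := μ) (F := fun n x => ‖g n x - G x‖)
      (f := fun _ => (0 : ℝ)) (bound := fun _ => M + M) (fun n => ((hgi n).sub hGi).norm.1)
      (integrable_const _) (fun n => by
        filter_upwards [hM n, hGM] with x h1 h2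
        rw [norm_norm]
        exact (norm_sub_le _ _).trans (add_le_add h1 h2))
      (by
        filter_upwards [hG] with x hx
        simpa using (hx.sub_const (G x)).norm)
    simpa using this
  · have e : (∫ x, ‖g s x - G x‖ ∂μ) + ∫ x, ‖g t x - G x‖ ∂μ =
        ∫ x, (‖g s x - G x‖ + ‖g t x - G x‖) ∂μ :=
      (integral_add ((hgi s).sub hGi).norm ((hgi t).sub hGi).norm).symm
    simp only [e]
    refine integral_mono ((hgi s).sub (hgi t)).norm
      (((hgi s).sub hGi).norm.add ((hgi t).sub hGi).norm) fun x => ?_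
    simp only
    rw [norm_sub_rev (g t x)]
    simpa using norm_sub_le_norm_sub_add_norm_sub (g s x) (G x) (g t x)

variable {ρ C : ℝ}

/-- This gives a meaning to the value of a current on an almost everywhere limit that leaves the
algebra, such as the derivative of a Lipschitz function. -/
theorem exists_tendsto_of_L1_bound (A : qLipAlg E →ₗ[ℂ] ℂ)
    (hA : ∀ f : qLipAlg E, ‖A f‖ ≤ C * ∫ x, ‖(f : E → ℂ) x‖ ∂μ) (hC : 0 ≤ C)
    {g : ℕ → qLipAlg E} {M : ℝ} (hM : ∀ n, ∀ᵐ x ∂μ, ‖(g n : E → ℂ) x‖ ≤ M)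
    (hlim : ∀ᵐ x ∂μ, ∃ l, Tendsto (fun n => (g n : E → ℂ) x) atTop (𝓝 l)) :
    ∃ l, Tendsto (fun n => A (g n)) atTop (𝓝 l) := by
  obtain ⟨δ, hδ, h⟩ := exists_L1_cauchy
    (fun n => aestronglyMeasurable_of_continuous_of_ae (continuousQ (g n))) hM hlim
  apply cauchySeq_tendsto_of_complete
  have h1 : ∀ s t, dist (A (g s)) (A (g t)) ≤ C * (δ s + δ t) := by
    intro s t
    rw [dist_eq_norm, ← map_sub]
    refine (hA _).trans ?_
    gcongr
    simpa using h s t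
  rw [cauchySeq_iff_tendsto_dist_atTop_0]
  refine squeeze_zero (fun _ => dist_nonneg) (fun n : ℕ × ℕ => h1 n.1 n.2) ?_
  have h2 : Tendsto (fun n : ℕ × ℕ => C * (δ n.1 + δ n.2)) atTop (𝓝 (C * (0 + 0))) := by
    rw [← prod_atTop_atTop_eq]
    exact ((hδ.comp tendsto_fst).add (hδ.comp tendsto_snd)).const_mul C
  simpa using h2

/-- Pointwise convergence of uniformly L¹-bounded functionals is uniform along an L¹ Cauchy
sequence: fix one late index `m`, use convergence at `g m`, and absorb `g n - g m` in the common
bound. -/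
theorem tendsto_sub_of_L1_bound (A : ℕ → qLipAlg E →ₗ[ℂ] ℂ) (A' : qLipAlg E →ₗ[ℂ] ℂ)
    (hA : ∀ n, ∀ f : qLipAlg E, ‖A n f‖ ≤ C * ∫ x, ‖(f : E → ℂ) x‖ ∂μ)
    (hA' : ∀ f : qLipAlg E, ‖A' f‖ ≤ C * ∫ x, ‖(f : E → ℂ) x‖ ∂μ) (hC : 0 ≤ C)
    (hAA : ∀ f, Tendsto (fun n => A n f) atTop (𝓝 (A' f)))
    {g : ℕ → qLipAlg E} {M : ℝ} (hM : ∀ n, ∀ᵐ x ∂μ, ‖(g n : E → ℂ) x‖ ≤ M)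
    (hlim : ∀ᵐ x ∂μ, ∃ l, Tendsto (fun n => (g n : E → ℂ) x) atTop (𝓝 l)) :
    Tendsto (fun n => A n (g n) - A' (g n)) atTop (𝓝 0) := by
  obtain ⟨δ, hδ, h⟩ := exists_L1_cauchy
    (fun n => aestronglyMeasurable_of_continuous_of_ae (continuousQ (g n))) hM hlim
  rw [Metric.tendsto_atTop]
  intro ε hε
  have h3 : Tendsto (fun n => 2 * C * (δ n + δ n)) atTop (𝓝 0) := by
    simpa using (hδ.add hδ).const_mul (2 * C)
  have h4 : Tendsto (fun n => 2 * C * δ n) atTop (𝓝 0) := by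
    simpa using hδ.const_mul (2 * C)
  obtain ⟨m, hm⟩ := eventually_atTop.1 (h4.eventually (gt_mem_nhds (show (0 : ℝ) < ε / 3 by positivity)))
  have h5 : Tendsto (fun n => A n (g m) - A' (g m)) atTop (𝓝 0) := by
    simpa using (hAA (g m)).sub_const (A' (g m))
  obtain ⟨N, hN⟩ := (Metric.tendsto_atTop.1 h5) (ε / 3) (by positivity)
  refine ⟨max m N, fun n hn => ?_⟩
  have e : A n (g n) - A' (g n) = (A n (g m) - A' (g m)) + (A n (g n - g m) - A' (g n - g m)) := by
    simp only [map_sub]; ring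
  have h6 := hN n ((le_max_right _ _).trans hn)
  have h7 : ∫ x, ‖((g n - g m : qLipAlg E) : E → ℂ) x‖ ∂μ ≤ δ n + δ m := by simpa using h n m
  have h8 : ‖A n (g n - g m) - A' (g n - g m)‖ ≤ 2 * C * (δ n + δ m) := by
    refine (norm_sub_le _ _).trans ?_
    have e1 := hA n (g n - g m)
    have e2 := hA' (g n - g m)
    have e3 := mul_le_mul_of_nonneg_left h7 hC
    linarith
  have h9 := hm n ((le_max_left _ _).trans hn)
  have h10 := hm m le_rfl
  rw [dist_zero_right] at h6 ⊢
  rw [e]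
  refine (norm_add_le _ _).trans_lt ?_
  linarith

end L1

/-! ### Cutoff functions and dependence on germs. -/

section Cut

variable {E : Type*} [NormedAddCommGroup E]

/-- The cutoff that is `1` where `u ≤ c` and `0` where `u ≥ 2 c`. -/
noncomputable def cutFn (u : E → ℝ) (c : ℝ) (x : E) : ℂ := ((max 0 (min 1 (2 - u x / c)) : ℝ) : ℂ)

omit [NormedAddCommGroup E] in
theorem cutFn_eq_one {u : E → ℝ} {c : ℝ} (hc : 0 < c) {x : E} (h : u x ≤ c) : cutFn u c x = 1 := by
  have : u x / c ≤ 1 := (div_le_one hc).2 h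
  rw [cutFn, min_eq_left (by linarith), max_eq_right zero_le_one, Complex.ofReal_one]

omit [NormedAddCommGroup E] in
theorem cutFn_eq_zero {u : E → ℝ} {c : ℝ} (hc : 0 < c) {x : E} (h : 2 * c ≤ u x) :
    cutFn u c x = 0 := by
  have : 2 ≤ u x / c := (le_div_iff₀ hc).2 h
  rw [cutFn, max_eq_left ((min_le_right _ _).trans (by linarith)), Complex.ofReal_zero]

omit [NormedAddCommGroup E] in
theorem norm_cutFn_le (u : E → ℝ) (c : ℝ) (x : E) : ‖cutFn u c x‖ ≤ 1 := by
  rw [cutFn, Complex.norm_real, Real.norm_of_nonneg (le_max_left _ _)]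
  exact max_le zero_le_one (min_le_left _ _)

omit [NormedAddCommGroup E] in
theorem norm_one_sub_cutFn_le (u : E → ℝ) (c : ℝ) (x : E) : ‖1 - cutFn u c x‖ ≤ 1 := by
  rw [cutFn, ← Complex.ofReal_one, ← Complex.ofReal_sub, Complex.norm_real, Real.norm_eq_abs,
    abs_le]
  have h1 : 0 ≤ max 0 (min 1 (2 - u x / c)) := le_max_left _ _
  have h2 : max 0 (min 1 (2 - u x / c)) ≤ 1 := max_le zero_le_one (min_le_left _ _)
  constructor <;> linarith

theorem lipschitzWith_cutFn {u : E → ℝ} (hu : LipschitzWith 1 u) {c : ℝ} (hc : 0 < c) :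
    LipschitzWith (c⁻¹).toNNReal (cutFn u c) := by
  have h0 : LipschitzWith (c⁻¹).toNNReal fun x => 2 - u x / c := by
    refine LipschitzWith.of_dist_le_mul fun x y => ?_
    have e : 2 - u x / c - (2 - u y / c) = c⁻¹ * (u y - u x) := by field_simp; ring
    rw [Real.dist_eq, e, abs_mul, abs_of_pos (inv_pos.2 hc), Real.coe_toNNReal _ (inv_pos.2 hc).le]
    have := hu.dist_le_mul y x
    rw [Real.dist_eq, NNReal.coe_one, one_mul, dist_comm] at this
    gcongr
  have h1 := (h0.const_min 1).const_max 0
  refine LipschitzWith.of_dist_le_mul fun x y => ?_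
  rw [cutFn, cutFn, Complex.dist_eq, ← Complex.ofReal_sub, Complex.norm_real, ← dist_eq_norm]
  exact h1.dist_le_mul x y

theorem cutFn_mem_lipB {u : E → ℝ} (hu : LipschitzWith 1 u) {c : ℝ} (hc : 0 < c) :
    cutFn u c ∈ lipB E :=
  ⟨⟨_, lipschitzWith_cutFn hu hc⟩, 1, norm_cutFn_le u c⟩

theorem tsupport_cutFn_subset {u : E → ℝ} (hu : LipschitzWith 1 u) {c : ℝ} (hc : 0 < c) :
    tsupport (cutFn u c) ⊆ {x | u x ≤ 2 * c} := by
  refine closure_minimal (fun x hx => ?_) (isClosed_le hu.continuous continuous_const)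
  by_contra hcon
  exact hx (cutFn_eq_zero hc (not_le.1 hcon).le)

theorem lip_sub {f g : E → ℂ} (hf : f ∈ lip E) (hg : g ∈ lip E) : f - g ∈ lip E := by
  obtain ⟨K, hK⟩ := hf
  obtain ⟨L, hL⟩ := hg
  exact ⟨_, hK.sub hL⟩

theorem lip_add {f g : E → ℂ} (hf : f ∈ lip E) (hg : g ∈ lip E) : f + g ∈ lip E := by
  obtain ⟨K, hK⟩ := hf
  obtain ⟨L, hL⟩ := hg
  exact ⟨_, hK.add hL⟩

theorem lipB_mul {f g : E → ℂ} (hf : f ∈ lipB E) (hg : g ∈ lipB E) : f * g ∈ lipB E := by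
  obtain ⟨⟨K, hK⟩, M, hM⟩ := hf
  obtain ⟨⟨L, hL⟩, N, hN⟩ := hg
  refine ⟨⟨_, lipschitzOnWith_univ.1 (lipschitzOnWith_mul (M := M.toNNReal) (N := N.toNNReal)
    hK.lipschitzOnWith hL.lipschitzOnWith (fun x _ => (hM x).trans (Real.le_coe_toNNReal M))
    (fun x _ => (hN x).trans (Real.le_coe_toNNReal N)))⟩, M * N, fun x => ?_⟩
  rw [Pi.mul_apply, norm_mul]
  have := (norm_nonneg _).trans (hM x)
  gcongr
  exacts [hM x, hN x]

theorem lipB_sub {f g : E → ℂ} (hf : f ∈ lipB E) (hg : g ∈ lipB E) : f - g ∈ lipB E := by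
  obtain ⟨h1, M, hM⟩ := hf
  obtain ⟨h2, N, hN⟩ := hg
  exact ⟨lip_sub h1 h2, M + N, fun x => (norm_sub_le _ _).trans (add_le_add (hM x) (hN x))⟩

theorem one_mem_lipB : (fun _ => 1 : E → ℂ) ∈ lipB E :=
  ⟨⟨0, LipschitzWith.const 1⟩, 1, fun _ => by simp⟩

theorem lipB_of_qTest {g : E → ℂ} (hg : g ∈ qTest E) : g ∈ lipB E := by
  obtain ⟨M, hM⟩ := exists_bound_of_mem_qLip (mem_qLip_of_qTest hg) hg.2.choose
  refine ⟨hg.1, M, fun x => ?_⟩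
  by_cases hx : x ∈ tsupport g
  · exact hM x (mem_ball_zero_iff.1 (hg.2.choose_spec.2 hx)).le
  · rw [image_eq_zero_of_notMem_tsupport hx, norm_zero]
    exact M.2

theorem lipschitzWith_of_zero_off {g : E → ℂ} {R : ℝ} {K M : ℝ≥0}
    (hK : LipschitzOnWith K g (Metric.ball 0 (R + 2))) (hM : ∀ x, ‖x‖ ≤ R → ‖g x‖ ≤ M)
    (h0 : ∀ x, R < ‖x‖ → g x = 0) : LipschitzWith (K + M) g := by
  have key : ∀ x y, ‖x‖ ≤ R → dist (g x) (g y) ≤ (K + M : ℝ≥0) * dist x y := by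
    intro x y hx
    by_cases hy : ‖y‖ < R + 2
    · refine (hK.dist_le_mul x (mem_ball_zero_iff.2 (by linarith)) y
        (mem_ball_zero_iff.2 hy)).trans ?_
      gcongr
      simp
    · rw [h0 y (by linarith), dist_zero_right]
      have h1 : 1 ≤ dist x y := by
        rw [dist_comm, dist_eq_norm]
        linarith [norm_sub_norm_le y x]
      have h2 := hM x (by linarith)
      have h3 : (0 : ℝ) ≤ K := K.2
      push_cast
      nlinarith [norm_nonneg (g x)]
  refine LipschitzWith.of_dist_le_mul fun x y => ?_
  by_cases hx : ‖x‖ ≤ R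
  · exact key x y hx
  · by_cases hy : ‖y‖ ≤ R
    · rw [dist_comm, dist_comm x]; exact key y x hy
    · rw [h0 x (not_le.1 hx), h0 y (not_le.1 hy), dist_self]; positivity

theorem mem_qTest_of_zero_off {g : E → ℂ} (hg : g ∈ qLip E) {R : ℝ}
    (h0 : ∀ x, R < ‖x‖ → g x = 0) : g ∈ qTest E := by
  set R' := max R 0
  have hR' : 0 ≤ R' := le_max_right _ _
  have h0' : ∀ x, R' < ‖x‖ → g x = 0 := fun x hx => h0 x ((le_max_left _ _).trans_lt hx)
  refine ⟨?_, R' + 1, by positivity, ?_⟩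
  · obtain ⟨K, hK⟩ := hg (R' + 2) (by positivity)
    obtain ⟨M, hM⟩ := exists_bound_of_mem_qLip hg R'
    exact ⟨_, lipschitzWith_of_zero_off hK hM h0'⟩
  · have : tsupport g ⊆ Metric.closedBall 0 R' :=
      closure_minimal (fun x hx => by
        by_contra hcon
        exact hx (h0' x (by simpa using hcon))) Metric.isClosed_closedBall
    exact this.trans (Metric.closedBall_subset_ball (by linarith))

/-- Multilinear local functionals depend only on the germs of the `π_i` along `supp f`. -/
theorem congr_of_local {F P : Set (E → ℂ)} {k : ℕ} {T : Functional E k}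
    (hT : IsMultilinearOn F P T) (hl : IsLocalOn F P T) (hP : ∀ u ∈ P, ∀ v ∈ P, u - v ∈ P)
    {f : E → ℂ} (hf : f ∈ F) {π π' : Fin k → E → ℂ} (hπ : ∀ i, π i ∈ P) (hπ' : ∀ i, π' i ∈ P)
    {W : Set E} (hW : IsOpen W) (hfW : tsupport f ⊆ W) (h : ∀ i, ∀ x ∈ W, π i x = π' i x) :
    T f π = T f π' := by
  have key : ∀ s : Finset (Fin k), T f (s.piecewise π' π) = T f π := by
    intro s
    induction s using Finset.induction_on with
    | empty => simp
    | insert i s hi ih =>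
      have hω : ∀ j, s.piecewise π' π j ∈ P := fun j => by
        by_cases hj : j ∈ s
        · simpa [hj] using hπ' j
        · simpa [hj] using hπ j
      rw [Finset.piecewise_insert, ← ih]
      have e : π' i = (π' i - π i) + π i := by simp
      have e2 : Function.update (s.piecewise π' π) i (π i) = s.piecewise π' π :=
        Function.update_eq_self_iff.2 (by simp [hi])
      have hd := hP _ (hπ' i) _ (hπ i)
      rw [e, hT.add_right f hf _ hω i _ hd _ (hπ i), e2,
        hl f hf _ (fun j => ?_) ⟨i, 0, W, hW, hfW, fun x hx => by simp [h i x hx]⟩, zero_add]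
      by_cases hj : j = i
      · subst hj; simpa using hd
      · simpa [Function.update_of_ne hj] using hω j
  simpa using (key Finset.univ).symm

end Cut

/-! ### Supports of metric currents, and currents carried by an annulus. -/

section Support

variable {E : Type*} [NormedAddCommGroup E] [MeasurableSpace E] [BorelSpace E] {k : ℕ}

/-- A metric current vanishes on the forms whose support does not meet its own. -/
theorem IsMetricCurrent.eq_zero_of_disjoint {T : Functional E k} (hT : IsMetricCurrent T)
    {f : E → ℂ} (hf : f ∈ lipB E) {π : Fin k → E → ℂ} (hπ : ∀ i, π i ∈ lip E)
    (hd : Disjoint (tsupport f) (supp T)) : T f π = 0 := by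
  obtain ⟨μ, hμ, hμi, hmass⟩ := hT.finite_mass
  choose L hL using hπ
  have hπ : ∀ i, π i ∈ lip E := fun i => ⟨L i, hL i⟩
  obtain ⟨M, hM⟩ := hf.2
  have hpt : ∀ x ∈ tsupport f, ∃ r : ℝ, 0 < r ∧ ∀ g ∈ lipB E, tsupport g ⊆ Metric.ball x (3 * r) →
      T g π = 0 := by
    intro x hx
    have hxs : x ∉ supp T := fun h => Set.disjoint_left.1 hd hx h
    simp only [supp, Set.mem_sInter, not_forall] at hxs
    obtain ⟨C, ⟨hC, hCT⟩, hxC⟩ := hxs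
    obtain ⟨r, hr, hrC⟩ := Metric.isOpen_iff.1 hC.isOpen_compl x hxC
    refine ⟨r / 3, by positivity, fun g hg hgs => hCT g hg π hπ ?_⟩
    rw [show 3 * (r / 3) = r by ring] at hgs
    exact Set.disjoint_left.2 fun y hy => hrC (hgs hy)
  choose! r hr hrT using hpt
  -- Multiplying by `1 - φ` around each of finitely many points does not change the value, because
  -- the removed piece is supported in a ball on which `T` vanishes.
  have hstep : ∀ s : Finset E, (∀ x ∈ s, x ∈ tsupport f) → ∃ h ∈ lipB E, T h π = T f π ∧
      (∀ x, ‖h x‖ ≤ ‖f x‖) ∧ ∀ y ∈ s, ∀ x ∈ Metric.ball y (r y), h x = 0 := by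
    intro s hs
    classical
    induction s using Finset.induction_on with
    | empty => exact ⟨f, hf, rfl, fun _ => le_rfl, by simp⟩
    | insert y s hy ih =>
      obtain ⟨h, hh, h1, h2, h3⟩ := ih fun x hx => hs x (Finset.mem_insert_of_mem hx)
      have hyf := hs y (Finset.mem_insert_self _ _)
      set φ := cutFn (fun x => dist x y) (r y) with hφ
      have hlu : LipschitzWith 1 fun x : E => dist x y := LipschitzWith.dist_left y
      have hφB : φ ∈ lipB E := cutFn_mem_lipB hlu (hr y hyf)
      have hhφ := lipB_mul hh hφB
      have h0 : T (h * φ) π = 0 := by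
        refine hrT y hyf _ hhφ ((closure_mono ?_).trans
          ((tsupport_cutFn_subset hlu (hr y hyf)).trans fun x hx => ?_))
        · exact Function.support_mul_subset_right h φ
        · have := hr y hyf
          have hx' : dist x y ≤ 2 * r y := hx
          rw [Metric.mem_ball]; linarith
      refine ⟨h - h * φ, lipB_sub hh hhφ, ?_, fun x => ?_, fun z hz x hx => ?_⟩
      · have := hT.multilinear.add_left _ (lipB_sub hh hhφ) _ hhφ π hπ
        rw [sub_add_cancel, h0, add_zero, h1] at this
        exact this.symm
      · have e : (h - h * φ) x = h x * (1 - φ x) := by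
          simp only [Pi.sub_apply, Pi.mul_apply]; ring
        rw [e, norm_mul]
        exact (mul_le_of_le_one_right (norm_nonneg _) (norm_one_sub_cutFn_le _ _ _)).trans (h2 x)
      · have e : (h - h * φ) x = h x * (1 - φ x) := by
          simp only [Pi.sub_apply, Pi.mul_apply]; ring
        rw [e]
        rcases Finset.mem_insert.1 hz with rfl | hz
        · rw [hφ, cutFn_eq_one (u := fun x => dist x z) (hr z hyf) (le_of_lt hx), sub_self, mul_zero]
        · rw [h3 z hz x hx, zero_mul]
  set Λ := ∏ i, (L i : ℝ)
  have hΛ : 0 ≤ Λ := by positivity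
  have key : ∀ δ : ℝ≥0, 0 < δ → ‖T f π‖ ≤ Λ * |M| * δ := by
    intro δ hδ
    -- Inner regularity replaces the covering of all of `supp f`: finitely many balls cover its part
    -- in a compact set that carries all but `δ` of the mass.
    obtain ⟨C, hC, hCδ⟩ := exists_isCompact_measure_compl_le μ (ε := δ) (by simpa using hδ.ne')
    have hC' : IsCompact (C ∩ tsupport f) := hC.inter_right (isClosed_tsupport f)
    obtain ⟨s, hs, hcov⟩ := hC'.elim_nhds_subcover (fun x => Metric.ball x (r x))
      fun x hx => Metric.ball_mem_nhds x (hr x hx.2)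
    obtain ⟨h, hh, h1, h2, h3⟩ := hstep s fun x hx => (hs x hx).2
    have hzero : ∀ x ∈ C, h x = 0 := by
      intro x hx
      by_cases hxf : x ∈ tsupport f
      · obtain ⟨y, hy, hxy⟩ := Set.mem_iUnion₂.1 (hcov ⟨hx, hxf⟩)
        exact h3 y hy x hxy
      · have := h2 x
        rw [image_eq_zero_of_notMem_tsupport hxf, norm_zero] at this
        exact norm_le_zero_iff.1 this
    rw [← h1]
    refine (hmass h hh π L hL).trans ?_
    rw [mul_assoc]
    refine mul_le_mul_of_nonneg_left ?_ hΛ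
    have hCm : MeasurableSet Cᶜ := hC.isClosed.measurableSet.compl
    calc ∫ x, ‖h x‖ ∂μ ≤ ∫ x, Cᶜ.indicator (fun _ => |M|) x ∂μ := by
          refine integral_mono_of_nonneg (ae_of_all _ fun x => norm_nonneg _)
            ((integrable_const _).indicator hCm) (ae_of_all _ fun x => ?_)
          by_cases hx : x ∈ C
          · simp [hzero x hx, hx]
          · simp only [Set.mem_compl_iff, hx, not_false_eq_true, Set.indicator_of_mem]
            exact (h2 x).trans ((hM x).trans (le_abs_self M))
      _ = (μ Cᶜ).toReal * |M| := by
          rw [integral_indicator_const _ hCm]; rfl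
      _ ≤ |M| * δ := by
          rw [mul_comm]
          gcongr
          exact ENNReal.toReal_le_of_le_ofReal δ.2 (by simpa using hCδ)
  have hlim : Tendsto (fun n : ℕ => Λ * |M| * (1 / ((n : ℝ) + 1))) atTop (𝓝 0) := by
    simpa using tendsto_one_div_add_atTop_nhds_zero_nat.const_mul (Λ * |M|)
  have := ge_of_tendsto' hlim (b := ‖T f π‖) fun n => by
    have := key (1 / ((n : ℝ≥0) + 1)) (by positivity)
    simpa using this
  exact norm_le_zero_iff.1 this

/-- Negative on the interior of the annulus of radii `d`, `b`, positive off it. -/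
def annDist (d b : ℝ) (x : E) : ℝ := max (d - ‖x‖) (‖x‖ - b)

omit [MeasurableSpace E] [BorelSpace E] in
theorem lipschitzWith_annDist (d b : ℝ) : LipschitzWith 1 (annDist d b : E → ℝ) := by
  have h1 : LipschitzWith 1 fun x : E => d - ‖x‖ := by
    simpa using (LipschitzWith.const d).sub (lipschitzWith_one_norm (E := E))
  have h2 : LipschitzWith 1 fun x : E => ‖x‖ - b := by
    simpa using (lipschitzWith_one_norm (E := E)).sub (LipschitzWith.const b)
  have := h1.max h2
  rw [max_self] at this
  exact this

/-- The functional `T` is carried by the annulus of radii `d`, `b`. -/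
def AnnSupported (d b : ℝ) (T : Functional E k) : Prop :=
  ∀ ε : ℝ, 0 < ε → ∀ f ∈ lipB E, (∀ x, annDist d b x < ε → f x = 0) →
    ∀ π : Fin k → E → ℂ, (∀ i, π i ∈ lip E) → T f π = 0

theorem annSupported_of_supp {T : Functional E k} (hT : IsMetricCurrent T) {d b : ℝ}
    (h : ∀ x ∈ supp T, d ≤ ‖x‖ ∧ ‖x‖ ≤ b) : AnnSupported d b T := by
  intro ε hε f hf h0 π hπ
  refine hT.eq_zero_of_disjoint hf hπ (Set.disjoint_left.2 fun x hx hxT => ?_)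
  have : tsupport f ⊆ {x | ε ≤ annDist d b x} :=
    closure_minimal (fun x hx => by
      by_contra hcon
      exact hx (h0 x (not_le.1 hcon)))
      (isClosed_le continuous_const (lipschitzWith_annDist d b).continuous)
  have h1 : ε ≤ annDist d b x := this hx
  have h2 : annDist d b x ≤ 0 := max_le (by linarith [(h x hxT).1]) (by linarith [(h x hxT).2])
  linarith

omit [MeasurableSpace E] [BorelSpace E] in
theorem AnnSupported.cut {T : Functional E k} (hm : IsMultilinearOn (lipB E) (lip E) T) {d b : ℝ}
    (hT : AnnSupported d b T) {c : ℝ} (hc : 0 < c) {f : E → ℂ} (hf : f ∈ lipB E)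
    {π : Fin k → E → ℂ} (hπ : ∀ i, π i ∈ lip E) : T f π = T (cutFn (annDist d b) c * f) π := by
  have hχ := cutFn_mem_lipB (lipschitzWith_annDist (E := E) d b) hc
  have h1 := lipB_mul hχ hf
  have h2 := lipB_sub hf h1
  have := hm.add_left _ h2 _ h1 π hπ
  rw [sub_add_cancel] at this
  rw [this, hT c hc _ h2 (fun x hx => by simp [cutFn_eq_one hc hx.le]) π hπ, zero_add]

omit [BorelSpace E] in
-- In `T (1, f, π)` the 1 may be replaced by a cutoff around the annulus, and on a neighbourhood of
-- its support `f` is the constant 0; locality in the slot of `f` concludes.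
theorem AnnSupported.boundary {T : Functional E k} (hT : IsMetricCurrent T) {d b : ℝ}
    (h : AnnSupported d b T) : AnnSupported d b (boundary T) := by
  cases k with
  | zero => intro _ _ _ _ _ _ _; rfl
  | succ k =>
    intro ε hε f hf h0 π hπ
    have hc : 0 < ε / 4 := by positivity
    have hcons : ∀ i, (Fin.cons (α := fun _ => E → ℂ) f π : Fin (k + 1) → E → ℂ) i ∈ lip E := by
      intro i
      refine Fin.cases ?_ (fun j => ?_) i
      · exact hf.1
      · exact hπ j
    have hlu := lipschitzWith_annDist (E := E) d b
    have e : (cutFn (annDist d b) (ε / 4) * fun _ => 1 : E → ℂ) = cutFn (annDist d b) (ε / 4) := by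
      ext x; simp
    change T (fun _ => 1) (Fin.cons (α := fun _ => E → ℂ) f π) = 0
    rw [h.cut hT.multilinear hc one_mem_lipB hcons, e]
    refine hT.isLocal _ (cutFn_mem_lipB hlu hc) _ hcons ⟨0, 0, {x | annDist d b x < ε},
      isOpen_lt hlu.continuous continuous_const,
      (tsupport_cutFn_subset hlu hc).trans fun x hx => ?_, fun x hx => ?_⟩
    · have hx' : annDist d b x ≤ 2 * (ε / 4) := hx
      change annDist d b x < ε
      linarith
    · simpa using h0 x hx

end Support

/-! ### Mass bounds for finite families of forms. -/

section Family

variable {E : Type*} [NormedAddCommGroup E] {k : ℕ}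

/-- A bound `m` for the mass, with the functions `π_i` controlled on a ball only. -/
def FamBound (G : qLipAlg E → (Fin k → qLipAlg E) → ℂ) (ρ : ℝ) (m : ℝ≥0∞) : Prop :=
  ∀ (n : ℕ) (f : Fin n → qLipAlg E) (π : Fin n → Fin k → qLipAlg E) (c L : ℝ≥0), 0 < c → 0 < L →
    (∀ x, ‖x‖ < ρ → ∑ j, ‖(f j : E → ℂ) x‖ ≤ c) →
    (∀ j i, LipschitzOnWith L (π j i : E → ℂ) (Metric.ball 0 ρ)) →
    ∑ j, ‖G (f j) (π j)‖ₑ ≤ c * L ^ k * m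

end Family

/-! ### From a metric current on an annulus to an alternating form. -/

section ToForm

variable {E : Type*} [NormedAddCommGroup E] [MeasurableSpace E] [BorelSpace E] {k : ℕ}

omit [MeasurableSpace E] [BorelSpace E] in
theorem cutFn_ann_mul_mem_qTest (d b : ℝ) {c : ℝ} (hc : 0 < c) (f : qLipAlg E) :
    (cutFn (annDist d b) c * (f : E → ℂ)) ∈ qTest E := by
  have h1 : cutFn (annDist d b) c ∈ qLip E :=
    mem_qLip_of_lipB (cutFn_mem_lipB (lipschitzWith_annDist d b) hc)
  refine mem_qTest_of_zero_off (R := b + 2 * c) ((qLipAlg E).mul_mem (x := cutFn (annDist d b) c)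
    h1 f.2) fun x hx => ?_
  have h2 : 2 * c ≤ annDist d b x := (by linarith : 2 * c ≤ ‖x‖ - b).trans (le_max_right _ _)
  rw [Pi.mul_apply, cutFn_eq_zero hc h2, zero_mul]

omit [MeasurableSpace E] [BorelSpace E] in
-- One constant serves all `g` with the same Lipschitz constant on a ball and the same bound at the
-- origin. Sequences that are equi-Lipschitz on balls thereby become globally equi-Lipschitz, as the
-- continuity axiom of `T` demands.
theorem exists_lip_cutFn_ann_mul (d b : ℝ) {c : ℝ} (hc : 0 < c) (L B : ℝ≥0) :
    ∃ C : ℝ≥0, ∀ g : E → ℂ,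
      LipschitzOnWith L g (Metric.ball 0 (max (b + 2 * c) 0 + 2)) → ‖g 0‖ ≤ B →
        LipschitzWith C (cutFn (annDist d b) c * g) := by
  set R := max (b + 2 * c) 0
  have hR : 0 ≤ R := le_max_right _ _
  set N : ℝ≥0 := B + L * (R + 2).toNNReal
  refine ⟨1 * L + N * (c⁻¹).toNNReal + N, fun g hg hB => ?_⟩
  have hN : ∀ x ∈ Metric.ball (0 : E) (R + 2), ‖g x‖ ≤ N := by
    intro x hx
    have h1 := hg.dist_le_mul x hx 0 (by simpa using by positivity)
    rw [dist_zero_right, dist_eq_norm] at h1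
    have h2 : ‖g x‖ ≤ ‖g 0‖ + ‖g x - g 0‖ := by simpa using norm_add_le (g 0) (g x - g 0)
    have h3 : (L : ℝ) * ‖x‖ ≤ L * (R + 2) := by
      gcongr; exact (mem_ball_zero_iff.1 hx).le
    have h4 : (N : ℝ) = B + L * (R + 2) := by
      simp only [N]
      push_cast
      rw [Real.coe_toNNReal _ (by positivity)]
    linarith
  have hl := lipschitzOnWith_mul (M := 1) (N := N)
    (lipschitzWith_cutFn (lipschitzWith_annDist (E := E) d b) hc).lipschitzOnWith hg
    (fun x _ => norm_cutFn_le _ _ _) hN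
  refine lipschitzWith_of_zero_off (M := N) hl (fun x hx => ?_) fun x hx => ?_
  · rw [Pi.mul_apply, norm_mul]
    exact (mul_le_of_le_one_left (norm_nonneg _) (norm_cutFn_le _ _ _)).trans
      (hN x (mem_ball_zero_iff.2 (by linarith)))
  · have hx' := (le_max_left _ _).trans_lt hx
    have h2 : 2 * c ≤ annDist d b x := (by linarith : 2 * c ≤ ‖x‖ - b).trans (le_max_right _ _)
    rw [Pi.mul_apply, cutFn_eq_zero hc h2, zero_mul]

omit [MeasurableSpace E] [BorelSpace E] in
theorem cutFn_ann_mul_mem_lipB (d b : ℝ) {c : ℝ} (hc : 0 < c) (f : qLipAlg E) :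
    (cutFn (annDist d b) c * (f : E → ℂ)) ∈ lipB E :=
  lipB_of_qTest (cutFn_ann_mul_mem_qTest d b hc f)

/-- A metric current carried by an annulus, extended to functions that are Lipschitz on every ball. -/
noncomputable def extendFun (d b : ℝ) (T : Functional E k) (f : qLipAlg E)
    (π : Fin k → qLipAlg E) : ℂ :=
  -- The first cutoff vanishes for `annDist ≥ d / 2`, while the second is 1 for `annDist ≤ d`; so
  -- the `π i` are untouched near the support of the cut function.
  T (cutFn (annDist d b) (d / 4) * (f : E → ℂ)) fun i => cutFn (annDist d b) d * (π i : E → ℂ)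

omit [MeasurableSpace E] [BorelSpace E] in
theorem extendFun_multilinear {T : Functional E k} (hT : IsMultilinearOn (lipB E) (lip E) T)
    {d b : ℝ} (hd : 0 < d) :
    ∃ M : qLipAlg E →ₗ[ℂ] MultilinearMap ℂ (fun _ : Fin k => qLipAlg E) ℂ,
      ∀ f π, M f π = extendFun d b T f π := by
  have hF : ∀ f : qLipAlg E, (cutFn (annDist d b) (d / 4) * (f : E → ℂ)) ∈ lipB E :=
    fun f => cutFn_ann_mul_mem_lipB d b (by positivity) f
  have hP : ∀ f : qLipAlg E, (cutFn (annDist d b) d * (f : E → ℂ)) ∈ lip E :=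
    fun f => (cutFn_ann_mul_mem_lipB d b hd f).1
  have hupd : ∀ (π : Fin k → qLipAlg E) (i : Fin k) (g : qLipAlg E),
      (fun j => cutFn (annDist d b) d * (Function.update π i g j : E → ℂ)) =
        Function.update (fun j => cutFn (annDist d b) d * (π j : E → ℂ)) i
          (cutFn (annDist d b) d * (g : E → ℂ)) := by
    intro π i g
    ext1 j
    by_cases hj : j = i
    · subst hj; simp
    · simp [Function.update_of_ne hj]
  refine ⟨LinearMap.mk (AddHom.mk (fun f => MultilinearMap.mk (extendFun d b T f) ?_ ?_) ?_) ?_,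
    fun f π => rfl⟩
  · intro inst π i u v
    rw [Subsingleton.elim inst (instDecidableEqFin k)]
    simp only [extendFun, hupd, Subalgebra.coe_add, mul_add]
    exact hT.add_right _ (hF f) _ (fun j => hP _) i _ (hP u) _ (hP v)
  · intro inst π i c u
    rw [Subsingleton.elim inst (instDecidableEqFin k)]
    simp only [extendFun, hupd, Subalgebra.coe_smul, mul_smul_comm]
    exact hT.smul_right c _ (hF f) _ (fun j => hP _) i _ (hP u)
  · intro f g
    ext π
    change extendFun d b T (f + g) π = extendFun d b T f π + extendFun d b T g π
    simp only [extendFun, Subalgebra.coe_add, mul_add]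
    exact hT.add_left _ (hF f) _ (hF g) _ fun j => hP _
  · intro c f
    ext π
    change extendFun d b T (c • f) π = c * extendFun d b T f π
    simp only [extendFun, Subalgebra.coe_smul, mul_smul_comm]
    exact hT.smul_left c _ (hF f) _ fun j => hP _

omit [MeasurableSpace E] [BorelSpace E] in
theorem tsupport_cut_mul_subset {d b : ℝ} (hd : 0 < d) (f : E → ℂ) :
    tsupport (cutFn (annDist d b) (d / 4) * f) ⊆ tsupport f ∩ {x | annDist d b x ≤ d / 2} := by
  refine Set.subset_inter (closure_mono (Function.support_mul_subset_right _ _))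
    ((closure_mono (Function.support_mul_subset_left _ _)).trans
      ((tsupport_cutFn_subset (lipschitzWith_annDist d b) (by positivity)).trans fun x hx => ?_))
  have hx' : annDist d b x ≤ 2 * (d / 4) := hx
  change annDist d b x ≤ d / 2
  linarith

omit [MeasurableSpace E] [BorelSpace E] in
-- As `d - ‖x‖ ≤ d` always holds, the cutoff of width `d` equals 1 near the origin too: it truncates
-- the `π i` only at infinity.
theorem annDist_le_of_norm_lt {d b : ℝ} {x : E} (hx : ‖x‖ < b + d) : annDist d b x ≤ d :=
  max_le (by linarith [norm_nonneg x]) (by linarith)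

omit [MeasurableSpace E] [BorelSpace E] in
theorem norm_lt_of_annDist_le {d b : ℝ} (hd : 0 < d) {x : E} (hx : annDist d b x ≤ d / 2) :
    ‖x‖ < b + d := by
  have := (le_max_right _ _).trans hx
  linarith

omit [BorelSpace E] in
theorem extendFun_eq {T : Functional E k} (hT : IsMetricCurrent T) {d b : ℝ} (hd : 0 < d)
    (f : qLipAlg E) (π : Fin k → qLipAlg E) {π' : Fin k → E → ℂ} (hπ' : ∀ i, π' i ∈ lip E)
    {W : Set E} (hW : IsOpen W) (hfW : tsupport (cutFn (annDist d b) (d / 4) * (f : E → ℂ)) ⊆ W)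
    (h : ∀ i, ∀ x ∈ W, ‖x‖ < b + d → (π i : E → ℂ) x = π' i x) :
    extendFun d b T f π = T (cutFn (annDist d b) (d / 4) * (f : E → ℂ)) π' := by
  refine congr_of_local hT.multilinear hT.isLocal (fun u hu v hv => lip_sub hu hv)
    (cutFn_ann_mul_mem_lipB d b (by positivity) f)
    (fun i => (cutFn_ann_mul_mem_lipB d b hd _).1) hπ' (hW.inter Metric.isOpen_ball)
    (W := W ∩ Metric.ball 0 (b + d)) (Set.subset_inter hfW
      ((tsupport_cut_mul_subset hd _).trans fun x hx => ?_)) fun i x hx => ?_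
  · exact mem_ball_zero_iff.2 (norm_lt_of_annDist_le hd hx.2)
  · have hx2 := mem_ball_zero_iff.1 hx.2
    rw [Pi.mul_apply, cutFn_eq_one hd (annDist_le_of_norm_lt hx2), one_mul, h i x hx.1 hx2]

omit [BorelSpace E] in
theorem extendFun_loc {T : Functional E k} (hT : IsMetricCurrent T) {d b : ℝ} (hd : 0 < d)
    (f : qLipAlg E) (π : Fin k → qLipAlg E) (i : Fin k) (c : ℂ) (W : Set E) (hW : IsOpen W)
    (hfW : tsupport (f : E → ℂ) ⊆ W) (h : ∀ x ∈ W, (π i : E → ℂ) x = c) :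
    extendFun d b T f π = 0 := by
  refine hT.isLocal _ (cutFn_ann_mul_mem_lipB d b (by positivity) f) _
    (fun i => (cutFn_ann_mul_mem_lipB d b hd _).1) ⟨i, c, W ∩ Metric.ball 0 (b + d),
      hW.inter Metric.isOpen_ball, (tsupport_cut_mul_subset hd _).trans fun x hx => ?_,
      fun x hx => ?_⟩
  · exact ⟨hfW hx.1, mem_ball_zero_iff.2 (norm_lt_of_annDist_le hd hx.2)⟩
  · rw [Pi.mul_apply, cutFn_eq_one hd (annDist_le_of_norm_lt (mem_ball_zero_iff.1 hx.2)), one_mul,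
      h x hx.1]

omit [MeasurableSpace E] [BorelSpace E] in
/-- Lipschitz functions on a ball, replaced by globally Lipschitz ones. -/
theorem exists_extension_family {ι : Type*} {ρ : ℝ} {π : ι → E → ℂ} {L : ι → ℝ≥0}
    (hL : ∀ i, LipschitzOnWith (L i) (π i) (Metric.ball 0 ρ)) :
    ∃ π' : ι → qLipAlg E, (∀ i, LipschitzWith (lipschitzExtensionConstant ℂ * L i)
      (π' i : E → ℂ)) ∧ ∀ i, ∀ x ∈ Metric.ball (0 : E) ρ, (π' i : E → ℂ) x = π i x := by
  choose π' h1 h2 using fun i => exists_extensionQ (hL i)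
  exact ⟨π', h1, h2⟩

theorem extendFun_tame {T : Functional E k} (hT : IsMetricCurrent T) {d b : ℝ} (hd : 0 < d) :
    ∃ μ : Measure E, Tame (extendFun d b T) (b + d) μ ∧ ∀ᵐ x ∂μ, d / 2 ≤ ‖x‖ := by
  obtain ⟨μ, hμ, hμi, hmass⟩ := hT.finite_mass
  set e := lipschitzExtensionConstant ℂ
  set A : Set E := {x | annDist d b x ≤ d / 2}
  have hA : MeasurableSet A :=
    (isClosed_le (lipschitzWith_annDist d b).continuous continuous_const).measurableSet
  have hres : (μ.restrict A).InnerRegular := by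
    refine innerRegular_of_tight _ fun ε hε => ?_
    obtain ⟨C, hC, h⟩ := exists_isCompact_measure_compl_le μ hε
    exact ⟨C, hC, (Measure.restrict_apply_le _ _).trans h⟩
  -- The `π i` are controlled on a ball only and have to be extended from it; each of the `k`
  -- extensions costs a factor `e`, the extension constant for complex values.
  have hae : ∀ᵐ x ∂(e ^ k • μ.restrict A), x ∈ A :=
    (Measure.smul_absolutelyContinuous (c := e ^ k)) (ae_restrict_mem hA)
  refine ⟨e ^ k • μ.restrict A, ⟨inferInstance, inferInstance, ?_, ?_, ?_⟩, ?_⟩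
  · filter_upwards [hae] with x hx using norm_lt_of_annDist_le hd hx
  · intro f π L hL
    obtain ⟨π', h1, h2⟩ := exists_extension_family hL
    rw [extendFun_eq hT hd f π (fun i => ⟨_, h1 i⟩) isOpen_univ (Set.subset_univ _)
      fun i x _ hx => (h2 i x (mem_ball_zero_iff.2 hx)).symm]
    refine (hmass _ (cutFn_ann_mul_mem_lipB d b (by positivity) f) _ _ h1).trans ?_
    have h3 : ∏ i, ((e * L i : ℝ≥0) : ℝ) = e ^ k * ∏ i, (L i : ℝ) := by
      simp [Finset.prod_mul_distrib]
    rw [h3, integral_smul_nnreal_measure, NNReal.smul_def, smul_eq_mul, mul_comm ((e : ℝ) ^ k),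
      mul_assoc, NNReal.coe_pow]
    refine mul_le_mul_of_nonneg_left ?_ (by positivity)
    refine mul_le_mul_of_nonneg_left ?_ (by positivity)
    rw [← integral_indicator hA]
    obtain ⟨M, hM⟩ := exists_boundQ f (b + d)
    refine integral_mono_of_nonneg (ae_of_all _ fun x => norm_nonneg _) ?_
      (ae_of_all _ fun x => ?_)
    · refine Integrable.of_bound (C := M)
        ((continuousQ f).measurable.norm.indicator hA).aestronglyMeasurable (ae_of_all _ fun x => ?_)
      by_cases hx : x ∈ A
      · simpa [hx] using hM x (norm_lt_of_annDist_le hd hx).le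
      · simp [hx]
    · by_cases hx : x ∈ A
      · simp only [hx, Set.indicator_of_mem, Pi.mul_apply, norm_mul]
        exact mul_le_of_le_one_left (norm_nonneg _) (norm_cutFn_le _ _ _)
      · have hx' : d / 2 < annDist d b x := not_le.1 hx
        simp only [hx, not_false_eq_true, Set.indicator_of_notMem, Pi.mul_apply]
        rw [cutFn_eq_zero (by positivity) (by linarith), zero_mul, norm_zero]
  · exact fun f π i c W hW hf h => extendFun_loc hT hd f π i c W hW hf h
  · filter_upwards [hae] with x hx
    have := (le_max_left _ _).trans (show annDist d b x ≤ d / 2 from hx)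
    linarith

omit [BorelSpace E] in
theorem extendFun_seqCont {T : Functional E k} (hT : IsMetricCurrent T) {d b : ℝ} (hd : 0 < d) :
    SeqCont (extendFun d b T) := by
  intro f πs π hE hπ
  have hkey : ∀ i, ∃ C : ℝ≥0, ∀ g : qLipAlg E, (g = π i ∨ ∃ n, g = πs n i) →
      LipschitzWith C (cutFn (annDist d b) d * (g : E → ℂ)) := by
    intro i
    obtain ⟨L, hL⟩ := hE i (max (b + 2 * d) 0 + 2)
    obtain ⟨L', hL'⟩ := exists_lipQ (π i) (max (b + 2 * d) 0 + 2)
    obtain ⟨B, hB⟩ := (hπ i 0).norm.bddAbove_range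
    obtain ⟨C, hC⟩ := exists_lip_cutFn_ann_mul (E := E) d b hd (max L L') (max B.toNNReal ‖(π i : E → ℂ) 0‖₊)
    refine ⟨C, fun g hg => ?_⟩
    rcases hg with rfl | ⟨n, rfl⟩
    · exact hC _ (hL'.weaken (le_max_right _ _)) (by simp)
    · refine hC _ ((hL n).weaken (le_max_left _ _)) ?_
      have h1 : ‖(πs n i : E → ℂ) 0‖ ≤ B := hB ⟨n, rfl⟩
      exact (h1.trans (Real.le_coe_toNNReal B)).trans (by exact_mod_cast le_max_left _ _)
  refine hT.continuous _ (cutFn_ann_mul_mem_lipB d b (by positivity) f) _ _ (fun i => ?_)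
    fun i x => ?_
  · obtain ⟨C, hC⟩ := hkey i
    exact ⟨C, hC _ (Or.inl rfl), fun n => hC _ (Or.inr ⟨n, rfl⟩)⟩
  · exact (hπ i x).const_mul _

omit [BorelSpace E] in
theorem extendFun_famBound {T : Functional E k} (hT : IsMetricCurrent T) {d b : ℝ} (hd : 0 < d) :
    FamBound (extendFun d b T) (b + d) (lipschitzExtensionConstant ℂ ^ k * mass T) := by
  intro n f π c L hc hL hf hπ
  set e := lipschitzExtensionConstant ℂ with he
  have he0 : 0 < e := lipschitzExtensionConstant_pos ℂ
  choose π' h1 h2 using fun j => exists_extension_family (π := fun i => (π j i : E → ℂ)) (hπ j)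
  obtain ⟨M, hM⟩ := extendFun_multilinear (b := b) hT.multilinear hd
  have heq : ∀ (g : qLipAlg E) (ω : Fin k → qLipAlg E), (∀ i, (ω i : E → ℂ) ∈ lip E) →
      extendFun d b T g ω =
      T (cutFn (annDist d b) (d / 4) * (g : E → ℂ)) fun i => (ω i : E → ℂ) := fun g ω hω =>
    extendFun_eq hT hd g _ hω isOpen_univ (Set.subset_univ _) fun _ _ _ _ => rfl
  have hinv : ∀ (a : ℝ≥0), a ≠ 0 → (a : ℝ≥0∞) * ‖((a : ℂ))⁻¹‖ₑ = 1 := by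
    intro a ha
    have h3 : ‖(a : ℂ)‖₊ = a := by ext; simp
    rw [enorm_eq_nnnorm, nnnorm_inv, h3, ← ENNReal.coe_mul, mul_inv_cancel₀ ha, ENNReal.coe_one]
  have hlipG : ∀ j i, LipschitzWith 1
      ((((e * L : ℝ≥0) : ℂ)⁻¹ • π' j i : qLipAlg E) : E → ℂ) := by
    intro j i
    refine LipschitzWith.of_dist_le_mul fun x y => ?_
    have h3 := (h1 j i).dist_le_mul x y
    have h4 : (0 : ℝ) < (e * L : ℝ≥0) := mul_pos he0 hL
    rw [Subalgebra.coe_smul, dist_eq_norm, Pi.smul_apply, Pi.smul_apply, ← smul_sub, norm_smul,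
      ← dist_eq_norm, norm_inv, NNReal.coe_one, one_mul]
    have h5 : ‖(((e * L : ℝ≥0) : ℝ) : ℂ)‖ = (e * L : ℝ≥0) := by
      rw [Complex.norm_real, Real.norm_of_nonneg h4.le]
    rw [h5, inv_mul_le_iff₀ h4]
    exact h3
  -- Dividing the functions by `c` and the extended `π j i` by `e * L` produces a family admissible
  -- in the definition of the mass.
  have hterm : ∀ j, ‖extendFun d b T (f j) (π j)‖ₑ = c * (e * L : ℝ≥0) ^ k *
      ‖T (cutFn (annDist d b) (d / 4) * (((c⁻¹ : ℂ) • f j : qLipAlg E) : E → ℂ))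
        (fun i => ((((e * L : ℝ≥0) : ℂ)⁻¹ • π' j i : qLipAlg E) : E → ℂ))‖ₑ := by
    intro j
    rw [← heq _ (fun i => (((e * L : ℝ≥0) : ℂ)⁻¹ • π' j i : qLipAlg E)) fun i => ⟨1, hlipG j i⟩,
      ← hM ((c : ℂ)⁻¹ • f j), MultilinearMap.map_smul_univ, map_smul, smul_apply, hM _ (π' j),
      Finset.prod_const, Finset.card_univ, Fintype.card_fin, enorm_smul, enorm_smul, enorm_pow]
    have h3 : extendFun d b T (f j) (π j) = extendFun d b T (f j) (π' j) := by
      rw [heq _ (π' j) fun i => ⟨_, h1 j i⟩]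
      exact extendFun_eq hT hd _ _ (fun i => ⟨_, h1 j i⟩) isOpen_univ (Set.subset_univ _)
        fun i x _ hx => (h2 j i x (mem_ball_zero_iff.2 hx)).symm
    rw [h3]
    have h4 := hinv c hc.ne'
    have h5 := hinv (e * L) (mul_pos he0 hL).ne'
    calc ‖extendFun d b T (f j) (π' j)‖ₑ
        = (c * ‖((c : ℂ))⁻¹‖ₑ) * ((e * L : ℝ≥0) * ‖(((e * L : ℝ≥0) : ℂ))⁻¹‖ₑ) ^ k *
          ‖extendFun d b T (f j) (π' j)‖ₑ := by rw [h4, h5]; simp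
      _ = _ := by rw [mul_pow]; ring
  rw [Finset.sum_congr rfl fun j _ => hterm j, ← Finset.mul_sum]
  have hmass : ∑ j, ‖T (cutFn (annDist d b) (d / 4) * (((c⁻¹ : ℂ) • f j : qLipAlg E) : E → ℂ))
        (fun i => ((((e * L : ℝ≥0) : ℂ)⁻¹ • π' j i : qLipAlg E) : E → ℂ))‖ₑ ≤ mass T := by
    unfold mass massOn
    refine le_iSup_of_le n (le_iSup_of_le _ (le_iSup_of_le _ (le_iSup_of_le ⟨fun j =>
      ⟨cutFn_ann_mul_mem_lipB d b (by positivity) _, Set.subset_univ _⟩, fun j i => ⟨?_, ?_⟩,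
      fun x => ?_⟩ le_rfl)))
    · exact ⟨1, hlipG j i⟩
    · exact (hlipG j i).lipschitzOnWith
    · by_cases hx : ‖x‖ < b + d
      · have h3 := hf x hx
        have hc' : (0 : ℝ) < c := hc
        calc _ ≤ ∑ j, (c : ℝ)⁻¹ * ‖(f j : E → ℂ) x‖ := by
              refine Finset.sum_le_sum fun j _ => ?_
              rw [Pi.mul_apply, norm_mul, Subalgebra.coe_smul, Pi.smul_apply, norm_smul]
              refine (mul_le_of_le_one_left (by positivity) (norm_cutFn_le _ _ _)).trans
                (le_of_eq ?_)
              congr 1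
              rw [norm_inv, Complex.norm_real, Real.norm_of_nonneg hc'.le]
          _ ≤ 1 := by
              rw [← Finset.mul_sum, inv_mul_le_iff₀ hc', mul_one]
              exact h3
      · have h3 : d / 2 < annDist d b x := by
          by_contra hcon
          exact hx (norm_lt_of_annDist_le hd (not_lt.1 hcon))
        have h4 : cutFn (annDist d b) (d / 4) x = 0 := cutFn_eq_zero (by positivity) (by linarith)
        simp [h4]
  calc _ ≤ _ := mul_le_mul_right hmass _
    _ = _ := by
      push_cast
      ring

omit [MeasurableSpace E] [BorelSpace E] in
theorem Form.map_update_eq (S : Form E (k + 1)) (g : qLipAlg E) (π : Fin (k + 1) → qLipAlg E)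
    (i : Fin (k + 1)) (f : qLipAlg E) :
    S g (Function.update π i f) =
      (-1) ^ (i : ℕ) * S g (Fin.cons (α := fun _ => qLipAlg E) f (i.removeNth π)) := by
  have h := (S g).map_insertNth i f (i.removeNth π)
  rw [Fin.insertNth_removeNth, zsmul_eq_mul] at h
  push_cast at h
  exact h

theorem prod_sdiff_eq (L : Fin (k + 1) → ℝ≥0) (i : Fin (k + 1)) :
    ∏ j ∈ Finset.univ \ {i}, (L j : ℝ) = ∏ j, (L (i.succAbove j) : ℝ) := by
  have h1 := prod_update_coe L i 1
  rw [Fin.prod_univ_succAbove _ i] at h1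
  simpa using h1.symm

/-- A form of finite mass, carried by a bounded set, whose boundary has finite mass. -/
structure NormalForm (S : Form E k) (ρ : ℝ) (μ : Measure E) : Prop extends
    Tame (fun f => ⇑(S f)) ρ μ where
  cont : SeqCont fun f => ⇑(S f)
  bd : ∀ (i : Fin k) (f : qLipAlg E) (π : Fin k → qLipAlg E) (L : Fin k → ℝ≥0),
    (∀ i, LipschitzOnWith (L i) (π i : E → ℂ) (Metric.ball 0 ρ)) →
      ‖S 1 (Function.update π i f)‖ ≤
        (∏ j ∈ Finset.univ \ {i}, (L j : ℝ)) * ∫ x, ‖(f : E → ℂ) x‖ ∂μ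

omit [BorelSpace E] in
-- Both sides may be tested with the narrowest cutoff `χ₀` as first function, and near its support
-- the other two cutoffs equal 1. So extension commutes with the boundary, and the mass of `dT`
-- controls `S (1, f, …)`.
theorem extendFun_boundary {T : Functional E (k + 1)} (hT : IsMetricCurrent T) {d b : ℝ}
    (hd : 0 < d) (ha : AnnSupported d b T) (f : qLipAlg E) (π : Fin k → qLipAlg E) :
    extendFun d b T 1 (Fin.cons (α := fun _ => qLipAlg E) f π) =
      extendFun d b (boundary T) f π := by
  have hlu := lipschitzWith_annDist (E := E) d b
  set χ₀ := cutFn (annDist d b : E → ℝ) (d / 16)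
  set χ₁ := cutFn (annDist d b : E → ℝ) (d / 4) with hχ₁
  set χ₂ := cutFn (annDist d b : E → ℝ) d with hχ₂
  have hχ₀ : χ₀ ∈ lipB E := cutFn_mem_lipB hlu (by positivity)
  have h1 : ∀ g : qLipAlg E, χ₁ * (g : E → ℂ) ∈ lipB E := cutFn_ann_mul_mem_lipB d b (by positivity)
  have h2 : ∀ g : qLipAlg E, χ₂ * (g : E → ℂ) ∈ lipB E := cutFn_ann_mul_mem_lipB d b hd
  have hl : ∀ i, χ₂ * ((Fin.cons (α := fun _ => qLipAlg E) f π :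
      Fin (k + 1) → qLipAlg E) i : E → ℂ) ∈ lip E := fun i => (h2 _).1
  have hr : ∀ i, (Fin.cons (α := fun _ => E → ℂ) (χ₁ * (f : E → ℂ))
      (fun i => χ₂ * (π i : E → ℂ)) : Fin (k + 1) → E → ℂ) i ∈ lip E := fun i => by
    refine Fin.cases ?_ (fun j => ?_) i
    · exact (h1 f).1
    · exact (h2 (π j)).1
  have hc : (0 : ℝ) < d / 16 := by positivity
  change T (χ₁ * ((1 : qLipAlg E) : E → ℂ)) _ =
    T (fun _ => 1) (Fin.cons (α := fun _ => E → ℂ) (χ₁ * (f : E → ℂ)) fun i => χ₂ * (π i : E → ℂ))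
  rw [ha.cut hT.multilinear hc (h1 1) hl, ha.cut hT.multilinear hc one_mem_lipB hr]
  have e1 : χ₀ * (χ₁ * ((1 : qLipAlg E) : E → ℂ)) = χ₀ := by
    ext x
    by_cases hx : annDist d b x ≤ d / 4
    · simp [hχ₁, cutFn_eq_one (by positivity : 0 < d / 4) hx]
    · have : χ₀ x = 0 := cutFn_eq_zero hc (by linarith)
      simp [this]
  have e2 : (χ₀ * fun _ => 1 : E → ℂ) = χ₀ := by ext x; simp
  change T (χ₀ * (χ₁ * ((1 : qLipAlg E) : E → ℂ))) _ = T (χ₀ * fun _ => 1) _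
  rw [e1, e2]
  refine congr_of_local hT.multilinear hT.isLocal (fun u hu v hv => lip_sub hu hv) hχ₀ hl hr
    (W := {x | annDist d b x < d / 4}) (isOpen_lt hlu.continuous continuous_const)
    ((tsupport_cutFn_subset hlu hc).trans fun x hx => ?_) fun i x hx => ?_
  · have hx' : annDist d b x ≤ 2 * (d / 16) := hx
    change annDist d b x < d / 4
    linarith
  · have hx' : annDist d b x < d / 4 := hx
    have e3 : χ₂ x = 1 := cutFn_eq_one hd (by linarith)
    have e4 : χ₁ x = 1 := cutFn_eq_one (by positivity) hx'.le
    refine Fin.cases ?_ (fun j => ?_) i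
    · simp [e3, e4]
    · simp

theorem exists_form {T : Functional E k} (hT : IsMetricCurrent T) {d b : ℝ} (hd : 0 < d) :
    ∃ S : Form E k, ∀ f π, S f π = extendFun d b T f π := by
  obtain ⟨M, hM⟩ := extendFun_multilinear (b := b) hT.multilinear hd
  obtain ⟨μ, hμ, -⟩ := extendFun_tame (b := b) hT hd
  have hM' : (fun f => ⇑(M f)) = extendFun d b T := by ext f π; exact hM f π
  have hc := extendFun_seqCont (b := b) hT hd
  rw [← hM'] at hμ hc
  refine ⟨LinearMap.mk (AddHom.mk (fun f => AlternatingMap.mk (M f) fun π i j hπ hij =>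
    map_eq_zero_of_eq_of_tame hμ hc f π i j hπ hij) ?_) ?_, hM⟩
  · intro f g
    ext π
    change M (f + g) π = M f π + M g π
    simp
  · intro c f
    ext π
    change M (c • f) π = c * M f π
    simp

theorem exists_normalForm {T : Functional E k} (hT : IsNormal T) {d b : ℝ} (hd : 0 < d)
    (ha : AnnSupported d b T) :
    ∃ (S : Form E k) (μ : Measure E), (∀ f π, S f π = extendFun d b T f π) ∧
      NormalForm S (b + d) μ ∧ ∀ᵐ x ∂μ, d / 2 ≤ ‖x‖ := by
  obtain ⟨S, hS⟩ := exists_form (b := b) hT.1 hd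
  obtain ⟨μ, hμ, hμd⟩ := extendFun_tame (b := b) hT.1 hd
  obtain ⟨ν, hν, hνd⟩ := extendFun_tame (b := b) hT.2 hd
  have := hμ.finite
  have := hμ.inner
  have := hν.finite
  have := hν.inner
  have hS' : (fun f => ⇑(S f)) = extendFun d b T := by ext f π; exact hS f π
  have hc := extendFun_seqCont (b := b) hT.1 hd
  rw [← hS'] at hμ hc
  have hconc : ∀ᵐ x ∂(μ + ν), ‖x‖ < b + d := by
    rw [ae_add_measure_iff]; exact ⟨hμ.conc, hν.conc⟩
  have hle : ∀ f : qLipAlg E, ∫ x, ‖(f : E → ℂ) x‖ ∂(μ + ν) =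
      (∫ x, ‖(f : E → ℂ) x‖ ∂μ) + ∫ x, ‖(f : E → ℂ) x‖ ∂ν := fun f =>
    integral_add_measure (integrableQ hμ.conc f).norm (integrableQ hν.conc f).norm
  -- A single measure has to dominate both the form and its boundary, hence the sum.
  refine ⟨S, μ + ν, hS, ⟨⟨inferInstance, innerRegular_add μ ν, hconc, fun f π L hL => ?_, hμ.loc⟩,
    hc, fun i f π L hL => ?_⟩, ?_⟩
  · refine (hμ.bound f π L hL).trans ?_
    refine mul_le_mul_of_nonneg_left ?_ (by positivity)
    rw [hle]
    exact le_add_of_nonneg_right (integral_nonneg fun x => norm_nonneg _)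
  · cases k with
    | zero => exact i.elim0
    | succ k =>
      rw [S.map_update_eq, hS, extendFun_boundary hT.1 hd ha, norm_mul, norm_pow, norm_neg, norm_one,
        one_pow, one_mul, prod_sdiff_eq]
      refine (hν.bound f (i.removeNth π) (fun j => L (i.succAbove j)) fun j => hL _).trans ?_
      refine mul_le_mul_of_nonneg_left ?_ (by positivity)
      rw [hle]
      exact le_add_of_nonneg_left (integral_nonneg fun x => norm_nonneg _)
  · rw [ae_add_measure_iff]; exact ⟨hμd, hνd⟩

end ToForm

/-! ### Continuity of normal forms under almost everywhere convergence. -/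

section Limits

variable {E : Type*} [NormedAddCommGroup E] [MeasurableSpace E] [BorelSpace E] {k : ℕ}
  {S : Form E k} {ρ : ℝ} {μ : Measure E}

/-- The limit of `g n` may leave the algebra, so continuity in the `π` is stated as a difference
with the same `g n` in both terms. -/
theorem NormalForm.tendsto_sub (hS : NormalForm S ρ μ) {πs : ℕ → Fin k → qLipAlg E}
    {π : Fin k → qLipAlg E} (hE : EquiLip πs) (hπ : TendsPt πs π) {g : ℕ → qLipAlg E} {M : ℝ}
    (hM : ∀ n, ∀ᵐ x ∂μ, ‖(g n : E → ℂ) x‖ ≤ M)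
    (hlim : ∀ᵐ x ∂μ, ∃ l, Tendsto (fun n => (g n : E → ℂ) x) atTop (𝓝 l)) :
    Tendsto (fun n => S (g n) (πs n) - S (g n) π) atTop (𝓝 0) := by
  have := hS.finite
  choose L hL using fun i => hE i ρ
  choose L' hL' using fun i => exists_lipQ (π i) ρ
  have hmax : ∀ n i, LipschitzOnWith (max (L i) (L' i)) (πs n i : E → ℂ) (Metric.ball 0 ρ) :=
    fun n i => (hL i n).weaken (le_max_left _ _)
  have hmax' : ∀ i, LipschitzOnWith (max (L i) (L' i)) (π i : E → ℂ) (Metric.ball 0 ρ) :=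
    fun i => (hL' i).weaken (le_max_right _ _)
  let ev : (Fin k → qLipAlg E) → qLipAlg E →ₗ[ℂ] ℂ := fun ω =>
    { toFun := fun f => S f ω, map_add' := fun f g => by simp, map_smul' := fun c f => by simp }
  exact tendsto_sub_of_L1_bound (fun n => ev (πs n)) (ev π)
    (fun n f => hS.bound f _ _ (hmax n)) (fun f => hS.bound f _ _ hmax') (by positivity)
    (fun f => hS.cont f πs π hE hπ) hM hlim

theorem NormalForm.exists_tendsto (hS : NormalForm S ρ μ) (π : Fin k → qLipAlg E)
    {g : ℕ → qLipAlg E} {M : ℝ} (hM : ∀ n, ∀ᵐ x ∂μ, ‖(g n : E → ℂ) x‖ ≤ M)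
    (hlim : ∀ᵐ x ∂μ, ∃ l, Tendsto (fun n => (g n : E → ℂ) x) atTop (𝓝 l)) :
    ∃ l, Tendsto (fun n => S (g n) π) atTop (𝓝 l) := by
  have := hS.finite
  choose L hL using fun i => exists_lipQ (π i) ρ
  let ev : qLipAlg E →ₗ[ℂ] ℂ :=
    { toFun := fun f => S f π, map_add' := fun f g => by simp, map_smul' := fun c f => by simp }
  exact exists_tendsto_of_L1_bound ev (fun f => hS.bound f _ _ hL) (by positivity) hM hlim

theorem Tame.tendsto_of_ae_tendsto (hS : Tame (fun f => ⇑(S f)) ρ μ) (π : Fin k → qLipAlg E)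
    {g : ℕ → qLipAlg E} {g' : qLipAlg E} {M : ℝ} (hM : ∀ n, ∀ᵐ x ∂μ, ‖(g n : E → ℂ) x‖ ≤ M)
    (hlim : ∀ᵐ x ∂μ, Tendsto (fun n => (g n : E → ℂ) x) atTop (𝓝 ((g' : E → ℂ) x))) :
    Tendsto (fun n => S (g n) π) atTop (𝓝 (S g' π)) := by
  have := hS.finite
  choose L hL using fun i => exists_lipQ (π i) ρ
  obtain ⟨M', hM'⟩ := exists_boundQ g' ρ
  rw [tendsto_iff_norm_sub_tendsto_zero]
  have h1 : ∀ n, ‖S (g n) π - S g' π‖ ≤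
      (∏ i, (L i : ℝ)) * ∫ x, ‖(g n : E → ℂ) x - (g' : E → ℂ) x‖ ∂μ := by
    intro n
    have := hS.bound (g n - g') π L hL
    simpa using this
  refine squeeze_zero (fun n => norm_nonneg _) h1 ?_
  have h2 := tendsto_integral_of_dominated_convergence (μ := μ)
    (F := fun n x => ‖(g n : E → ℂ) x - (g' : E → ℂ) x‖) (f := fun _ => (0 : ℝ))
    (bound := fun _ => M + M')
    (fun n => ((continuousQ (g n)).sub (continuousQ g')).norm.measurable.aestronglyMeasurable)
    (integrable_const _) (fun n => by
      filter_upwards [hM n, hS.conc] with x h1 h2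
      rw [norm_norm]
      exact (norm_sub_le _ _).trans (add_le_add h1 (hM' x h2.le)))
    (by
      filter_upwards [hlim] with x hx
      simpa using (hx.sub_const ((g' : E → ℂ) x)).norm)
  simpa using h2.const_mul (∏ i, (L i : ℝ))

theorem NormalForm.tendsto_joint (hS : NormalForm S ρ μ) {πs : ℕ → Fin k → qLipAlg E}
    {π : Fin k → qLipAlg E} (hE : EquiLip πs) (hπ : TendsPt πs π) {g : ℕ → qLipAlg E}
    {g' : qLipAlg E} {M : ℝ}
    (hM : ∀ n, ∀ᵐ x ∂μ, ‖(g n : E → ℂ) x‖ ≤ M)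
    (hlim : ∀ᵐ x ∂μ, Tendsto (fun n => (g n : E → ℂ) x) atTop (𝓝 ((g' : E → ℂ) x))) :
    Tendsto (fun n => S (g n) (πs n)) atTop (𝓝 (S g' π)) := by
  have h1 := hS.tendsto_sub hE hπ hM (hlim.mono fun x hx => ⟨_, hx⟩)
  have h2 := hS.toTame.tendsto_of_ae_tendsto π hM hlim
  simpa using h1.add h2

end Limits

/-! ### Dilations and their polar difference quotients. -/

section Pull

variable {E : Type*} [NormedAddCommGroup E] [NormedSpace ℂ E] {k : ℕ}

theorem smul_mem_ball {ζ : ℂ} {Z R : ℝ} (hZ : 0 < Z) (hζ : ‖ζ‖ ≤ Z) {x : E} (hx : ‖x‖ < R) :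
    ‖ζ • x‖ < Z * R := by
  rw [norm_smul]
  calc ‖ζ‖ * ‖x‖ ≤ Z * ‖x‖ := by gcongr
    _ < Z * R := by gcongr

theorem lipschitzOnWith_smul {g : E → ℂ} {L Z : ℝ≥0} {R : ℝ} (hZ : 0 < Z)
    (hg : LipschitzOnWith L g (Metric.ball 0 (Z * R))) {ζ : ℂ} (hζ : ‖ζ‖ ≤ Z) :
    LipschitzOnWith (Z * L) (fun x => g (ζ • x)) (Metric.ball 0 R) := by
  refine LipschitzOnWith.of_dist_le_mul fun x hx y hy => ?_
  refine (hg.dist_le_mul _ (mem_ball_zero_iff.2 (smul_mem_ball hZ hζ (mem_ball_zero_iff.1 hx))) _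
    (mem_ball_zero_iff.2 (smul_mem_ball hZ hζ (mem_ball_zero_iff.1 hy)))).trans ?_
  rw [dist_smul₀]
  push_cast
  calc (L : ℝ) * (‖ζ‖ * dist x y) ≤ L * (Z * dist x y) := by gcongr
    _ = _ := by ring

/-- Composition with the dilation by `ζ`. -/
def pull (ζ : ℂ) : qLipAlg E →ₐ[ℂ] qLipAlg E where
  toFun g := ⟨fun x => (g : E → ℂ) (ζ • x), fun R _ => by
    obtain ⟨L, hL⟩ := exists_lipQ g ((‖ζ‖₊ + 1 : ℝ≥0) * R)
    exact ⟨_, lipschitzOnWith_smul (by positivity) hL (by simp)⟩⟩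
  map_one' := rfl
  map_mul' _ _ := rfl
  map_zero' := rfl
  map_add' _ _ := rfl
  commutes' _ := rfl

@[simp] theorem pull_apply (ζ : ℂ) (g : qLipAlg E) (x : E) :
    (pull ζ g : E → ℂ) x = (g : E → ℂ) (ζ • x) := rfl

theorem pull_lip {g : qLipAlg E} {L Z : ℝ≥0} {R : ℝ} (hZ : 0 < Z)
    (hg : LipschitzOnWith L (g : E → ℂ) (Metric.ball 0 (Z * R))) {ζ : ℂ} (hζ : ‖ζ‖ ≤ Z) :
    LipschitzOnWith (Z * L) (pull ζ g : E → ℂ) (Metric.ball 0 R) :=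
  lipschitzOnWith_smul hZ hg hζ

theorem tsupport_pull_mul_subset (ζ : ℂ) (f g : qLipAlg E) :
    tsupport ((pull ζ f * g : qLipAlg E) : E → ℂ) ⊆ (fun x => ζ • x) ⁻¹' tsupport (f : E → ℂ) := by
  refine closure_minimal (fun x hx => subset_tsupport _ ?_)
    ((isClosed_tsupport _).preimage (continuous_const_smul ζ))
  intro h0
  apply hx
  simp [h0]

/-- The point `1 + r exp (i θ)`. -/
noncomputable def zeta (r θ : ℝ) : ℂ := 1 + r * Complex.exp (θ * Complex.I)

theorem continuous_zeta : Continuous fun p : ℝ × ℝ => zeta p.1 p.2 := by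
  unfold zeta; fun_prop

theorem norm_zeta_le (r θ : ℝ) : ‖zeta r θ‖ ≤ 1 + |r| := by
  refine (norm_add_le _ _).trans ?_
  rw [norm_mul, Complex.norm_exp_ofReal_mul_I, norm_one, Complex.norm_real, mul_one,
    Real.norm_eq_abs]

theorem le_norm_zeta (r θ : ℝ) : |r| - 1 ≤ ‖zeta r θ‖ := by
  have h := norm_sub_le (zeta r θ) 1
  have e : zeta r θ - 1 = r * Complex.exp (θ * Complex.I) := by rw [zeta]; ring
  rw [e, norm_mul, Complex.norm_exp_ofReal_mul_I, norm_one, Complex.norm_real, mul_one,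
    Real.norm_eq_abs] at h
  linarith

theorem norm_zeta_sub_radial (r s θ : ℝ) : ‖zeta s θ - zeta r θ‖ = |s - r| := by
  have e : zeta s θ - zeta r θ = (s - r : ℝ) * Complex.exp (θ * Complex.I) := by
    rw [zeta, zeta]; push_cast; ring
  rw [e, norm_mul, Complex.norm_exp_ofReal_mul_I, Complex.norm_real, mul_one, Real.norm_eq_abs]

theorem norm_zeta_sub_angular (r θ φ : ℝ) : ‖zeta r φ - zeta r θ‖ ≤ |r| * |φ - θ| := by
  have e : zeta r φ - zeta r θ = r * (Complex.exp (θ * Complex.I) *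
      (Complex.exp (Complex.I * (φ - θ : ℝ)) - 1)) := by
    rw [zeta, zeta, mul_sub, ← Complex.exp_add]
    have : (θ : ℂ) * Complex.I + Complex.I * (φ - θ : ℝ) = φ * Complex.I := by push_cast; ring
    rw [this]; ring
  rw [e, norm_mul, norm_mul, Complex.norm_exp_ofReal_mul_I, Complex.norm_real, one_mul,
    Real.norm_eq_abs]
  gcongr
  exact Real.norm_exp_I_mul_ofReal_sub_one_le

/-- A multiple of the difference of two dilations. -/
noncomputable def diffQ (c ζ' ζ : ℂ) : qLipAlg E →ₗ[ℂ] qLipAlg E where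
  toFun g := c • (pull ζ' g - pull ζ g)
  map_add' f g := by
    rw [map_add, map_add, ← smul_add]; congr 1; abel
  map_smul' a f := by
    rw [map_smul, map_smul, ← smul_sub, smul_comm, RingHom.id_apply]

@[simp] theorem diffQ_apply (c ζ' ζ : ℂ) (g : qLipAlg E) (x : E) :
    (diffQ c ζ' ζ g : E → ℂ) x = c * ((g : E → ℂ) (ζ' • x) - (g : E → ℂ) (ζ • x)) := rfl

theorem diffQ_eq (c ζ' ζ : ℂ) (g : qLipAlg E) :
    diffQ c ζ' ζ g = c • (pull ζ' g - pull ζ g) := rfl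

theorem norm_diffQ_le {g : qLipAlg E} {L Z : ℝ≥0} {R : ℝ} (hZ : 0 < Z)
    (hg : LipschitzOnWith L (g : E → ℂ) (Metric.ball 0 (Z * R))) {c ζ' ζ : ℂ} (hζ' : ‖ζ'‖ ≤ Z)
    (hζ : ‖ζ‖ ≤ Z) {C : ℝ} (hc : ‖c‖ * ‖ζ' - ζ‖ ≤ C) {x : E} (hx : ‖x‖ < R) :
    ‖(diffQ c ζ' ζ g : E → ℂ) x‖ ≤ C * L * R := by
  have h := hg.dist_le_mul _ (mem_ball_zero_iff.2 (smul_mem_ball hZ hζ' hx)) _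
    (mem_ball_zero_iff.2 (smul_mem_ball hZ hζ hx))
  rw [dist_eq_norm, dist_eq_norm, ← sub_smul, norm_smul] at h
  rw [diffQ_apply, norm_mul]
  have hC : 0 ≤ C := (by positivity : 0 ≤ ‖c‖ * ‖ζ' - ζ‖).trans hc
  calc _ ≤ ‖c‖ * (L * (‖ζ' - ζ‖ * ‖x‖)) := by gcongr
    _ = (‖c‖ * ‖ζ' - ζ‖) * L * ‖x‖ := by ring
    _ ≤ C * L * R := by gcongr

/-- Difference quotient in the radial direction. -/
noncomputable def radQ (n : ℕ) (p : ℝ × ℝ) : qLipAlg E →ₗ[ℂ] qLipAlg E :=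
  diffQ (n + 1) (zeta (p.1 + 1 / (n + 1)) p.2) (zeta p.1 p.2)

/-- Difference quotient in the angular direction. -/
noncomputable def angQ (n : ℕ) (p : ℝ × ℝ) : qLipAlg E →ₗ[ℂ] qLipAlg E :=
  diffQ (n + 1) (zeta p.1 (p.2 + 1 / (n + 1))) (zeta p.1 p.2)

/-- Difference quotient approximating a multiple of the `∂̄`-derivative along the complex lines
through the origin, in polar coordinates with centre `1`. -/
noncomputable def dbarQ (n : ℕ) (p : ℝ × ℝ) : qLipAlg E →ₗ[ℂ] qLipAlg E where
  toFun g := radQ n p g + (Complex.I / p.1 : ℂ) • angQ n p g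
  map_add' f g := by
    rw [map_add, map_add, smul_add]; abel
  map_smul' a f := by
    rw [map_smul, map_smul, smul_comm, ← smul_add, RingHom.id_apply]

theorem dbarQ_apply (n : ℕ) (p : ℝ × ℝ) (g : qLipAlg E) (x : E) : (dbarQ n p g : E → ℂ) x =
    (radQ n p g : E → ℂ) x + Complex.I / p.1 * (angQ n p g : E → ℂ) x := rfl

theorem one_div_succ_le (n : ℕ) : 1 / ((n : ℝ) + 1) ≤ 1 := by
  rw [div_le_one (by positivity)]; linarith [(Nat.cast_nonneg n : (0 : ℝ) ≤ n)]

variable {ϱ R : ℝ} {p : ℝ × ℝ}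

/-- The room left by `ϱ + 2` accommodates the radial increments `1 / (n + 1) ≤ 1` of the difference
quotients. -/
theorem norm_zeta_le_of_le {Z : ℝ≥0} (hZ : ϱ + 2 ≤ Z) {r : ℝ} (hr : 0 < r) (hr' : r ≤ ϱ + 1)
    (θ : ℝ) : ‖zeta r θ‖ ≤ Z :=
  (norm_zeta_le _ _).trans (by rw [abs_of_pos hr]; linarith)

theorem norm_natCast_succ (n : ℕ) : ‖((n : ℂ) + 1)‖ = n + 1 := by
  rw [← Nat.cast_succ, Complex.norm_natCast, Nat.cast_succ]

theorem norm_succ_mul_radial (n : ℕ) (r θ : ℝ) :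
    ‖((n : ℂ) + 1)‖ * ‖zeta (r + 1 / (n + 1)) θ - zeta r θ‖ ≤ 1 := by
  have hn : (0 : ℝ) < n + 1 := by positivity
  rw [norm_zeta_sub_radial, norm_natCast_succ, add_sub_cancel_left, abs_of_pos (by positivity)]
  field_simp
  exact le_rfl

theorem norm_succ_mul_angular (n : ℕ) {r : ℝ} (hr : 0 < r) (θ : ℝ) :
    ‖((n : ℂ) + 1)‖ * ‖zeta r (θ + 1 / (n + 1)) - zeta r θ‖ ≤ r := by
  have hn : (0 : ℝ) < n + 1 := by positivity
  have h := norm_zeta_sub_angular r θ (θ + 1 / (n + 1))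
  rw [add_sub_cancel_left, abs_of_pos (by positivity : 0 < 1 / ((n : ℝ) + 1)), abs_of_pos hr] at h
  rw [norm_natCast_succ]
  calc _ ≤ ((n : ℝ) + 1) * (r * (1 / (n + 1))) := by gcongr
    _ = r := by field_simp

theorem norm_radQ_le {g : qLipAlg E} {L Z : ℝ≥0} (hZ : ϱ + 2 ≤ Z) (hZ0 : 0 < Z)
    (hg : LipschitzOnWith L (g : E → ℂ) (Metric.ball 0 (Z * R))) (hp : 0 < p.1) (hp' : p.1 ≤ ϱ)
    (n : ℕ) {x : E} (hx : ‖x‖ < R) : ‖(radQ n p g : E → ℂ) x‖ ≤ L * R := by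
  have hn : (0 : ℝ) < 1 / (n + 1) := by positivity
  have := norm_diffQ_le hZ0 hg (norm_zeta_le_of_le (θ := p.2) hZ (by linarith)
    (by linarith [one_div_succ_le n])) (norm_zeta_le_of_le (θ := p.2) hZ hp (by linarith))
    (norm_succ_mul_radial n p.1 p.2) hx
  simpa [radQ] using this

theorem norm_angQ_le {g : qLipAlg E} {L Z : ℝ≥0} (hZ : ϱ + 2 ≤ Z) (hZ0 : 0 < Z)
    (hg : LipschitzOnWith L (g : E → ℂ) (Metric.ball 0 (Z * R))) (hp : 0 < p.1) (hp' : p.1 ≤ ϱ)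
    (n : ℕ) {x : E} (hx : ‖x‖ < R) : ‖(angQ n p g : E → ℂ) x‖ ≤ p.1 * L * R :=
  norm_diffQ_le hZ0 hg (norm_zeta_le_of_le hZ hp (by linarith) _)
    (norm_zeta_le_of_le (θ := p.2) hZ hp (by linarith)) (norm_succ_mul_angular n hp p.2) hx

/-- The angular quotient carries the speed `r` of the circle of radius `r`, which cancels the weight
`1 / r`. The bound is thus independent of `r`, and the singularity of the Cauchy kernel at `ζ = 1`
does no harm. -/
theorem norm_dbarQ_le {g : qLipAlg E} {L Z : ℝ≥0} (hZ : ϱ + 2 ≤ Z) (hZ0 : 0 < Z)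
    (hg : LipschitzOnWith L (g : E → ℂ) (Metric.ball 0 (Z * R))) (hp : 0 < p.1) (hp' : p.1 ≤ ϱ)
    (n : ℕ) {x : E} (hx : ‖x‖ < R) : ‖(dbarQ n p g : E → ℂ) x‖ ≤ 2 * L * R := by
  have h1 := norm_radQ_le hZ hZ0 hg hp hp' n hx
  have h2 := norm_angQ_le hZ hZ0 hg hp hp' n hx
  rw [dbarQ_apply]
  refine (norm_add_le _ _).trans ?_
  rw [norm_mul, norm_div, Complex.norm_I, Complex.norm_real, Real.norm_of_nonneg hp.le]
  have h3 : 1 / p.1 * ‖(angQ n p g : E → ℂ) x‖ ≤ 1 / p.1 * (p.1 * L * R) := by gcongr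
  have h4 : 1 / p.1 * (p.1 * L * R) = L * R := by field_simp
  linarith

end Pull

/-! ### Almost everywhere convergence of the difference quotients. -/

section Rademacher

theorem tendsto_succ_slope {h : ℝ → ℂ} {t : ℝ} (hd : DifferentiableAt ℝ h t) :
    Tendsto (fun n : ℕ => ((n : ℂ) + 1) * (h (t + 1 / (n + 1)) - h t)) atTop (𝓝 (deriv h t)) := by
  have h1 := hd.hasDerivAt.tendsto_slope_zero_right
  have h2 : Tendsto (fun n : ℕ => 1 / ((n : ℝ) + 1)) atTop (𝓝[>] 0) :=
    tendsto_nhdsWithin_iff.2 ⟨tendsto_one_div_add_atTop_nhds_zero_nat,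
      Eventually.of_forall fun n => Set.mem_Ioi.2 (by positivity)⟩
  refine (h1.comp h2).congr fun n => ?_
  simp [Complex.real_smul]

theorem ae_exists_tendsto_slope {h : ℝ → ℂ} {C : ℝ≥0} {a b : ℝ}
    (hl : LipschitzOnWith C h (Set.Ioo a b)) :
    ∀ᵐ t : ℝ, t ∈ Set.Ioo a b →
      ∃ l, Tendsto (fun n : ℕ => ((n : ℂ) + 1) * (h (t + 1 / (n + 1)) - h t)) atTop (𝓝 l) := by
  filter_upwards [hl.ae_differentiableWithinAt_of_mem_real] with t ht htm
  exact ⟨_, tendsto_succ_slope ((ht htm).differentiableAt (isOpen_Ioo.mem_nhds htm))⟩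

variable {E : Type*} [NormedAddCommGroup E] [NormedSpace ℂ E] [MeasurableSpace E] [BorelSpace E]

/-- The parameter measure. -/
noncomputable def parMeasure (ϱ : ℝ) : Measure (ℝ × ℝ) :=
  (volume.restrict (Set.Ioc 0 ϱ)).prod (volume.restrict (Set.Ioc 0 (2 * Real.pi)))

instance (ϱ : ℝ) : IsFiniteMeasure (parMeasure ϱ) := by unfold parMeasure; infer_instance

theorem ae_parMeasure (ϱ : ℝ) : ∀ᵐ p ∂parMeasure ϱ, 0 < p.1 ∧ p.1 ≤ ϱ := by
  unfold parMeasure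
  have : MeasurableSet {p : ℝ × ℝ | 0 < p.1 ∧ p.1 ≤ ϱ} :=
    (measurableSet_Ioc (a := (0 : ℝ)) (b := ϱ)).preimage measurable_fst
  rw [Measure.ae_prod_iff_ae_ae this]
  filter_upwards [ae_restrict_mem measurableSet_Ioc] with r hr
  exact ae_of_all _ fun _ => hr

omit [MeasurableSpace E] [BorelSpace E] in
theorem continuous_zeta_smul (h h' : ℝ) :
    Continuous fun z : (ℝ × ℝ) × E => zeta (z.1.1 + h) (z.1.2 + h') • z.2 :=
  (continuous_zeta.comp (g := fun p : ℝ × ℝ => zeta p.1 p.2) (f := fun z : (ℝ × ℝ) × E =>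
    (z.1.1 + h, z.1.2 + h')) (by fun_prop)).smul continuous_snd

omit [MeasurableSpace E] [BorelSpace E] in
theorem continuous_radQ (n : ℕ) (g : qLipAlg E) :
    Continuous fun z : (ℝ × ℝ) × E => (radQ n z.1 g : E → ℂ) z.2 := by
  have h1 := (continuousQ g).comp (continuous_zeta_smul (E := E) (1 / (n + 1)) 0)
  have h2 := (continuousQ g).comp (continuous_zeta_smul (E := E) 0 0)
  have := continuous_const (y := ((n : ℂ) + 1)) |>.mul (h1.sub h2)
  refine this.congr fun z => ?_
  simp [radQ, diffQ, pull_apply]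

omit [MeasurableSpace E] [BorelSpace E] in
theorem continuous_angQ (n : ℕ) (g : qLipAlg E) :
    Continuous fun z : (ℝ × ℝ) × E => (angQ n z.1 g : E → ℂ) z.2 := by
  have h1 := (continuousQ g).comp (continuous_zeta_smul (E := E) 0 (1 / (n + 1)))
  have h2 := (continuousQ g).comp (continuous_zeta_smul (E := E) 0 0)
  have := continuous_const (y := ((n : ℂ) + 1)) |>.mul (h1.sub h2)
  refine this.congr fun z => ?_
  simp [angQ, diffQ, pull_apply]

theorem measurableSet_radQ (g : qLipAlg E) : MeasurableSet {z : (ℝ × ℝ) × E |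
    ∃ l, Tendsto (fun n => (radQ n z.1 g : E → ℂ) z.2) atTop (𝓝 l)} :=
  measurableSet_exists_tendsto fun n => (continuous_radQ n g).measurable

theorem measurableSet_angQ (g : qLipAlg E) : MeasurableSet {z : (ℝ × ℝ) × E |
    ∃ l, Tendsto (fun n => (angQ n z.1 g : E → ℂ) z.2) atTop (𝓝 l)} :=
  measurableSet_exists_tendsto fun n => (continuous_angQ n g).measurable

omit [MeasurableSpace E] [BorelSpace E] in
theorem exists_lip_zeta (g : qLipAlg E) (R : ℝ) (x : E) : ∃ C : ℝ≥0, ∀ r θ r' θ' : ℝ,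
    |r| ≤ R → |r'| ≤ R → dist ((g : E → ℂ) (zeta r θ • x)) ((g : E → ℂ) (zeta r' θ' • x)) ≤
      C * ‖zeta r θ - zeta r' θ'‖ := by
  obtain ⟨L, hL⟩ := exists_lipQ g ((1 + |R|) * (‖x‖ + 1))
  have hmem : ∀ r θ : ℝ, |r| ≤ R → zeta r θ • x ∈ Metric.ball (0 : E) ((1 + |R|) * (‖x‖ + 1)) := by
    intro r θ hr
    refine mem_ball_zero_iff.2 (smul_mem_ball (by positivity) ((norm_zeta_le r θ).trans ?_)
      (by linarith))
    linarith [le_abs_self R]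
  refine ⟨L * ‖x‖₊, fun r θ r' θ' hr hr' => ?_⟩
  refine (hL.dist_le_mul _ (hmem r θ hr) _ (hmem r' θ' hr')).trans (le_of_eq ?_)
  rw [dist_eq_norm, ← sub_smul, norm_smul]
  push_cast
  ring

/-- For fixed `x` and `θ` the function `r ↦ g (ζ x)` of one real variable is Lipschitz, hence
differentiable almost everywhere. Fubini exchanges the quantifiers over parameters and points, so no
differentiability theory on `E` is involved. -/
theorem ae_exists_tendsto_radQ (μ : Measure E) [IsFiniteMeasure μ] (ϱ : ℝ) (g : qLipAlg E) :
    ∀ᵐ p ∂parMeasure ϱ, ∀ᵐ x ∂μ,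
      ∃ l, Tendsto (fun n => (radQ n p g : E → ℂ) x) atTop (𝓝 l) := by
  rw [Measure.ae_ae_comm (measurableSet_radQ g)]
  refine ae_of_all _ fun x => ?_
  have hm : MeasurableSet {p : ℝ × ℝ |
      ∃ l, Tendsto (fun n => (radQ n p g : E → ℂ) x) atTop (𝓝 l)} :=
    measurableSet_exists_tendsto fun n =>
      ((continuous_radQ n g).comp (continuous_id.prodMk continuous_const)).measurable
  unfold parMeasure
  rw [Measure.ae_prod_iff_ae_ae hm, Measure.ae_ae_comm hm]
  refine ae_of_all _ fun θ => ?_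
  obtain ⟨C, hC⟩ := exists_lip_zeta g (ϱ + 1) x
  have hlip : LipschitzOnWith C (fun r => (g : E → ℂ) (zeta r θ • x)) (Set.Ioo 0 (ϱ + 1)) := by
    refine LipschitzOnWith.of_dist_le_mul fun r hr s hs => ?_
    refine (hC r θ s θ (abs_le.2 ⟨by linarith [hr.1, hr.2], hr.2.le⟩)
      (abs_le.2 ⟨by linarith [hs.1, hs.2], hs.2.le⟩)).trans ?_
    rw [norm_zeta_sub_radial, Real.dist_eq]
  filter_upwards [ae_restrict_of_ae (ae_exists_tendsto_slope hlip),
    ae_restrict_mem measurableSet_Ioc] with r h1 h2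
  exact h1 ⟨h2.1, by linarith [h2.2]⟩

theorem ae_exists_tendsto_angQ (μ : Measure E) [IsFiniteMeasure μ] (ϱ : ℝ) (g : qLipAlg E) :
    ∀ᵐ p ∂parMeasure ϱ, ∀ᵐ x ∂μ,
      ∃ l, Tendsto (fun n => (angQ n p g : E → ℂ) x) atTop (𝓝 l) := by
  rw [Measure.ae_ae_comm (measurableSet_angQ g)]
  refine ae_of_all _ fun x => ?_
  have hm : MeasurableSet {p : ℝ × ℝ |
      ∃ l, Tendsto (fun n => (angQ n p g : E → ℂ) x) atTop (𝓝 l)} :=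
    measurableSet_exists_tendsto fun n =>
      ((continuous_angQ n g).comp (continuous_id.prodMk continuous_const)).measurable
  unfold parMeasure
  rw [Measure.ae_prod_iff_ae_ae hm]
  refine ae_of_all _ fun r => ?_
  obtain ⟨C, hC⟩ := exists_lip_zeta g |r| x
  have hlip : LipschitzOnWith (C * ‖r‖₊) (fun θ => (g : E → ℂ) (zeta r θ • x))
      (Set.Ioo 0 (2 * Real.pi + 1)) := by
    refine LipschitzOnWith.of_dist_le_mul fun θ _ φ _ => ?_
    refine (hC r θ r φ le_rfl le_rfl).trans ?_
    rw [NNReal.coe_mul, mul_assoc, Real.dist_eq]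
    exact mul_le_mul_of_nonneg_left (norm_zeta_sub_angular r φ θ) C.2
  filter_upwards [ae_restrict_of_ae (ae_exists_tendsto_slope hlip),
    ae_restrict_mem measurableSet_Ioc] with r h1 h2
  exact h1 ⟨h2.1, by linarith [h2.2]⟩

end Rademacher

/-! ### The integrand of the cone, its limit, and the cone as a form. -/

section Kernel

variable {E : Type*} [NormedAddCommGroup E] [NormedSpace ℂ E] {k : ℕ}

/-- The integrand of the cone over `S`. -/
noncomputable def kern (S : Form E k) (n : ℕ) (p : ℝ × ℝ) (f : qLipAlg E) :
    qLipAlg E [⋀^Fin (k + 1)]→ₗ[ℂ] ℂ :=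
  AlternatingMap.alternatizeUncurryFin
    { toFun := fun g => (S (pull (zeta p.1 p.2) f * dbarQ n p g)).compLinearMap
        (pull (zeta p.1 p.2)).toLinearMap
      map_add' := fun g g' => by
        rw [map_add, mul_add, map_add]; rfl
      map_smul' := fun c g => by
        rw [map_smul, mul_smul_comm, map_smul]; rfl }

/-- The terms of the integrand. -/
noncomputable def kernTerm (S : Form E k) (n : ℕ) (p : ℝ × ℝ) (f : qLipAlg E)
    (π : Fin (k + 1) → qLipAlg E) (i : Fin (k + 1)) : ℂ :=
  S (pull (zeta p.1 p.2) f * dbarQ n p (π i)) fun j => pull (zeta p.1 p.2) (π (i.succAbove j))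

theorem kern_apply (S : Form E k) (n : ℕ) (p : ℝ × ℝ) (f : qLipAlg E)
    (π : Fin (k + 1) → qLipAlg E) :
    kern S n p f π = ∑ i : Fin (k + 1), (-1) ^ (i : ℕ) * kernTerm S n p f π i := by
  rw [kern, AlternatingMap.alternatizeUncurryFin_apply]
  refine Finset.sum_congr rfl fun i _ => ?_
  rw [zsmul_eq_mul]
  push_cast
  rfl

theorem kern_add (S : Form E k) (n : ℕ) (p : ℝ × ℝ) (f g : qLipAlg E)
    (π : Fin (k + 1) → qLipAlg E) : kern S n p (f + g) π = kern S n p f π + kern S n p g π := by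
  simp only [kern_apply, kernTerm, map_add, add_mul, AlternatingMap.add_apply, mul_add,
    Finset.sum_add_distrib]

theorem kern_smul (S : Form E k) (n : ℕ) (p : ℝ × ℝ) (c : ℂ) (f : qLipAlg E)
    (π : Fin (k + 1) → qLipAlg E) : kern S n p (c • f) π = c * kern S n p f π := by
  simp only [kern_apply, kernTerm, map_smul, smul_mul_assoc, AlternatingMap.smul_apply, smul_eq_mul,
    Finset.mul_sum]
  exact Finset.sum_congr rfl fun i _ => by ring

variable [MeasurableSpace E] [BorelSpace E] {S : Form E k} {ρ : ℝ} {μ : Measure E}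

omit [MeasurableSpace E] [BorelSpace E] in
theorem equiLip_pull (π : Fin k → qLipAlg E) {ζ : ℕ → ℂ} {Z : ℝ≥0} (hZ : 0 < Z)
    (hζ : ∀ n, ‖ζ n‖ ≤ Z) : EquiLip fun n i => pull (ζ n) (π i) := by
  intro i R
  obtain ⟨L, hL⟩ := exists_lipQ (π i) (Z * R)
  exact ⟨Z * L, fun n => pull_lip hZ hL (hζ n)⟩

omit [MeasurableSpace E] [BorelSpace E] in
theorem tendsPt_pull (π : Fin k → qLipAlg E) {ζ : ℕ → ℂ} {ζ' : ℂ}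
    (h : Tendsto ζ atTop (𝓝 ζ')) : TendsPt (fun n i => pull (ζ n) (π i)) fun i => pull ζ' (π i) :=
  fun i x => ((continuousQ (π i)).tendsto _).comp (h.smul_const x)

/-- Used for measurability in the parameters. The two dilations are independent because the
difference quotients shift only the factor `g`. -/
theorem NormalForm.continuous_pull (hS : NormalForm S ρ μ) (f g : qLipAlg E)
    (π : Fin k → qLipAlg E) : Continuous fun z : ℂ × ℂ =>
      S (pull z.1 f * pull z.2 g) fun i => pull z.1 (π i) := by
  refine continuous_iff_seqContinuous.2 fun z z' hz => ?_
  obtain ⟨Z, hZ⟩ := hz.norm.bddAbove_range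
  have hZ1 : ∀ n, ‖(z n).1‖ ≤ (max Z 1).toNNReal := fun n =>
    ((norm_fst_le _).trans (hZ ⟨n, rfl⟩)).trans ((le_max_left _ _).trans (Real.le_coe_toNNReal _))
  have hZ2 : ∀ n, ‖(z n).2‖ ≤ (max Z 1).toNNReal := fun n =>
    ((norm_snd_le _).trans (hZ ⟨n, rfl⟩)).trans ((le_max_left _ _).trans (Real.le_coe_toNNReal _))
  have hZ0 : 0 < (max Z 1).toNNReal := Real.toNNReal_pos.2 (by positivity)
  set Z' := (max Z 1).toNNReal
  have h1 : Tendsto (fun n => (z n).1) atTop (𝓝 z'.1) := (continuous_fst.tendsto _).comp hz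
  have h2 : Tendsto (fun n => (z n).2) atTop (𝓝 z'.2) := (continuous_snd.tendsto _).comp hz
  obtain ⟨M, hM⟩ := exists_boundQ f (Z' * ρ)
  obtain ⟨N, hN⟩ := exists_boundQ g (Z' * ρ)
  refine hS.tendsto_joint (M := M * N) (equiLip_pull π hZ0 hZ1) (tendsPt_pull π h1) (fun n => ?_)
    (ae_of_all _ fun x => ?_)
  · filter_upwards [hS.conc] with x hx
    simp only [Subalgebra.coe_mul, Pi.mul_apply, pull_apply, norm_mul]
    gcongr
    · exact hM _ (smul_mem_ball hZ0 (hZ1 n) hx).le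
    · exact hN _ (smul_mem_ball hZ0 (hZ2 n) hx).le
  · simp only [Subalgebra.coe_mul, Pi.mul_apply, pull_apply]
    exact (((continuousQ f).tendsto _).comp (h1.smul_const x)).mul
      (((continuousQ g).tendsto _).comp (h2.smul_const x))

theorem NormalForm.measurable_kernTerm (hS : NormalForm S ρ μ) (n : ℕ) (f : qLipAlg E)
    (π : Fin (k + 1) → qLipAlg E) (i : Fin (k + 1)) :
    Measurable fun p => kernTerm S n p f π i := by
  have hG := hS.continuous_pull f (π i) (fun j => π (i.succAbove j))
  set G : ℂ × ℂ → ℂ := fun z => S (pull z.1 f * pull z.2 (π i)) fun j => pull z.1 (π (i.succAbove j))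
    with hGdef
  have e : (fun p => kernTerm S n p f π i) = fun p : ℝ × ℝ =>
      ((n : ℂ) + 1) * (G (zeta p.1 p.2, zeta (p.1 + 1 / (n + 1)) p.2) -
        G (zeta p.1 p.2, zeta p.1 p.2)) + Complex.I / p.1 * (((n : ℂ) + 1) *
        (G (zeta p.1 p.2, zeta p.1 (p.2 + 1 / (n + 1))) - G (zeta p.1 p.2, zeta p.1 p.2))) := by
    ext p
    have e1 : dbarQ n p (π i) = ((n : ℂ) + 1) • (pull (zeta (p.1 + 1 / (n + 1)) p.2) (π i) -
        pull (zeta p.1 p.2) (π i)) + (Complex.I / p.1 : ℂ) • (((n : ℂ) + 1) •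
          (pull (zeta p.1 (p.2 + 1 / (n + 1))) (π i) - pull (zeta p.1 p.2) (π i))) := rfl
    rw [kernTerm, e1]
    simp only [hGdef, mul_add, mul_sub, mul_smul_comm, map_add, map_sub, map_smul, smul_sub,
      AlternatingMap.add_apply, AlternatingMap.sub_apply, AlternatingMap.smul_apply, smul_eq_mul]
  rw [e]
  have hz : ∀ h h' : ℝ, Continuous fun p : ℝ × ℝ => zeta (p.1 + h) (p.2 + h') := fun h h' =>
    continuous_zeta.comp (g := fun p : ℝ × ℝ => zeta p.1 p.2)
      (f := fun p : ℝ × ℝ => (p.1 + h, p.2 + h')) (by fun_prop)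
  have m0 : Measurable fun p : ℝ × ℝ => G (zeta p.1 p.2, zeta p.1 p.2) :=
    (hG.comp (continuous_zeta.prodMk continuous_zeta)).measurable
  have m1 : Measurable fun p : ℝ × ℝ => G (zeta p.1 p.2, zeta (p.1 + 1 / (n + 1)) p.2) := by
    have := hz (1 / (n + 1)) 0
    simp only [add_zero] at this
    exact (hG.comp (continuous_zeta.prodMk this)).measurable
  have m2 : Measurable fun p : ℝ × ℝ => G (zeta p.1 p.2, zeta p.1 (p.2 + 1 / (n + 1))) := by
    have := hz 0 (1 / (n + 1))
    simp only [add_zero] at this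
    exact (hG.comp (continuous_zeta.prodMk this)).measurable
  have m3 : Measurable fun p : ℝ × ℝ => Complex.I / (p.1 : ℂ) :=
    measurable_const.div (Complex.measurable_ofReal.comp measurable_fst)
  exact ((m1.sub m0).const_mul _).add (m3.mul ((m2.sub m0).const_mul _))

theorem NormalForm.measurable_kern (hS : NormalForm S ρ μ) (n : ℕ) (f : qLipAlg E)
    (π : Fin (k + 1) → qLipAlg E) : Measurable fun p => kern S n p f π := by
  simp only [kern_apply]
  exact Finset.measurable_sum _ fun i _ => (hS.measurable_kernTerm n f π i).const_mul _

/-- The slot moved into the function contributes `2 * L i * ρ`, the bound for `dbarQ` on the ball of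
radius `ρ`; each of the other `k` slots contributes `Z * L j` through its dilation. -/
theorem Tame.norm_kernTerm_le (hS : Tame (fun f => ⇑(S f)) ρ μ) {ϱ : ℝ} {Z : ℝ≥0} (hZ : ϱ + 2 ≤ Z)
    (hZ0 : 0 < Z) (f : qLipAlg E) {π : Fin (k + 1) → qLipAlg E} {L : Fin (k + 1) → ℝ≥0}
    (hL : ∀ i, LipschitzOnWith (L i) (π i : E → ℂ) (Metric.ball 0 (Z * ρ))) (n : ℕ) {p : ℝ × ℝ}
    (hp : 0 < p.1) (hp' : p.1 ≤ ϱ) (i : Fin (k + 1)) :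
    ‖kernTerm S n p f π i‖ ≤ 2 * ρ * Z ^ k * (∏ i, (L i : ℝ)) *
      ∫ x, ‖(f : E → ℂ) (zeta p.1 p.2 • x)‖ ∂μ := by
  have := hS.finite
  have hζ : ‖zeta p.1 p.2‖ ≤ Z := norm_zeta_le_of_le hZ hp (by linarith) _
  have h1 := hS.bound (pull (zeta p.1 p.2) f * dbarQ n p (π i))
    (fun j => pull (zeta p.1 p.2) (π (i.succAbove j))) (fun j => Z * L (i.succAbove j))
    (fun j => pull_lip hZ0 (hL _) hζ)
  have h2 : ∫ x, ‖((pull (zeta p.1 p.2) f * dbarQ n p (π i) : qLipAlg E) : E → ℂ) x‖ ∂μ ≤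
      2 * L i * ρ * ∫ x, ‖(f : E → ℂ) (zeta p.1 p.2 • x)‖ ∂μ := by
    rw [← integral_const_mul]
    refine integral_mono_ae (integrableQ hS.conc _).norm
      ((integrableQ hS.conc (pull (zeta p.1 p.2) f)).norm.const_mul _) ?_
    filter_upwards [hS.conc] with x hx
    simp only [Subalgebra.coe_mul, Pi.mul_apply, norm_mul, pull_apply]
    rw [mul_comm]
    gcongr
    exact norm_dbarQ_le hZ hZ0 (hL i) hp hp' n hx
  refine h1.trans ((mul_le_mul_of_nonneg_left h2 (by positivity)).trans (le_of_eq ?_))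
  rw [Fin.prod_univ_succAbove _ i]
  push_cast
  rw [Finset.prod_mul_distrib, Finset.prod_const, Finset.card_univ, Fintype.card_fin]
  ring

theorem Tame.exists_kern_bound (hS : Tame (fun f => ⇑(S f)) ρ μ) (ϱ : ℝ) (f : qLipAlg E)
    (π : Fin (k + 1) → qLipAlg E) :
    ∃ C : ℝ, ∀ n, ∀ᵐ p ∂parMeasure ϱ, ‖kern S n p f π‖ ≤ C := by
  have := hS.finite
  set Z : ℝ≥0 := (max (ϱ + 2) 1).toNNReal
  have hZ : ϱ + 2 ≤ Z := (le_max_left _ _).trans (Real.le_coe_toNNReal _)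
  have hZ0 : 0 < Z := Real.toNNReal_pos.2 (by positivity)
  choose L hL using fun i => exists_lipQ (π i) (Z * ρ)
  obtain ⟨M, hM⟩ := exists_boundQ f (Z * ρ)
  refine ⟨∑ _i : Fin (k + 1), |2 * ρ * Z ^ k * (∏ i, (L i : ℝ))| * (M * μ.real Set.univ),
    fun n => ?_⟩
  filter_upwards [ae_parMeasure ϱ] with p hp
  rw [kern_apply]
  refine norm_sum_le_of_le _ fun i _ => ?_
  rw [norm_mul, norm_pow, norm_neg, norm_one, one_pow, one_mul]
  refine (hS.norm_kernTerm_le hZ hZ0 f hL n hp.1 hp.2 i).trans ?_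
  have h1 : ∫ x, ‖(f : E → ℂ) (zeta p.1 p.2 • x)‖ ∂μ ≤ M * μ.real Set.univ := by
    have : ∫ x, ‖(f : E → ℂ) (zeta p.1 p.2 • x)‖ ∂μ ≤ ∫ _x, (M : ℝ) ∂μ := by
      refine integral_mono_ae (integrableQ hS.conc (pull (zeta p.1 p.2) f)).norm
        (integrable_const _) ?_
      filter_upwards [hS.conc] with x hx
      exact hM _ (smul_mem_ball hZ0 (norm_zeta_le_of_le hZ hp.1 (by linarith [hp.2]) _) hx).le
    refine this.trans (le_of_eq ?_)
    simp [mul_comm]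
  have h2 : 0 ≤ ∫ x, ‖(f : E → ℂ) (zeta p.1 p.2 • x)‖ ∂μ := integral_nonneg fun x => norm_nonneg _
  calc _ ≤ |2 * ρ * Z ^ k * (∏ i, (L i : ℝ))| * ∫ x, ‖(f : E → ℂ) (zeta p.1 p.2 • x)‖ ∂μ := by
        gcongr; exact le_abs_self _
    _ ≤ _ := by gcongr

/-- For almost every parameter the quotients of each `π i` converge `μ`-almost everywhere; the L¹
bound of `S` turns this into convergence of the values. -/
theorem NormalForm.ae_exists_tendsto_kern (hS : NormalForm S ρ μ) (ϱ : ℝ) (f : qLipAlg E)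
    (π : Fin (k + 1) → qLipAlg E) :
    ∀ᵐ p ∂parMeasure ϱ, ∃ l, Tendsto (fun n => kern S n p f π) atTop (𝓝 l) := by
  have := hS.finite
  set Z : ℝ≥0 := (max (ϱ + 2) 1).toNNReal
  have hZ : ϱ + 2 ≤ Z := (le_max_left _ _).trans (Real.le_coe_toNNReal _)
  have hZ0 : 0 < Z := Real.toNNReal_pos.2 (by positivity)
  choose L hL using fun i => exists_lipQ (π i) (Z * ρ)
  obtain ⟨M, hM⟩ := exists_boundQ f (Z * ρ)
  have h1 : ∀ᵐ p ∂parMeasure ϱ, ∀ i, ∀ᵐ x ∂μ,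
      ∃ l, Tendsto (fun n => (radQ n p (π i) : E → ℂ) x) atTop (𝓝 l) :=
    ae_all_iff.2 fun i => ae_exists_tendsto_radQ μ ϱ (π i)
  have h2 : ∀ᵐ p ∂parMeasure ϱ, ∀ i, ∀ᵐ x ∂μ,
      ∃ l, Tendsto (fun n => (angQ n p (π i) : E → ℂ) x) atTop (𝓝 l) :=
    ae_all_iff.2 fun i => ae_exists_tendsto_angQ μ ϱ (π i)
  filter_upwards [h1, h2, ae_parMeasure ϱ] with p hr ha hp
  have hterm : ∀ i, ∃ l, Tendsto (fun n => kernTerm S n p f π i) atTop (𝓝 l) := by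
    intro i
    refine hS.exists_tendsto _ (M := M * (2 * L i * ρ)) (fun n => ?_) ?_
    · filter_upwards [hS.conc] with x hx
      simp only [Subalgebra.coe_mul, Pi.mul_apply, norm_mul, pull_apply]
      gcongr
      · exact hM _ (smul_mem_ball hZ0 (norm_zeta_le_of_le hZ hp.1 (by linarith [hp.2]) _) hx).le
      · exact norm_dbarQ_le hZ hZ0 (hL i) hp.1 hp.2 n hx
    · filter_upwards [hr i, ha i] with x ⟨l, hl⟩ ⟨l', hl'⟩
      exact ⟨_, (hl.add (hl'.const_mul (Complex.I / p.1 : ℂ))).const_mul _⟩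
  choose l hl using hterm
  refine ⟨∑ i : Fin (k + 1), (-1) ^ (i : ℕ) * l i, ?_⟩
  simp only [kern_apply]
  exact tendsto_finsetSum _ fun i _ => (hl i).const_mul _

/-- The approximations of the cone over `S`. -/
noncomputable def coneSeq (S : Form E k) (ϱ : ℝ) (n : ℕ) (f : qLipAlg E)
    (π : Fin (k + 1) → qLipAlg E) : ℂ :=
  -- This is the constant of the Cauchy-Pompeiu formula for `∂_r + (i/r) ∂_θ`. The measure is `dr
  -- dθ` without the Jacobian `r`, which cancels against the kernel.
  -(1 / (2 * Real.pi) : ℂ) * ∫ p, kern S n p f π ∂parMeasure ϱ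

theorem NormalForm.integrable_kern (hS : NormalForm S ρ μ) (ϱ : ℝ) (n : ℕ) (f : qLipAlg E)
    (π : Fin (k + 1) → qLipAlg E) : Integrable (fun p => kern S n p f π) (parMeasure ϱ) := by
  obtain ⟨C, hC⟩ := hS.exists_kern_bound ϱ f π
  exact Integrable.of_bound (hS.measurable_kern n f π).aestronglyMeasurable C (hC n)

theorem NormalForm.exists_tendsto_coneSeq (hS : NormalForm S ρ μ) (ϱ : ℝ) (f : qLipAlg E)
    (π : Fin (k + 1) → qLipAlg E) :
    ∃ l, Tendsto (fun n => coneSeq S ϱ n f π) atTop (𝓝 l) := by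
  obtain ⟨C, hC⟩ := hS.exists_kern_bound ϱ f π
  obtain ⟨G, -, hG⟩ := exists_stronglyMeasurable_limit_of_tendsto_ae
    (fun n => (hS.measurable_kern n f π).aestronglyMeasurable) (hS.ae_exists_tendsto_kern ϱ f π)
  exact ⟨_, (tendsto_integral_of_dominated_convergence (fun _ => C)
    (fun n => (hS.measurable_kern n f π).aestronglyMeasurable) (integrable_const _) hC hG).const_mul
      _⟩

/-- The cone over `S`, truncated at the radius `ϱ`, as a function. -/
noncomputable def coneFun (S : Form E k) (ϱ : ℝ) (f : qLipAlg E) (π : Fin (k + 1) → qLipAlg E) : ℂ :=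
  limUnder atTop fun n => coneSeq S ϱ n f π

theorem NormalForm.tendsto_coneFun (hS : NormalForm S ρ μ) (ϱ : ℝ) (f : qLipAlg E)
    (π : Fin (k + 1) → qLipAlg E) :
    Tendsto (fun n => coneSeq S ϱ n f π) atTop (𝓝 (coneFun S ϱ f π)) :=
  tendsto_nhds_limUnder (hS.exists_tendsto_coneSeq ϱ f π)

/-- The cone over `S`, truncated at the radius `ϱ`. -/
noncomputable def NormalForm.cone (hS : NormalForm S ρ μ) (ϱ : ℝ) : Form E (k + 1) where
  toFun f :=
    { toFun := coneFun S ϱ f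
      map_update_add' := fun π i u v => by
        refine tendsto_nhds_unique (hS.tendsto_coneFun ϱ f _)
          (((hS.tendsto_coneFun ϱ f _).add (hS.tendsto_coneFun ϱ f _)).congr fun n => ?_)
        rw [coneSeq, coneSeq, coneSeq, ← mul_add, ← integral_add (hS.integrable_kern ϱ n f _)
          (hS.integrable_kern ϱ n f _)]
        simp only [AlternatingMap.map_update_add]
      map_update_smul' := fun π i c u => by
        refine tendsto_nhds_unique (hS.tendsto_coneFun ϱ f _)
          (((hS.tendsto_coneFun ϱ f _).const_mul c).congr fun n => ?_)
        rw [coneSeq, coneSeq, mul_left_comm, ← integral_const_mul]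
        simp only [AlternatingMap.map_update_smul, smul_eq_mul]
      map_eq_zero_of_eq' := fun π i j hπ hij => by
        refine tendsto_nhds_unique (hS.tendsto_coneFun ϱ f _) (tendsto_const_nhds.congr fun n => ?_)
        rw [coneSeq]
        simp only [AlternatingMap.map_eq_zero_of_eq _ π hπ hij, integral_zero, mul_zero] }
  map_add' f g := by
    ext π
    refine tendsto_nhds_unique (hS.tendsto_coneFun ϱ (f + g) π)
      (((hS.tendsto_coneFun ϱ f π).add (hS.tendsto_coneFun ϱ g π)).congr fun n => ?_)
    rw [coneSeq, coneSeq, coneSeq, ← mul_add, ← integral_add (hS.integrable_kern ϱ n f _)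
      (hS.integrable_kern ϱ n g _)]
    simp only [kern_add]
  map_smul' c f := by
    ext π
    refine tendsto_nhds_unique (hS.tendsto_coneFun ϱ (c • f) π)
      (((hS.tendsto_coneFun ϱ f π).const_mul c).congr fun n => ?_)
    rw [coneSeq, coneSeq, mul_left_comm, ← integral_const_mul]
    simp only [kern_smul]

theorem NormalForm.tendsto_cone (hS : NormalForm S ρ μ) (ϱ : ℝ) (f : qLipAlg E)
    (π : Fin (k + 1) → qLipAlg E) :
    Tendsto (fun n => coneSeq S ϱ n f π) atTop (𝓝 (hS.cone ϱ f π)) :=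
  hS.tendsto_coneFun ϱ f π

theorem NormalForm.cone_eq_zero (hS : NormalForm S ρ μ) (ϱ : ℝ) (f : qLipAlg E)
    (π : Fin (k + 1) → qLipAlg E)
    (h : ∀ p : ℝ × ℝ, 0 < p.1 → p.1 ≤ ϱ → ∀ i, Tendsto (fun n => kernTerm S n p f π i) atTop (𝓝 0)) :
    hS.cone ϱ f π = 0 := by
  obtain ⟨C, hC⟩ := hS.exists_kern_bound ϱ f π
  have h1 := (tendsto_integral_of_dominated_convergence (f := fun _ => 0) (fun _ => C)
    (fun n => (hS.measurable_kern n f π).aestronglyMeasurable) (integrable_const _) hC (by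
      filter_upwards [ae_parMeasure ϱ] with p hp
      simp only [kern_apply]
      have := tendsto_finsetSum (Finset.univ : Finset (Fin (k + 1))) fun i _ =>
        (h p hp.1 hp.2 i).const_mul ((-1) ^ (i : ℕ))
      simpa using this)).const_mul (-(1 / (2 * Real.pi) : ℂ))
  rw [integral_zero, mul_zero] at h1
  exact tendsto_nhds_unique (hS.tendsto_cone ϱ f π) h1

end Kernel

/-! ### Mass, locality and truncation of the cone. -/

section ConeMass

variable {E : Type*} [NormedAddCommGroup E] [NormedSpace ℂ E] [MeasurableSpace E] [BorelSpace E]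
  {k : ℕ} {S : Form E k} {ρ : ℝ} {μ : Measure E}

/-- The measure that controls the cone. -/
noncomputable def coneMeasure (μ : Measure E) (ϱ : ℝ) (c : ℝ≥0) : Measure E :=
  c • ((parMeasure ϱ).prod μ).map fun z : (ℝ × ℝ) × E => zeta z.1.1 z.1.2 • z.2

omit [MeasurableSpace E] [BorelSpace E] in
theorem continuous_zeta_smul_snd : Continuous fun z : (ℝ × ℝ) × E => zeta z.1.1 z.1.2 • z.2 := by
  simpa using continuous_zeta_smul (E := E) 0 0

instance (μ : Measure E) [IsFiniteMeasure μ] (ϱ : ℝ) (c : ℝ≥0) :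
    IsFiniteMeasure (coneMeasure μ ϱ c) := by
  unfold coneMeasure; infer_instance

/-- The controlling measure is an image of parameters times `μ`. The image of the compact parameter
rectangle times a compact set of almost full `μ`-measure is compact and carries almost everything.
-/
theorem innerRegular_coneMeasure (μ : Measure E) [IsFiniteMeasure μ] [μ.InnerRegular] (ϱ : ℝ)
    (c : ℝ≥0) : (coneMeasure μ ϱ c).InnerRegular := by
  refine innerRegular_of_tight _ fun ε hε => ?_
  -- The added 1 only keeps `t` nonzero, so that `ε / t` is a legitimate tolerance.
  set t : ℝ≥0∞ := c * parMeasure ϱ Set.univ + 1 with ht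
  have ht0 : t ≠ 0 := by simp [ht]
  have htt : t ≠ ∞ := by simp [ht, ENNReal.mul_ne_top]
  obtain ⟨C, hC, hμC⟩ := exists_isCompact_measure_compl_le μ (ε := ε / t)
    (by simp [ENNReal.div_eq_zero_iff, hε, htt])
  set P : Set (ℝ × ℝ) := Set.Icc 0 ϱ ×ˢ Set.Icc 0 (2 * Real.pi)
  have hP : parMeasure ϱ Pᶜ = 0 := by
    have h1 : ∀ᵐ p ∂parMeasure ϱ, p ∈ P := by
      unfold parMeasure
      rw [Measure.prod_restrict]
      filter_upwards [ae_restrict_mem (measurableSet_Ioc.prod measurableSet_Ioc)] with p hp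
      exact ⟨Set.Ioc_subset_Icc_self hp.1, Set.Ioc_subset_Icc_self hp.2⟩
    exact h1
  have hK : IsCompact ((fun z : (ℝ × ℝ) × E => zeta z.1.1 z.1.2 • z.2) '' (P ×ˢ C)) :=
    ((isCompact_Icc.prod isCompact_Icc).prod hC).image continuous_zeta_smul_snd
  refine ⟨_, hK, ?_⟩
  rw [coneMeasure, Measure.smul_apply, Measure.map_apply continuous_zeta_smul_snd.measurable
    hK.isClosed.measurableSet.compl]
  have hsub : (fun z : (ℝ × ℝ) × E => zeta z.1.1 z.1.2 • z.2) ⁻¹'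
      ((fun z : (ℝ × ℝ) × E => zeta z.1.1 z.1.2 • z.2) '' (P ×ˢ C))ᶜ ⊆
        (Pᶜ ×ˢ Set.univ) ∪ (Set.univ ×ˢ Cᶜ) := by
    intro z hz
    by_contra hcon
    simp only [Set.mem_union, Set.mem_prod, Set.mem_compl_iff, Set.mem_univ, and_true, true_and,
      not_or, not_not] at hcon
    exact hz ⟨z, hcon, rfl⟩
  have h2 : ((parMeasure ϱ).prod μ) ((Pᶜ ×ˢ Set.univ) ∪ (Set.univ ×ˢ Cᶜ)) ≤
      parMeasure ϱ Set.univ * (ε / t) := by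
    refine (measure_union_le _ _).trans ?_
    rw [Measure.prod_prod, Measure.prod_prod, hP, zero_mul, zero_add]
    gcongr
  calc (c • ((parMeasure ϱ).prod μ) _ : ℝ≥0∞) ≤ c * (parMeasure ϱ Set.univ * (ε / t)) := by
        rw [ENNReal.smul_def, smul_eq_mul]
        gcongr
        exact (measure_mono hsub).trans h2
    _ = (c * parMeasure ϱ Set.univ) * (ε / t) := by rw [mul_assoc]
    _ ≤ t * (ε / t) := by gcongr; exact le_self_add
    _ = ε := ENNReal.mul_div_cancel ht0 htt

theorem ae_coneMeasure [IsFiniteMeasure μ] (hμ : ∀ᵐ x ∂μ, ‖x‖ < ρ) {ϱ : ℝ} {Z : ℝ≥0}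
    (hZ : ϱ + 2 ≤ Z) (hZ0 : 0 < Z) (c : ℝ≥0) : ∀ᵐ x ∂coneMeasure μ ϱ c, ‖x‖ < Z * ρ := by
  unfold coneMeasure
  refine Measure.ae_smul_measure ?_ c
  rw [ae_map_iff continuous_zeta_smul_snd.measurable.aemeasurable
    (isOpen_lt continuous_norm continuous_const).measurableSet]
  filter_upwards [Measure.quasiMeasurePreserving_fst.ae (ae_parMeasure ϱ),
    Measure.quasiMeasurePreserving_snd.ae hμ] with z h1 h2
  exact smul_mem_ball hZ0 (norm_zeta_le_of_le hZ h1.1 (by linarith [h1.2]) _) h2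

theorem integral_coneMeasure [IsFiniteMeasure μ] (hμ : ∀ᵐ x ∂μ, ‖x‖ < ρ) {ϱ : ℝ} {Z : ℝ≥0}
    (hZ : ϱ + 2 ≤ Z) (hZ0 : 0 < Z) (c : ℝ≥0) (f : qLipAlg E) :
    Integrable (fun p => ∫ x, ‖(f : E → ℂ) (zeta p.1 p.2 • x)‖ ∂μ) (parMeasure ϱ) ∧
    ∫ x, ‖(f : E → ℂ) x‖ ∂coneMeasure μ ϱ c =
      c * ∫ p, ∫ x, ‖(f : E → ℂ) (zeta p.1 p.2 • x)‖ ∂μ ∂parMeasure ϱ := by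
  have hae := ae_coneMeasure hμ hZ hZ0 1
  have hi := (integrableQ hae f).norm
  rw [coneMeasure, one_smul] at hi
  have hi2 := (integrable_map_measure hi.aestronglyMeasurable
    continuous_zeta_smul_snd.measurable.aemeasurable).1 hi
  refine ⟨hi2.integral_prod_left, ?_⟩
  rw [coneMeasure, integral_smul_nnreal_measure, integral_map
    continuous_zeta_smul_snd.measurable.aemeasurable hi.aestronglyMeasurable, NNReal.smul_def,
    smul_eq_mul]
  congr 1
  exact integral_prod _ hi2

theorem NormalForm.norm_cone_le (hS : NormalForm S ρ μ) (hρ : 0 ≤ ρ) {ϱ : ℝ} {Z : ℝ≥0}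
    (hZ : ϱ + 2 ≤ Z) (hZ0 : 0 < Z) (f : qLipAlg E) (π : Fin (k + 1) → qLipAlg E)
    (L : Fin (k + 1) → ℝ≥0)
    (hL : ∀ i, LipschitzOnWith (L i) (π i : E → ℂ) (Metric.ball 0 (Z * ρ))) :
    ‖hS.cone ϱ f π‖ ≤ (∏ i, (L i : ℝ)) *
      ∫ x, ‖(f : E → ℂ) x‖ ∂coneMeasure μ ϱ ((k + 1) * (2 * ρ.toNNReal * Z ^ k)) := by
  have := hS.finite
  refine le_of_tendsto (hS.tendsto_cone ϱ f π).norm (Eventually.of_forall fun n => ?_)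
  obtain ⟨h1, h2⟩ := integral_coneMeasure hS.conc hZ hZ0 ((k + 1) * (2 * ρ.toNNReal * Z ^ k)) f
  rw [h2, coneSeq, norm_mul]
  have h3 : ‖(-(1 / (2 * Real.pi) : ℂ))‖ ≤ 1 := by
    rw [norm_neg, norm_div, norm_one, norm_mul, Complex.norm_real, Real.norm_of_nonneg
      Real.pi_pos.le, Complex.norm_ofNat, div_le_one (by positivity)]
    linarith [Real.pi_gt_three]
  refine (mul_le_of_le_one_left (norm_nonneg _) h3).trans ?_
  refine (norm_integral_le_of_norm_le (h1.const_mul ((k + 1) * (2 * ρ * Z ^ k * ∏ i, (L i : ℝ)))) ?_).trans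
    (le_of_eq ?_)
  · filter_upwards [ae_parMeasure ϱ] with p hp
    rw [kern_apply]
    have : ∀ i ∈ (Finset.univ : Finset (Fin (k + 1))), ‖(-1) ^ (i : ℕ) * kernTerm S n p f π i‖ ≤
        2 * ρ * Z ^ k * (∏ i, (L i : ℝ)) * ∫ x, ‖(f : E → ℂ) (zeta p.1 p.2 • x)‖ ∂μ := by
      intro i _
      rw [norm_mul, norm_pow, norm_neg, norm_one, one_pow, one_mul]
      exact hS.norm_kernTerm_le hZ hZ0 f hL n hp.1 hp.2 i
    refine (norm_sum_le_of_le _ this).trans (le_of_eq ?_)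
    rw [Finset.sum_const, Finset.card_univ, Fintype.card_fin, nsmul_eq_mul]
    push_cast
    ring
  · rw [integral_const_mul]
    push_cast
    rw [Real.coe_toNNReal _ hρ]
    ring

theorem NormalForm.tendsto_kernTerm_zero (hS : NormalForm S ρ μ) {ϱ : ℝ} (f : qLipAlg E)
    (π : Fin (k + 1) → qLipAlg E) {p : ℝ × ℝ} (hp : 0 < p.1) (hp' : p.1 ≤ ϱ) (i : Fin (k + 1))
    (h : ∀ x, (f : E → ℂ) (zeta p.1 p.2 • x) ≠ 0 →
      Tendsto (fun n => (dbarQ n p (π i) : E → ℂ) x) atTop (𝓝 0)) :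
    Tendsto (fun n => kernTerm S n p f π i) atTop (𝓝 0) := by
  set Z : ℝ≥0 := (max (ϱ + 2) 1).toNNReal
  have hZ : ϱ + 2 ≤ Z := (le_max_left _ _).trans (Real.le_coe_toNNReal _)
  have hZ0 : 0 < Z := Real.toNNReal_pos.2 (by positivity)
  obtain ⟨L, hL⟩ := exists_lipQ (π i) (Z * ρ)
  obtain ⟨M, hM⟩ := exists_boundQ f (Z * ρ)
  have := hS.toTame.tendsto_of_ae_tendsto (fun j => pull (zeta p.1 p.2) (π (i.succAbove j)))
    (g := fun n => pull (zeta p.1 p.2) f * dbarQ n p (π i)) (g' := 0) (M := M * (2 * L * ρ))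
    (fun n => ?_) (ae_of_all _ fun x => ?_)
  · rw [map_zero, AlternatingMap.zero_apply] at this
    exact this
  · filter_upwards [hS.conc] with x hx
    simp only [Subalgebra.coe_mul, Pi.mul_apply, norm_mul, pull_apply]
    gcongr
    · exact hM _ (smul_mem_ball hZ0 (norm_zeta_le_of_le hZ hp (by linarith) _) hx).le
    · exact norm_dbarQ_le hZ hZ0 hL hp hp' n hx
  · simp only [Subalgebra.coe_mul, Pi.mul_apply, pull_apply]
    by_cases h0 : (f : E → ℂ) (zeta p.1 p.2 • x) = 0
    · simp [h0]
    · simpa using (h x h0).const_mul ((f : E → ℂ) (zeta p.1 p.2 • x))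

theorem tendsto_zeta_radial (r θ : ℝ) :
    Tendsto (fun n : ℕ => zeta (r + 1 / (n + 1)) θ) atTop (𝓝 (zeta r θ)) := by
  have h1 : Tendsto (fun n : ℕ => ((r + 1 / ((n : ℝ) + 1), θ) : ℝ × ℝ)) atTop (𝓝 (r, θ)) := by
    refine Tendsto.prodMk_nhds ?_ tendsto_const_nhds
    simpa using tendsto_one_div_add_atTop_nhds_zero_nat.const_add r
  exact (continuous_zeta.tendsto _).comp h1

theorem tendsto_zeta_angular (r θ : ℝ) :
    Tendsto (fun n : ℕ => zeta r (θ + 1 / (n + 1))) atTop (𝓝 (zeta r θ)) := by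
  have h1 : Tendsto (fun n : ℕ => ((r, θ + 1 / ((n : ℝ) + 1)) : ℝ × ℝ)) atTop (𝓝 (r, θ)) := by
    refine Tendsto.prodMk_nhds tendsto_const_nhds ?_
    simpa using tendsto_one_div_add_atTop_nhds_zero_nat.const_add θ
  exact (continuous_zeta.tendsto _).comp h1

/-- If the constant function is the differentiated one, its quotients vanish for large `n` at each
point that counts. Otherwise it occupies a slot of `S`, and the dilated form falls under the
locality of `S`. -/
theorem NormalForm.cone_loc (hS : NormalForm S ρ μ) (ϱ : ℝ) (f : qLipAlg E)
    (π : Fin (k + 1) → qLipAlg E) (i : Fin (k + 1)) (c : ℂ) (W : Set E) (hW : IsOpen W)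
    (hfW : tsupport (f : E → ℂ) ⊆ W) (h : ∀ x ∈ W, (π i : E → ℂ) x = c) : hS.cone ϱ f π = 0 := by
  refine hS.cone_eq_zero ϱ f π fun p hp hp' j => ?_
  by_cases hj : j = i
  · subst hj
    refine hS.tendsto_kernTerm_zero f π hp hp' j fun x hx => ?_
    have hxW : zeta p.1 p.2 • x ∈ W := hfW (subset_tsupport _ hx)
    have h1 := ((tendsto_zeta_radial p.1 p.2).smul_const x).eventually (hW.mem_nhds hxW)
    have h2 := ((tendsto_zeta_angular p.1 p.2).smul_const x).eventually (hW.mem_nhds hxW)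
    refine tendsto_const_nhds.congr' ?_
    filter_upwards [h1, h2] with n h1 h2
    rw [dbarQ_apply, radQ, angQ, diffQ_apply, diffQ_apply, h _ hxW, h _ h1, h _ h2]
    simp
  · obtain ⟨m, rfl⟩ := Fin.exists_succAbove_eq (Ne.symm hj)
    have : ∀ n, kernTerm S n p f π j = 0 := fun n =>
      hS.loc _ _ m c ((fun x => zeta p.1 p.2 • x) ⁻¹' W) (hW.preimage (continuous_const_smul _))
        ((tsupport_pull_mul_subset _ _ _).trans (Set.preimage_mono hfW)) fun x hx => h _ hx
    simp [this]

theorem NormalForm.tame_cone (hS : NormalForm S ρ μ) (hρ : 0 ≤ ρ) {ϱ : ℝ} {Z : ℝ≥0}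
    (hZ : ϱ + 2 ≤ Z) (hZ0 : 0 < Z) : Tame (fun f => ⇑(hS.cone ϱ f)) (Z * ρ)
      (coneMeasure μ ϱ ((k + 1) * (2 * ρ.toNNReal * Z ^ k))) := by
  have := hS.finite
  have := hS.inner
  exact ⟨inferInstance, innerRegular_coneMeasure _ _ _, ae_coneMeasure hS.conc hZ hZ0 _,
    hS.norm_cone_le hρ hZ hZ0, hS.cone_loc ϱ⟩

/-- For each fixed parameter the dilated family is again admissible, with `c` replaced by `c * 2 * L
* ρ` and `L` by `Z * L`. Summing over the `k + 1` slots and integrating over the parameters gives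
the factor in front of `m`. -/
theorem NormalForm.famBound_cone (hS : NormalForm S ρ μ) (hρ : 0 < ρ) {ϱ : ℝ} {Z : ℝ≥0}
    (hZ : ϱ + 2 ≤ Z) (hZ0 : 0 < Z) {m : ℝ≥0∞} (hm : FamBound (fun f => ⇑(S f)) ρ m) :
    FamBound (fun f => ⇑(hS.cone ϱ f)) (Z * ρ)
      (((k + 1) * (2 * ρ.toNNReal * Z ^ k) : ℝ≥0) * parMeasure ϱ Set.univ * m) := by
  intro N f π c L hc hL hf hπ
  have hρ' : (ρ.toNNReal : ℝ) = ρ := Real.coe_toNNReal _ hρ.le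
  have hkern : ∀ n, ∀ p : ℝ × ℝ, 0 < p.1 → p.1 ≤ ϱ → ∑ j, ‖kern S n p (f j) (π j)‖ₑ ≤
      c * L ^ (k + 1) * (((k + 1) * (2 * ρ.toNNReal * Z ^ k) : ℝ≥0) * m) := by
    intro n p hp hp'
    have hζ : ‖zeta p.1 p.2‖ ≤ Z := norm_zeta_le_of_le hZ hp (by linarith) _
    have h1 : ∀ i : Fin (k + 1), ∑ j, ‖kernTerm S n p (f j) (π j) i‖ₑ ≤
        (c * (2 * L * ρ.toNNReal) : ℝ≥0) * (Z * L : ℝ≥0) ^ k * m := by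
      intro i
      refine hm N (fun j => pull (zeta p.1 p.2) (f j) * dbarQ n p (π j i))
        (fun j l => pull (zeta p.1 p.2) (π j (i.succAbove l))) _ _
        (by have := Real.toNNReal_pos.2 hρ; positivity) (by positivity) (fun x hx => ?_)
        fun j l => pull_lip hZ0 (hπ j _) hζ
      calc ∑ j, ‖((pull (zeta p.1 p.2) (f j) * dbarQ n p (π j i) : qLipAlg E) : E → ℂ) x‖
          ≤ ∑ j, ‖(f j : E → ℂ) (zeta p.1 p.2 • x)‖ * (2 * L * ρ) := by
            refine Finset.sum_le_sum fun j _ => ?_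
            rw [Subalgebra.coe_mul, Pi.mul_apply, norm_mul, pull_apply]
            gcongr
            exact norm_dbarQ_le hZ hZ0 (hπ j i) hp hp' n hx
        _ ≤ c * (2 * L * ρ) := by
            rw [← Finset.sum_mul]
            gcongr
            exact hf _ (smul_mem_ball hZ0 hζ hx)
        _ = _ := by push_cast; rw [hρ']
    calc ∑ j, ‖kern S n p (f j) (π j)‖ₑ
        ≤ ∑ j, ∑ i, ‖kernTerm S n p (f j) (π j) i‖ₑ := by
          refine Finset.sum_le_sum fun j _ => ?_
          rw [kern_apply]
          refine (enorm_sum_le _ _).trans (Finset.sum_le_sum fun i _ => ?_)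
          rw [enorm_mul, enorm_pow, enorm_neg, enorm_one, one_pow, one_mul]
      _ = ∑ i, ∑ j, ‖kernTerm S n p (f j) (π j) i‖ₑ := Finset.sum_comm
      _ ≤ ∑ _i : Fin (k + 1), (c * (2 * L * ρ.toNNReal) : ℝ≥0) * (Z * L : ℝ≥0) ^ k * m :=
          Finset.sum_le_sum fun i _ => h1 i
      _ = _ := by
          rw [Finset.sum_const, Finset.card_univ, Fintype.card_fin, nsmul_eq_mul]
          push_cast
          ring
  have hlim : Tendsto (fun n => ∑ j, ‖coneSeq S ϱ n (f j) (π j)‖ₑ) atTop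
      (𝓝 (∑ j, ‖hS.cone ϱ (f j) (π j)‖ₑ)) :=
    tendsto_finsetSum _ fun j _ => (hS.tendsto_cone ϱ (f j) (π j)).enorm
  refine le_of_tendsto hlim (Eventually.of_forall fun n => ?_)
  have h3 : ‖(-(1 / (2 * Real.pi) : ℂ))‖ₑ ≤ 1 := by
    rw [← enorm_one (G := ℂ)]
    rw [enorm_le_iff_norm_le]
    rw [norm_neg, norm_div, norm_one, norm_mul, Complex.norm_real, Real.norm_of_nonneg
      Real.pi_pos.le, Complex.norm_ofNat, div_le_one (by positivity)]
    linarith [Real.pi_gt_three]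
  calc ∑ j, ‖coneSeq S ϱ n (f j) (π j)‖ₑ
      ≤ ∑ j, ∫⁻ p, ‖kern S n p (f j) (π j)‖ₑ ∂parMeasure ϱ := by
        refine Finset.sum_le_sum fun j _ => ?_
        rw [coneSeq, enorm_mul]
        refine (mul_le_of_le_one_left zero_le h3).trans (enorm_integral_le_lintegral_enorm _)
    _ = ∫⁻ p, ∑ j, ‖kern S n p (f j) (π j)‖ₑ ∂parMeasure ϱ :=
        (lintegral_finsetSum _ fun j _ => (hS.measurable_kern n (f j) (π j)).enorm).symm
    _ ≤ ∫⁻ _p, c * L ^ (k + 1) * (((k + 1) * (2 * ρ.toNNReal * Z ^ k) : ℝ≥0) * m) ∂parMeasure ϱ := by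
        refine lintegral_mono_ae ?_
        filter_upwards [ae_parMeasure ϱ] with p hp using hkern n p hp.1 hp.2
    _ = _ := by rw [lintegral_const]; ring

/-- The radii beyond `ϱ` contribute nothing once the dilated `f` vanishes `μ`-almost everywhere
there; this makes the truncations compatible. -/
theorem NormalForm.cone_eq_cone (hS : NormalForm S ρ μ) {ϱ ϱ' : ℝ} (h : ϱ ≤ ϱ') (f : qLipAlg E)
    (π : Fin (k + 1) → qLipAlg E)
    (hf : ∀ p : ℝ × ℝ, ϱ < p.1 → ∀ᵐ x ∂μ, (f : E → ℂ) (zeta p.1 p.2 • x) = 0) :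
    hS.cone ϱ f π = hS.cone ϱ' f π := by
  refine tendsto_nhds_unique (hS.tendsto_cone ϱ f π) ((hS.tendsto_cone ϱ' f π).congr fun n => ?_)
  rw [coneSeq, coneSeq]
  congr 1
  unfold parMeasure
  rw [Measure.prod_restrict, Measure.prod_restrict]
  refine setIntegral_eq_of_subset_of_forall_sdiff_eq_zero (measurableSet_Ioc.prod measurableSet_Ioc)
    (Set.prod_mono (Set.Ioc_subset_Ioc_right h) subset_rfl) fun p hp => ?_
  have hp1 : ϱ < p.1 := by
    by_contra hcon
    exact hp.2 ⟨⟨hp.1.1.1, not_lt.1 hcon⟩, hp.1.2⟩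
  rw [kern_apply]
  refine Finset.sum_eq_zero fun i _ => ?_
  rw [mul_eq_zero]
  right
  choose L hL using fun j => exists_lipQ (pull (zeta p.1 p.2) (π (i.succAbove j))) ρ
  have h1 := hS.bound (pull (zeta p.1 p.2) f * dbarQ n p (π i)) _ L hL
  have h2 : ∫ x, ‖((pull (zeta p.1 p.2) f * dbarQ n p (π i) : qLipAlg E) : E → ℂ) x‖ ∂μ = 0 := by
    refine integral_eq_zero_of_ae ?_
    filter_upwards [hf p hp1] with x hx
    simp [hx]
  rw [h2, mul_zero] at h1
  exact norm_le_zero_iff.1 h1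

end ConeMass

/-! ### The cone raises the antiholomorphic degree. -/

section Bidimension

variable {E : Type*} [NormedAddCommGroup E] [NormedSpace ℂ E] {k : ℕ}

/-- A functional on `qLipAlg E` of bidimension `(p, q)`. -/
def BidimQ (G : qLipAlg E → (Fin k → qLipAlg E) → ℂ) (p q : ℤ) : Prop :=
  ∀ (f : qLipAlg E) (π : Fin k → qLipAlg E) (I : Finset (Fin k)),
    ((p < (I.card : ℤ) ∧ ∀ i ∈ I, HolomorphicNear (π i : E → ℂ) (tsupport (f : E → ℂ))) ∨
      (q < (I.card : ℤ) ∧ ∀ i ∈ I, AntiholomorphicNear (π i : E → ℂ) (tsupport (f : E → ℂ)))) →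
    G f π = 0

theorem HolomorphicNear.comp_smul {g : E → ℂ} {s t : Set E} {ζ : ℂ} (h : HolomorphicNear g s)
    (ht : t ⊆ (fun x => ζ • x) ⁻¹' s) : HolomorphicNear (fun x => g (ζ • x)) t := by
  obtain ⟨W, hW, hs, hg⟩ := h
  exact ⟨_, hW.preimage (continuous_const_smul ζ), ht.trans (Set.preimage_mono hs),
    hg.comp (differentiable_id.const_smul ζ).differentiableOn fun x hx => hx⟩

theorem hasDerivAt_zeta_radial (r θ : ℝ) :
    HasDerivAt (fun s : ℝ => zeta s θ) (Complex.exp (θ * Complex.I)) r := by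
  have := (((hasDerivAt_id r).ofReal_comp).mul_const (Complex.exp (θ * Complex.I))).const_add 1
  rw [Complex.ofReal_one, one_mul] at this
  exact this

theorem hasDerivAt_zeta_angular (r θ : ℝ) :
    HasDerivAt (fun s : ℝ => zeta r s) (r * (Complex.exp (θ * Complex.I) * Complex.I)) θ := by
  have := ((((hasDerivAt_id θ).ofReal_comp).mul_const Complex.I).cexp.const_mul (r : ℂ)).const_add 1
  rw [Complex.ofReal_one, one_mul] at this
  exact this

/-- Cauchy-Riemann in polar coordinates: for `D` the complex derivative along the line, `∂_r =
exp(iθ) D` and `∂_θ = i r exp(iθ) D`, so `∂_r + (i/r) ∂_θ` gives 0. -/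
theorem tendsto_dbarQ_zero {g : qLipAlg E} {p : ℝ × ℝ} (hp : 0 < p.1) {x : E}
    (hg : DifferentiableAt ℂ (g : E → ℂ) (zeta p.1 p.2 • x)) :
    Tendsto (fun n => (dbarQ n p g : E → ℂ) x) atTop (𝓝 0) := by
  have hd : DifferentiableAt ℂ (fun w : ℂ => (g : E → ℂ) (w • x)) (zeta p.1 p.2) :=
    DifferentiableAt.comp (zeta p.1 p.2) (g := (g : E → ℂ)) (f := fun w : ℂ => w • x) hg
      (differentiableAt_id.smul_const x)
  set D := deriv (fun w : ℂ => (g : E → ℂ) (w • x)) (zeta p.1 p.2)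
  have h1 := hd.hasDerivAt.scomp p.1 (hasDerivAt_zeta_radial p.1 p.2)
  have h2 := hd.hasDerivAt.scomp p.2 (hasDerivAt_zeta_angular p.1 p.2)
  have h3 := tendsto_succ_slope h1.differentiableAt
  have h4 := (tendsto_succ_slope h2.differentiableAt).const_mul (Complex.I / p.1)
  rw [h1.deriv] at h3
  rw [h2.deriv] at h4
  have h5 := h3.add h4
  have hp' : (p.1 : ℂ) ≠ 0 := by exact_mod_cast hp.ne'
  have e : Complex.exp (p.2 * Complex.I) • D + Complex.I / p.1 *
      ((p.1 * (Complex.exp (p.2 * Complex.I) * Complex.I)) • D) = 0 := by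
    simp only [smul_eq_mul]
    field_simp
    rw [Complex.I_sq]; ring
  rw [e] at h5
  exact h5

theorem card_preimage_succAbove (j : Fin (k + 1)) (I : Finset (Fin (k + 1))) :
    (Finset.univ.filter fun m => j.succAbove m ∈ I).card = (I.erase j).card := by
  rw [← Finset.card_map (Fin.succAboveEmb j)]
  congr 1
  ext x
  simp only [Finset.mem_map, Finset.mem_filter, Finset.mem_univ, true_and, Fin.coe_succAboveEmb,
    Finset.mem_erase]
  constructor
  · rintro ⟨m, hm, rfl⟩
    exact ⟨Fin.succAbove_ne _ _, hm⟩
  · rintro ⟨h1, h2⟩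
    obtain ⟨m, rfl⟩ := Fin.exists_succAbove_eq h1
    exact ⟨m, h2, rfl⟩

variable [MeasurableSpace E] [BorelSpace E] {S : Form E k} {ρ : ℝ} {μ : Measure E}

/-- A term in which a holomorphic `π j` is differentiated tends to 0, and in any other term all the
holomorphic functions of `I` remain in the slots of `S`. Among antiholomorphic functions at most one
is lost to differentiation, so `q + 1` replaces `q`. -/
theorem NormalForm.bidimQ_cone (hS : NormalForm S ρ μ) (ϱ : ℝ) {p q : ℤ}
    (hb : BidimQ (fun f => ⇑(S f)) p q) : BidimQ (fun f => ⇑(hS.cone ϱ f)) p (q + 1) := by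
  intro f π I hI
  refine hS.cone_eq_zero ϱ f π fun z hz hz' j => ?_
  have hsub : ∀ n, tsupport ((pull (zeta z.1 z.2) f * dbarQ n z (π j) : qLipAlg E) : E → ℂ) ⊆
      (fun x => zeta z.1 z.2 • x) ⁻¹' tsupport (f : E → ℂ) := fun n => tsupport_pull_mul_subset _ _ _
  by_cases hj : j ∈ I ∧ HolomorphicNear (π j : E → ℂ) (tsupport (f : E → ℂ))
  · obtain ⟨W, hW, hfW, hd⟩ := hj.2
    exact hS.tendsto_kernTerm_zero f π hz hz' j fun x hx => tendsto_dbarQ_zero hz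
      (hd.differentiableAt (hW.mem_nhds (hfW (subset_tsupport _ hx))))
  · have : ∀ n, kernTerm S n z f π j = 0 := by
      intro n
      refine hb _ _ (Finset.univ.filter fun m => j.succAbove m ∈ I) ?_
      rw [card_preimage_succAbove]
      rcases hI with ⟨h1, h2⟩ | ⟨h1, h2⟩
      · have hjI : j ∉ I := fun h => hj ⟨h, h2 j h⟩
        rw [Finset.erase_eq_of_notMem hjI]
        exact Or.inl ⟨h1, fun i hi => (h2 _ (Finset.mem_filter.1 hi).2).comp_smul (hsub n)⟩
      · have := Finset.pred_card_le_card_erase (s := I) (a := j)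
        refine Or.inr ⟨by lia, fun i hi => ?_⟩
        have h3 := h2 _ (Finset.mem_filter.1 hi).2
        exact HolomorphicNear.comp_smul (g := fun x => starRingEnd ℂ ((π (j.succAbove i) : E → ℂ) x))
          h3 (hsub n)
    simp [this]

end Bidimension

/-! ### Variation of normal forms in their slots. -/

section Variation

variable {E : Type*} [NormedAddCommGroup E] {k : ℕ}

/-- The first entries of `π'` followed by the last entries of `π`. -/
def splice {α : Type*} (π π' : Fin k → α) (m : ℕ) (i : Fin k) : α := if (i : ℕ) < m then π' i else π i

theorem Form.map_sub_eq_sum (S : Form E k) (f : qLipAlg E) (π π' : Fin k → qLipAlg E) :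
    S f π' - S f π = ∑ j : Fin k, S f (Function.update (splice π π' j) j (π' j - π j)) := by
  have h0 : splice π π' 0 = π := by ext i; simp [splice]
  have h1 : splice π π' k = π' := by ext i; simp [splice]
  have h2 : ∀ j : Fin k, S f (Function.update (splice π π' j) j (π' j - π j)) =
      S f (splice π π' (j + 1)) - S f (splice π π' j) := by
    intro j
    rw [AlternatingMap.map_update_sub]
    congr 2
    · ext i : 1
      by_cases hij : i = j
      · subst hij; simp [splice]
      · have : (i : ℕ) ≠ j := fun h => hij (Fin.ext h)
        rw [Function.update_of_ne hij]
        by_cases h : (i : ℕ) < j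
        · simp [splice, h, h.trans (Nat.lt_succ_self _)]
        · have h' : ¬ (i : ℕ) < j + 1 := by lia
          simp [splice, h, h']
    · refine Function.update_eq_self_iff.2 ?_
      simp [splice]
  rw [Finset.sum_congr rfl fun j _ => h2 j,
    Fin.sum_univ_eq_sum_range (fun j => S f (splice π π' (j + 1)) - S f (splice π π' j)) k,
    Finset.sum_range_sub (fun j => S f (splice π π' j)), h0, h1]

theorem lip_splice {π π' : Fin k → qLipAlg E} {L : Fin k → ℝ≥0} {s : Set E}
    (h : ∀ i, LipschitzOnWith (L i) (π i : E → ℂ) s)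
    (h' : ∀ i, LipschitzOnWith (L i) (π' i : E → ℂ) s) (m : ℕ) (i : Fin k) :
    LipschitzOnWith (L i) ((splice π π' m i : qLipAlg E) : E → ℂ) s := by
  unfold splice
  split_ifs
  exacts [h' i, h i]

variable [MeasurableSpace E] [BorelSpace E] {S : Form E k} {ρ : ℝ} {μ : Measure E}

/-- This is the product rule for `1`, `f`, `g`, rearranged. It moves `g` out of the slot at the
price of a boundary term `S (1, …)`, after which only the size of `g`, not its Lipschitz constant,
enters. -/
theorem Tame.map_update_left (hS : Tame (fun f => ⇑(S f)) ρ μ) (f : qLipAlg E)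
    (π : Fin k → qLipAlg E) (i : Fin k) (g : qLipAlg E) : S f (Function.update π i g) =
      S 1 (Function.update π i (f * g)) - S g (Function.update π i f) := by
  rw [hS.leibniz, one_mul, one_mul, add_sub_cancel_right]

/-- The supremum of `g` replaces its Lipschitz constant, thanks to the finite mass of the boundary.
-/
theorem NormalForm.norm_update_le (hS : NormalForm S ρ μ) {π : Fin k → qLipAlg E}
    {L : Fin k → ℝ≥0} (hL : ∀ i, LipschitzOnWith (L i) (π i : E → ℂ) (Metric.ball 0 ρ))
    {f g : qLipAlg E} {M Lf : ℝ≥0} {δ : ℝ} (hM : ∀ x, ‖x‖ < ρ → ‖(f : E → ℂ) x‖ ≤ M)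
    (hf : LipschitzOnWith Lf (f : E → ℂ) (Metric.ball 0 ρ))
    (hg : ∀ x, ‖x‖ < ρ → ‖(g : E → ℂ) x‖ ≤ δ) (i : Fin k) :
    ‖S f (Function.update π i g)‖ ≤
      (∏ j ∈ Finset.univ \ {i}, (L j : ℝ)) * ((M + Lf) * (δ * μ.real Set.univ)) := by
  have := hS.finite
  have hint : ∀ {h : qLipAlg E} {C : ℝ}, (∀ x, ‖x‖ < ρ → ‖(h : E → ℂ) x‖ ≤ C) →
      ∫ x, ‖(h : E → ℂ) x‖ ∂μ ≤ C * μ.real Set.univ := by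
    intro h C hC
    have : ∫ x, ‖(h : E → ℂ) x‖ ∂μ ≤ ∫ _x, C ∂μ :=
      integral_mono_ae (integrableQ hS.conc h).norm (integrable_const _) (by
        filter_upwards [hS.conc] with x hx using hC x hx)
    refine this.trans (le_of_eq ?_)
    simp [mul_comm]
  have h1 := hS.bd i (f * g) π L hL
  have h2 := hS.bound g (Function.update π i f) _ (lip_update hL hf)
  rw [prod_update_coe] at h2
  have h3 : ∫ x, ‖((f * g : qLipAlg E) : E → ℂ) x‖ ∂μ ≤ (M * δ) * μ.real Set.univ :=
    hint fun x hx => by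
      rw [Subalgebra.coe_mul, Pi.mul_apply, norm_mul]
      exact mul_le_mul (hM x hx) (hg x hx) (norm_nonneg _) M.2
  have h4 := hint hg
  have hP : 0 ≤ ∏ j ∈ Finset.univ \ {i}, (L j : ℝ) := by positivity
  rw [hS.map_update_left]
  refine (norm_sub_le _ _).trans ?_
  have h5 := mul_le_mul_of_nonneg_left h3 hP
  have h6 := mul_le_mul_of_nonneg_left h4 (mul_nonneg Lf.2 hP)
  simp only [NNReal.val_eq_coe] at h6
  nlinarith [h1, h2, h5, h6]

/-- Moving `g n` out of the slot leaves two expressions that are L¹-bounded in `g n`, one by the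
mass of `S`, the other by the mass of its boundary, so almost everywhere convergence of `g n` is
enough. -/
theorem NormalForm.tendsto_update_sub (hS : NormalForm S ρ μ) {ωs : ℕ → Fin k → qLipAlg E}
    {ω : Fin k → qLipAlg E} (hE : EquiLip ωs) (hω : TendsPt ωs ω) (f : qLipAlg E) (j : Fin k)
    {g : ℕ → qLipAlg E} {M : ℝ} (hM : ∀ n, ∀ᵐ x ∂μ, ‖(g n : E → ℂ) x‖ ≤ M)
    (hlim : ∀ᵐ x ∂μ, ∃ l, Tendsto (fun n => (g n : E → ℂ) x) atTop (𝓝 l)) :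
    Tendsto (fun n => S f (Function.update (ωs n) j (g n)) - S f (Function.update ω j (g n)))
      atTop (𝓝 0) := by
  have := hS.finite
  have h1 : Tendsto (fun n => S (g n) (Function.update (ωs n) j f) -
      S (g n) (Function.update ω j f)) atTop (𝓝 0) :=
    hS.tendsto_sub (hE.update fun R => (exists_lipQ f R).imp fun _ h _ => h)
      (hω.update fun x => tendsto_const_nhds) hM hlim
  choose L hL using fun i => hE i ρ
  choose L' hL' using fun i => exists_lipQ (ω i) ρ
  have hmax : ∀ n i, LipschitzOnWith (max (L i) (L' i)) (ωs n i : E → ℂ) (Metric.ball 0 ρ) :=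
    fun n i => (hL i n).weaken (le_max_left _ _)
  have hmax' : ∀ i, LipschitzOnWith (max (L i) (L' i)) (ω i : E → ℂ) (Metric.ball 0 ρ) :=
    fun i => (hL' i).weaken (le_max_right _ _)
  let ev : (Fin k → qLipAlg E) → qLipAlg E →ₗ[ℂ] ℂ := fun ω =>
    { toFun := fun h => S 1 (Function.update ω j h)
      map_add' := fun f g => by simp
      map_smul' := fun c f => by simp }
  obtain ⟨B, hB⟩ := exists_boundQ f ρ
  have h2 : Tendsto (fun n => ev (ωs n) (f * g n) - ev ω (f * g n)) atTop (𝓝 0) := by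
    refine tendsto_sub_of_L1_bound (fun n => ev (ωs n)) (ev ω)
      (fun n h => hS.bd j h _ _ (hmax n)) (fun h => hS.bd j h _ _ hmax') (by positivity)
      (fun h => hS.cont 1 _ _ (hE.update fun R => (exists_lipQ h R).imp fun _ h _ => h)
        (hω.update fun x => tendsto_const_nhds)) (M := B * M) (fun n => ?_) ?_
    · filter_upwards [hM n, hS.conc] with x h1 h2
      rw [Subalgebra.coe_mul, Pi.mul_apply, norm_mul]
      exact mul_le_mul (hB x h2.le) h1 (norm_nonneg _) B.2
    · filter_upwards [hlim] with x ⟨l, hl⟩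
      exact ⟨_, hl.const_mul ((f : E → ℂ) x)⟩
  have h3 := h2.sub h1
  rw [sub_zero] at h3
  refine h3.congr fun n => ?_
  rw [hS.map_update_left f (ωs n), hS.map_update_left f ω]
  simp only [ev, LinearMap.coe_mk, AddHom.coe_mk]
  ring

end Variation

/-! ### The function `ζ ↦ S (f ∘ ζ, π ∘ ζ)` and its derivative. -/

section Orbit

variable {E : Type*} [NormedAddCommGroup E] [NormedSpace ℂ E] {k : ℕ}

/-- The values of `S` along the dilations of a form. -/
noncomputable def orbit (S : Form E k) (f : qLipAlg E) (π : Fin k → qLipAlg E) (ζ : ℂ) : ℂ :=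
  S (pull ζ f) fun i => pull ζ (π i)

theorem mul_orbit_sub (S : Form E k) (f : qLipAlg E) (π : Fin k → qLipAlg E) (c ζ' ζ : ℂ) :
    c * (orbit S f π ζ' - orbit S f π ζ) = S (diffQ c ζ' ζ f) (fun i => pull ζ' (π i)) +
      ∑ j : Fin k, S (pull ζ f) (Function.update (splice (fun i => pull ζ (π i))
        (fun i => pull ζ' (π i)) j) j (diffQ c ζ' ζ (π j))) := by
  have h1 : orbit S f π ζ' - orbit S f π ζ = S (pull ζ' f - pull ζ f) (fun i => pull ζ' (π i)) +
      (S (pull ζ f) (fun i => pull ζ' (π i)) - S (pull ζ f) fun i => pull ζ (π i)) := by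
    rw [orbit, orbit, map_sub, AlternatingMap.sub_apply]; ring
  rw [h1, S.map_sub_eq_sum, mul_add, Finset.mul_sum]
  simp only [diffQ_eq, map_smul, AlternatingMap.smul_apply, AlternatingMap.map_update_smul,
    smul_eq_mul]

variable [MeasurableSpace E] [BorelSpace E] {S : Form E k} {ρ : ℝ} {μ : Measure E}

theorem NormalForm.continuous_orbit (hS : NormalForm S ρ μ) (f : qLipAlg E)
    (π : Fin k → qLipAlg E) : Continuous (orbit S f π) := by
  have h := (hS.continuous_pull f 1 π).comp (continuous_id.prodMk continuous_id)
  refine h.congr fun ζ => ?_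
  simp only [Function.comp_apply, map_one, mul_one, orbit, id]

/-- A change of `ζ` alters the slots by functions that are uniformly small, though not small in
Lipschitz norm; the bound through the supremum is therefore essential. -/
theorem NormalForm.exists_lip_orbit (hS : NormalForm S ρ μ) (f : qLipAlg E)
    (π : Fin k → qLipAlg E) {Z : ℝ≥0} (hZ : 0 < Z) : ∃ C : ℝ, 0 ≤ C ∧ ∀ ζ ζ' : ℂ, ‖ζ‖ ≤ Z → ‖ζ'‖ ≤ Z →
      ‖orbit S f π ζ' - orbit S f π ζ‖ ≤ C * ‖ζ' - ζ‖ := by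
  have := hS.finite
  choose L hL using fun i => exists_lipQ (π i) (Z * ρ)
  obtain ⟨Lf, hLf⟩ := exists_lipQ f (Z * ρ)
  obtain ⟨M, hM⟩ := exists_boundQ f (Z * ρ)
  set P : Fin k → ℝ := fun i => ∏ j ∈ Finset.univ \ {i}, ((Z * L j : ℝ≥0) : ℝ)
  refine ⟨(∏ i, ((Z * L i : ℝ≥0) : ℝ)) * (Lf * |ρ| * μ.real Set.univ) +
    ∑ j, P j * ((M + (Z * Lf : ℝ≥0)) * (L j * |ρ| * μ.real Set.univ)), by positivity,
    fun ζ ζ' hζ hζ' => ?_⟩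
  have hd : ∀ {g : qLipAlg E} {Lg : ℝ≥0}, LipschitzOnWith Lg (g : E → ℂ) (Metric.ball 0 (Z * ρ)) →
      ∀ x, ‖x‖ < ρ → ‖(diffQ 1 ζ' ζ g : E → ℂ) x‖ ≤ ‖ζ' - ζ‖ * Lg * |ρ| := by
    intro g Lg hg x hx
    refine (norm_diffQ_le hZ hg hζ' hζ (C := ‖ζ' - ζ‖) (by simp) hx).trans ?_
    gcongr
    exact le_abs_self ρ
  have h1 := mul_orbit_sub S f π 1 ζ' ζ
  rw [one_mul] at h1
  rw [h1, add_mul, Finset.sum_mul]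
  refine (norm_add_le _ _).trans (add_le_add ?_ (norm_sum_le_of_le _ fun j _ => ?_))
  · refine (hS.bound _ _ _ fun i => pull_lip hZ (hL i) hζ').trans ?_
    rw [mul_assoc]
    refine mul_le_mul_of_nonneg_left ?_ (by positivity)
    have : ∫ x, ‖(diffQ 1 ζ' ζ f : E → ℂ) x‖ ∂μ ≤ ∫ _x, ‖ζ' - ζ‖ * Lf * |ρ| ∂μ :=
      integral_mono_ae (integrableQ hS.conc _).norm (integrable_const _) (by
        filter_upwards [hS.conc] with x hx using hd hLf x hx)
    refine this.trans (le_of_eq ?_)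
    rw [integral_const, smul_eq_mul]
    ring
  · refine (hS.norm_update_le (f := pull ζ f) (M := M) (lip_splice (fun i => pull_lip hZ (hL i) hζ)
      (fun i => pull_lip hZ (hL i) hζ') j) (fun x hx => hM _ (smul_mem_ball hZ hζ hx).le)
      (pull_lip hZ hLf hζ) (hd (hL j)) j).trans (le_of_eq ?_)
    simp only [P]
    ring

/-- The product rule for the derivative of the orbit, at the level of difference quotients: in the
telescoped increment, every dilation other than the differentiated one may be frozen at `ζ`. -/
theorem NormalForm.tendsto_orbit_sub (hS : NormalForm S ρ μ) (f : qLipAlg E)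
    (π : Fin k → qLipAlg E) {Z : ℝ≥0} (hZ : 0 < Z) {ζ' : ℕ → ℂ} {ζ : ℂ}
    (h : Tendsto ζ' atTop (𝓝 ζ)) (hζ' : ∀ n, ‖ζ' n‖ ≤ Z) (hζ : ‖ζ‖ ≤ Z) {c : ℕ → ℂ} {C : ℝ}
    (hc : ∀ n, ‖c n‖ * ‖ζ' n - ζ‖ ≤ C)
    (hf : ∀ᵐ x ∂μ, ∃ l, Tendsto (fun n => (diffQ (c n) (ζ' n) ζ f : E → ℂ) x) atTop (𝓝 l))
    (hπ : ∀ j, ∀ᵐ x ∂μ, ∃ l,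
      Tendsto (fun n => (diffQ (c n) (ζ' n) ζ (π j) : E → ℂ) x) atTop (𝓝 l)) :
    Tendsto (fun n => c n * (orbit S f π (ζ' n) - orbit S f π ζ) -
      (S (diffQ (c n) (ζ' n) ζ f) (fun i => pull ζ (π i)) + ∑ j : Fin k,
        S (pull ζ f) (Function.update (fun i => pull ζ (π i)) j (diffQ (c n) (ζ' n) ζ (π j)))))
      atTop (𝓝 0) := by
  have hE := equiLip_pull π hZ hζ'
  have hT := tendsPt_pull π h
  have hb : ∀ g : qLipAlg E, ∃ B : ℝ, ∀ n, ∀ᵐ x ∂μ, ‖(diffQ (c n) (ζ' n) ζ g : E → ℂ) x‖ ≤ B := by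
    intro g
    obtain ⟨L, hL⟩ := exists_lipQ g (Z * ρ)
    refine ⟨C * L * ρ, fun n => ?_⟩
    filter_upwards [hS.conc] with x hx
    exact norm_diffQ_le hZ hL (hζ' n) hζ (hc n) hx
  obtain ⟨B, hB⟩ := hb f
  have h1 := hS.tendsto_sub hE hT hB hf
  have h2 : ∀ j : Fin k, Tendsto (fun n => S (pull ζ f) (Function.update
      (splice (fun i => pull ζ (π i)) (fun i => pull (ζ' n) (π i)) j) j
        (diffQ (c n) (ζ' n) ζ (π j))) - S (pull ζ f) (Function.update (fun i => pull ζ (π i)) j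
          (diffQ (c n) (ζ' n) ζ (π j)))) atTop (𝓝 0) := by
    intro j
    obtain ⟨B, hB⟩ := hb (π j)
    refine hS.tendsto_update_sub (fun i R => ?_) (fun i x => ?_) (pull ζ f) j hB (hπ j)
    · obtain ⟨L, hL⟩ := exists_lipQ (π i) (Z * R)
      refine ⟨Z * L, fun n => ?_⟩
      unfold splice
      split_ifs
      exacts [pull_lip hZ hL (hζ' n), pull_lip hZ hL hζ]
    · unfold splice
      split_ifs
      exacts [hT i x, tendsto_const_nhds]
  have h3 := h1.add (tendsto_finsetSum Finset.univ fun j _ => h2 j)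
  rw [Finset.sum_const_zero, add_zero] at h3
  refine h3.congr fun n => ?_
  rw [mul_orbit_sub, Finset.sum_sub_distrib]
  ring

end Orbit

/-! ### The Cauchy-Pompeiu formula for Lipschitz functions. -/

section Polar

/-- The radial difference quotient of a function on the plane. -/
noncomputable def radD (F : ℂ → ℂ) (n : ℕ) (p : ℝ × ℝ) : ℂ :=
  (n + 1) * (F (zeta (p.1 + 1 / (n + 1)) p.2) - F (zeta p.1 p.2))

/-- The angular difference quotient of a function on the plane. -/
noncomputable def angD (F : ℂ → ℂ) (n : ℕ) (p : ℝ × ℝ) : ℂ :=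
  (n + 1) * (F (zeta p.1 (p.2 + 1 / (n + 1))) - F (zeta p.1 p.2))

variable {F : ℂ → ℂ} {ϱ C : ℝ} {Z : ℝ≥0}

theorem continuous_zeta_shift (h h' : ℝ) :
    Continuous fun p : ℝ × ℝ => zeta (p.1 + h) (p.2 + h') :=
  continuous_zeta.comp (g := fun p : ℝ × ℝ => zeta p.1 p.2)
    (f := fun p : ℝ × ℝ => (p.1 + h, p.2 + h')) (by fun_prop)

theorem continuous_radD (hF : Continuous F) (n : ℕ) : Continuous (radD F n) := by
  have h1 := continuous_zeta_shift (1 / ((n : ℝ) + 1)) 0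
  simp only [add_zero] at h1
  exact continuous_const.mul ((hF.comp h1).sub (hF.comp continuous_zeta))

theorem continuous_angD (hF : Continuous F) (n : ℕ) : Continuous (angD F n) := by
  have h1 := continuous_zeta_shift 0 (1 / ((n : ℝ) + 1))
  simp only [add_zero] at h1
  exact continuous_const.mul ((hF.comp h1).sub (hF.comp continuous_zeta))

theorem norm_radD_le (hC : 0 ≤ C) (hZ : ϱ + 2 ≤ Z)
    (hl : ∀ ζ ζ' : ℂ, ‖ζ‖ ≤ Z → ‖ζ'‖ ≤ Z → ‖F ζ' - F ζ‖ ≤ C * ‖ζ' - ζ‖) (n : ℕ) {p : ℝ × ℝ}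
    (hp : 0 < p.1) (hp' : p.1 ≤ ϱ) : ‖radD F n p‖ ≤ C := by
  have hn : (0 : ℝ) < 1 / (n + 1) := by positivity
  rw [radD, norm_mul]
  calc _ ≤ ‖((n : ℂ) + 1)‖ * (C * ‖zeta (p.1 + 1 / (n + 1)) p.2 - zeta p.1 p.2‖) := by
        gcongr
        exact hl _ _ (norm_zeta_le_of_le hZ hp (by linarith) _) (norm_zeta_le_of_le hZ
          (by linarith) (by linarith [one_div_succ_le n]) _)
    _ = C * (‖((n : ℂ) + 1)‖ * ‖zeta (p.1 + 1 / (n + 1)) p.2 - zeta p.1 p.2‖) := by ring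
    _ ≤ C * 1 := by gcongr; exact norm_succ_mul_radial n p.1 p.2
    _ = C := mul_one C

theorem norm_angD_le (hC : 0 ≤ C) (hZ : ϱ + 2 ≤ Z)
    (hl : ∀ ζ ζ' : ℂ, ‖ζ‖ ≤ Z → ‖ζ'‖ ≤ Z → ‖F ζ' - F ζ‖ ≤ C * ‖ζ' - ζ‖) (n : ℕ) {p : ℝ × ℝ}
    (hp : 0 < p.1) (hp' : p.1 ≤ ϱ) : ‖Complex.I / p.1 * angD F n p‖ ≤ C := by
  rw [norm_mul, norm_div, Complex.norm_I, Complex.norm_real, Real.norm_of_nonneg hp.le, angD,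
    norm_mul]
  calc _ ≤ 1 / p.1 * (‖((n : ℂ) + 1)‖ *
        (C * ‖zeta p.1 (p.2 + 1 / (n + 1)) - zeta p.1 p.2‖)) := by
        gcongr
        exact hl _ _ (norm_zeta_le_of_le hZ hp (by linarith) _) (norm_zeta_le_of_le hZ
          hp (by linarith) _)
    _ = 1 / p.1 * C * (‖((n : ℂ) + 1)‖ * ‖zeta p.1 (p.2 + 1 / (n + 1)) - zeta p.1 p.2‖) := by ring
    _ ≤ 1 / p.1 * C * p.1 := by gcongr; exact norm_succ_mul_angular n hp p.2
    _ = C := by field_simp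

theorem zeta_zero (θ : ℝ) : zeta 0 θ = 1 := by simp [zeta]

theorem zeta_add_two_pi (r θ : ℝ) : zeta r (θ + 2 * Real.pi) = zeta r θ := by
  have : ((θ + 2 * Real.pi : ℝ) : ℂ) * Complex.I = θ * Complex.I + 2 * Real.pi * Complex.I := by
    push_cast; ring
  rw [zeta, this, Complex.exp_add, Complex.exp_two_pi_mul_I, mul_one, zeta]

/-- The integral of a difference quotient telescopes to averages over intervals of length `1 / (n +
1)` at the two ends. The outer one vanishes; the inner one is within `C / (n + 1)` of `F 1`, as
`zeta 0 θ = 1`. -/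
theorem integral_radD_section (hF : Continuous F) (hϱ : 0 < ϱ) (hZ : ϱ + 2 ≤ Z) (hC : 0 ≤ C)
    (hl : ∀ ζ ζ' : ℂ, ‖ζ‖ ≤ Z → ‖ζ'‖ ≤ Z → ‖F ζ' - F ζ‖ ≤ C * ‖ζ' - ζ‖)
    (h0 : ∀ r θ : ℝ, ϱ ≤ r → F (zeta r θ) = 0) (n : ℕ) (θ : ℝ) :
    ‖(∫ r in Set.Ioc 0 ϱ, radD F n (r, θ)) + F 1‖ ≤ C * (1 / (n + 1)) := by
  have hn : (0 : ℝ) < 1 / (n + 1) := by positivity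
  set h : ℝ := 1 / (n + 1) with hh
  set G : ℝ → ℂ := fun r => F (zeta r θ) with hG
  have hGc : Continuous G := hF.comp (continuous_zeta.comp (g := fun p : ℝ × ℝ => zeta p.1 p.2)
    (f := fun r : ℝ => (r, θ)) (by fun_prop))
  have hGi : ∀ a b, IntervalIntegrable G volume a b := fun a b => hGc.intervalIntegrable a b
  have hGh : ∀ a b, IntervalIntegrable (fun r => G (r + h)) volume a b := fun a b =>
    (hGc.comp (continuous_add_const h)).intervalIntegrable a b
  have e1 : ∫ r in Set.Ioc 0 ϱ, radD F n (r, θ) = -((n + 1) * ∫ r in (0 : ℝ)..h, G r) := by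
    rw [← intervalIntegral.integral_of_le hϱ.le]
    have : ∀ r, radD F n (r, θ) = (n + 1) * (G (r + h) - G r) := fun r => rfl
    simp only [this]
    rw [intervalIntegral.integral_const_mul, intervalIntegral.integral_sub
      (hGh _ _) (hGi _ _),
      intervalIntegral.integral_comp_add_right (fun r => G r) h,
      intervalIntegral.integral_interval_sub_interval_comm (hGi _ _) (hGi _ _) (hGi _ _)]
    have e2 : ∫ r in (ϱ + h)..ϱ, G r = 0 := by
      rw [intervalIntegral.integral_symm, neg_eq_zero]
      refine intervalIntegral.integral_zero_ae (ae_of_all _ fun r hr => ?_)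
      rw [Set.uIoc_of_le (by linarith)] at hr
      exact h0 r θ hr.1.le
    rw [e2, sub_zero, intervalIntegral.integral_symm, zero_add]
    ring
  have e3 : F 1 = (n + 1) * ∫ _r in (0 : ℝ)..h, F 1 := by
    rw [intervalIntegral.integral_const, sub_zero, Complex.real_smul, hh]
    have : ((n : ℂ) + 1) ≠ 0 := Nat.cast_add_one_ne_zero n
    push_cast
    field_simp
  have e4 : (∫ r in Set.Ioc 0 ϱ, radD F n (r, θ)) + F 1 =
      (n + 1) * ∫ r in (0 : ℝ)..h, (F 1 - G r) := by
    rw [e1, intervalIntegral.integral_sub intervalIntegrable_const (hGi _ _), mul_sub, ← e3]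
    ring
  rw [e4, norm_mul, norm_natCast_succ]
  have e5 : ‖∫ r in (0 : ℝ)..h, (F 1 - G r)‖ ≤ C * h * |h - 0| := by
    refine intervalIntegral.norm_integral_le_of_norm_le_const fun r hr => ?_
    rw [Set.uIoc_of_le hn.le] at hr
    have hh1 : h ≤ 1 := one_div_succ_le n
    have := hl (zeta r θ) (zeta 0 θ) (norm_zeta_le_of_le hZ hr.1 (by linarith [hr.2]) _) (by
      rw [zeta_zero, norm_one]; linarith)
    rw [norm_zeta_sub_radial, zeta_zero] at this
    refine this.trans ?_
    gcongr
    rw [zero_sub, abs_neg, abs_of_pos hr.1]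
    exact hr.2
  rw [sub_zero, abs_of_pos hn] at e5
  calc _ ≤ ((n : ℝ) + 1) * (C * h * h) := by gcongr
    _ = C * h := by rw [hh]; field_simp

/-- A shift does not change the integral of a periodic function over a period. -/
theorem integral_angD_section (hF : Continuous F) (n : ℕ) (r : ℝ) :
    ∫ θ in Set.Ioc 0 (2 * Real.pi), angD F n (r, θ) = 0 := by
  set h : ℝ := 1 / (n + 1) with hh
  set G : ℝ → ℂ := fun θ => F (zeta r θ) with hG
  have hGc : Continuous G := hF.comp (continuous_zeta.comp (g := fun p : ℝ × ℝ => zeta p.1 p.2)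
    (f := fun θ : ℝ => (r, θ)) (by fun_prop))
  have hGh : ∀ a b, IntervalIntegrable (fun r => G (r + h)) volume a b := fun a b =>
    (hGc.comp (continuous_add_const h)).intervalIntegrable a b
  have hGp : Function.Periodic G (2 * Real.pi) := fun θ => by rw [hG]; simp only [zeta_add_two_pi]
  rw [← intervalIntegral.integral_of_le (by positivity)]
  have : ∀ θ, angD F n (r, θ) = (n + 1) * (G (θ + h) - G θ) := fun θ => rfl
  simp only [this]
  rw [intervalIntegral.integral_const_mul, intervalIntegral.integral_sub
    (hGh _ _) (hGc.intervalIntegrable _ _),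
    intervalIntegral.integral_comp_add_right (fun r => G r) h, zero_add, add_comm (2 * Real.pi) h,
    hGp.intervalIntegral_add_eq h 0, zero_add, sub_self, mul_zero]

/-- The angular part integrates to exactly 0 over each circle, and the radial part tends to `-F 1`
along each ray. Difference quotients avoid any appeal to the fundamental theorem for merely
Lipschitz functions. -/
theorem tendsto_integral_polar (hF : Continuous F) (hϱ : 0 < ϱ) (hZ : ϱ + 2 ≤ Z) (hC : 0 ≤ C)
    (hl : ∀ ζ ζ' : ℂ, ‖ζ‖ ≤ Z → ‖ζ'‖ ≤ Z → ‖F ζ' - F ζ‖ ≤ C * ‖ζ' - ζ‖)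
    (h0 : ∀ r θ : ℝ, ϱ ≤ r → F (zeta r θ) = 0) :
    Tendsto (fun n => ∫ p, (radD F n p + Complex.I / p.1 * angD F n p) ∂parMeasure ϱ) atTop
      (𝓝 (-(2 * Real.pi * F 1))) := by
  have i1 : ∀ n, Integrable (radD F n) (parMeasure ϱ) := fun n =>
    Integrable.of_bound (continuous_radD hF n).aestronglyMeasurable C (by
      filter_upwards [ae_parMeasure ϱ] with p hp using norm_radD_le hC hZ hl n hp.1 hp.2)
  have i2 : ∀ n, Integrable (fun p : ℝ × ℝ => Complex.I / p.1 * angD F n p) (parMeasure ϱ) :=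
    fun n => Integrable.of_bound ((measurable_const.div (Complex.measurable_ofReal.comp
      measurable_fst)).mul (continuous_angD hF n).measurable).aestronglyMeasurable C (by
      filter_upwards [ae_parMeasure ϱ] with p hp using norm_angD_le hC hZ hl n hp.1 hp.2)
  have e2 : ∀ n, ∫ p, Complex.I / p.1 * angD F n p ∂parMeasure ϱ = 0 := by
    intro n
    have := i2 n
    unfold parMeasure at this ⊢
    rw [integral_prod _ this]
    simp only [integral_const_mul, integral_angD_section hF, mul_zero, integral_zero]
  simp only [integral_add (i1 _) (i2 _), e2, add_zero]
  rw [tendsto_iff_norm_sub_tendsto_zero]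
  have hlim : Tendsto (fun n : ℕ => C * (1 / ((n : ℝ) + 1)) * (2 * Real.pi)) atTop (𝓝 0) := by
    simpa using (tendsto_one_div_add_atTop_nhds_zero_nat.const_mul C).mul_const (2 * Real.pi)
  refine squeeze_zero (fun n => norm_nonneg _) (fun n => ?_) hlim
  have e3 : ∫ p, radD F n p ∂parMeasure ϱ - -(2 * Real.pi * F 1) =
      ∫ θ in Set.Ioc 0 (2 * Real.pi), ((∫ r in Set.Ioc 0 ϱ, radD F n (r, θ)) + F 1) := by
    have hi := i1 n
    unfold parMeasure at hi ⊢
    rw [integral_add hi.integral_prod_right (integrable_const _), integral_prod_symm _ hi,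
      setIntegral_const, sub_neg_eq_add]
    congr 1
    rw [Real.volume_real_Ioc_of_le (by positivity), sub_zero, Complex.real_smul]
    push_cast
    rfl
  rw [e3]
  have := norm_setIntegral_le_of_norm_le_const (μ := (volume : Measure ℝ))
    (s := Set.Ioc 0 (2 * Real.pi)) measure_Ioc_lt_top fun θ _ =>
    integral_radD_section hF hϱ hZ hC hl h0 n θ
  rwa [Real.volume_real_Ioc_of_le (by positivity), sub_zero] at this

end Polar

/-! ### The homotopy formula `dC(S) = S - C(dS)`. -/

section Homotopy

variable {E : Type*} [NormedAddCommGroup E] [NormedSpace ℂ E] [MeasurableSpace E] [BorelSpace E]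
  {k : ℕ} {S : Form E k} {ρ : ℝ} {μ : Measure E}

/-- The integrand of the cone over the boundary. -/
noncomputable def bkern (S : Form E k) (n : ℕ) (p : ℝ × ℝ) (f : qLipAlg E)
    (π : Fin k → qLipAlg E) : ℂ :=
  ∑ j : Fin k, S 1 (Function.update (fun i => pull (zeta p.1 p.2) (π i)) j
    (pull (zeta p.1 p.2) f * dbarQ n p (π j)))

omit [MeasurableSpace E] [BorelSpace E] in
theorem bkern_eq_kern {S : Form E (k + 1)} {B : Form E k}
    (hB : ∀ f π, B f π = S 1 (Fin.cons (α := fun _ => qLipAlg E) f π)) (n : ℕ) (p : ℝ × ℝ)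
    (f : qLipAlg E) (π : Fin (k + 1) → qLipAlg E) : bkern S n p f π = kern B n p f π := by
  rw [bkern, kern_apply]
  refine Finset.sum_congr rfl fun j _ => ?_
  rw [S.map_update_eq, kernTerm, hB]
  rfl

omit [MeasurableSpace E] [BorelSpace E] in
theorem kern_cons (S : Form E k) (n : ℕ) (p : ℝ × ℝ) (f : qLipAlg E) (π : Fin k → qLipAlg E) :
    kern S n p 1 (Fin.cons (α := fun _ => qLipAlg E) f π) =
      S (dbarQ n p f) (fun i => pull (zeta p.1 p.2) (π i)) -
        ∑ j, S (dbarQ n p (π j)) (Function.update (fun i => pull (zeta p.1 p.2) (π i)) j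
          (pull (zeta p.1 p.2) f)) := by
  rw [kern_apply, Fin.sum_univ_succ, sub_eq_add_neg, ← Finset.sum_neg_distrib]
  congr 1
  · rw [kernTerm, map_one, one_mul, Fin.val_zero, pow_zero, one_mul]
    rfl
  · refine Finset.sum_congr rfl fun j _ => ?_
    cases k with
    | zero => exact j.elim0
    | succ k =>
      rw [S.map_update_eq, kernTerm, map_one, one_mul, Fin.cons_succ, Fin.val_succ, pow_succ]
      have : (fun i => pull (zeta p.1 p.2) ((Fin.cons (α := fun _ => qLipAlg E) f π :
          Fin (k + 2) → qLipAlg E) (j.succ.succAbove i))) =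
          (Fin.cons (α := fun _ => qLipAlg E) (pull (zeta p.1 p.2) f)
            (j.removeNth fun i => pull (zeta p.1 p.2) (π i)) : Fin (k + 1) → qLipAlg E) := by
        ext i : 1
        refine Fin.cases ?_ (fun i => ?_) i
        · rw [Fin.succ_succAbove_zero, Fin.cons_zero, Fin.cons_zero]
        · rw [Fin.succ_succAbove_succ, Fin.cons_succ, Fin.cons_succ]
          rfl
      rw [this]
      ring

/-- The homotopy formula under the integral sign: in each slot `j` the product rule merges `S (1, …,
f Dπ_j, …)` and `S (Dπ_j, …, f, …)` into `S (f, …, Dπ_j, …)`. The result is the formal derivative of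
the orbit. -/
theorem Tame.kern_cons_add_bkern (hS : Tame (fun f => ⇑(S f)) ρ μ) (n : ℕ) (p : ℝ × ℝ)
    (f : qLipAlg E) (π : Fin k → qLipAlg E) :
    kern S n p 1 (Fin.cons (α := fun _ => qLipAlg E) f π) + bkern S n p f π =
      S (dbarQ n p f) (fun i => pull (zeta p.1 p.2) (π i)) +
        ∑ j, S (pull (zeta p.1 p.2) f) (Function.update (fun i => pull (zeta p.1 p.2) (π i)) j
          (dbarQ n p (π j))) := by
  rw [kern_cons, bkern, sub_add_eq_add_sub, add_sub_assoc, ← Finset.sum_sub_distrib]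
  congr 1
  exact Finset.sum_congr rfl fun j _ => (hS.map_update_left _ _ _ _).symm

theorem NormalForm.ae_tendsto_kern_sub (hS : NormalForm S ρ μ) (ϱ : ℝ) (f : qLipAlg E)
    (π : Fin k → qLipAlg E) : ∀ᵐ p ∂parMeasure ϱ, Tendsto (fun n =>
      (radD (orbit S f π) n p + Complex.I / p.1 * angD (orbit S f π) n p) -
      (kern S n p 1 (Fin.cons (α := fun _ => qLipAlg E) f π) + bkern S n p f π)) atTop (𝓝 0) := by
  have := hS.finite
  set Z : ℝ≥0 := (max (ϱ + 2) 1).toNNReal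
  have hZ : ϱ + 2 ≤ Z := (le_max_left _ _).trans (Real.le_coe_toNNReal _)
  have hZ0 : 0 < Z := Real.toNNReal_pos.2 (by positivity)
  have h1 : ∀ᵐ p ∂parMeasure ϱ, ∀ i, ∀ᵐ x ∂μ,
      ∃ l, Tendsto (fun n => (radQ n p (π i) : E → ℂ) x) atTop (𝓝 l) :=
    ae_all_iff.2 fun i => ae_exists_tendsto_radQ μ ϱ (π i)
  have h2 : ∀ᵐ p ∂parMeasure ϱ, ∀ i, ∀ᵐ x ∂μ,
      ∃ l, Tendsto (fun n => (angQ n p (π i) : E → ℂ) x) atTop (𝓝 l) :=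
    ae_all_iff.2 fun i => ae_exists_tendsto_angQ μ ϱ (π i)
  filter_upwards [h1, h2, ae_exists_tendsto_radQ μ ϱ f, ae_exists_tendsto_angQ μ ϱ f,
    ae_parMeasure ϱ] with p hr ha hrf haf hp
  have hζ : ‖zeta p.1 p.2‖ ≤ Z := norm_zeta_le_of_le hZ hp.1 (by linarith [hp.2]) _
  have t1 := hS.tendsto_orbit_sub f π hZ0 (tendsto_zeta_radial p.1 p.2) (fun n => by
    have hn : (0 : ℝ) < 1 / (n + 1) := by positivity
    exact norm_zeta_le_of_le hZ (by linarith [hp.1]) (by linarith [hp.2, one_div_succ_le n]) _) hζ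
    (c := fun n => (n : ℂ) + 1) (fun n => norm_succ_mul_radial n p.1 p.2) hrf hr
  have t2 := (hS.tendsto_orbit_sub f π hZ0 (tendsto_zeta_angular p.1 p.2) (fun n =>
    norm_zeta_le_of_le hZ hp.1 (by linarith [hp.2]) _) hζ
    (c := fun n => (n : ℂ) + 1) (fun n => norm_succ_mul_angular n hp.1 p.2) haf ha).const_mul
      (Complex.I / p.1)
  have t3 := t1.add t2
  rw [mul_zero, add_zero] at t3
  refine t3.congr fun n => ?_
  rw [hS.toTame.kern_cons_add_bkern]
  have e1 : ∀ g : qLipAlg E, dbarQ n p g = diffQ ((n : ℂ) + 1) (zeta (p.1 + 1 / (n + 1)) p.2)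
      (zeta p.1 p.2) g + (Complex.I / p.1 : ℂ) • diffQ ((n : ℂ) + 1)
        (zeta p.1 (p.2 + 1 / (n + 1))) (zeta p.1 p.2) g := fun g => rfl
  simp only [e1, map_add, map_smul, AlternatingMap.add_apply, AlternatingMap.smul_apply,
    AlternatingMap.map_update_add, AlternatingMap.map_update_smul, smul_eq_mul,
    Finset.sum_add_distrib, ← Finset.mul_sum, radD, angD]
  ring

omit [BorelSpace E] in
theorem NormalForm.orbit_eq_zero (hS : NormalForm S ρ μ) (f : qLipAlg E) (π : Fin k → qLipAlg E)
    {ζ : ℂ} (h : ∀ᵐ x ∂μ, (f : E → ℂ) (ζ • x) = 0) : orbit S f π ζ = 0 := by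
  choose L hL using fun i => exists_lipQ (pull ζ (π i)) ρ
  have h1 := hS.bound (pull ζ f) _ L hL
  rw [integral_eq_zero_of_ae (by filter_upwards [h] with x hx; simp [hx]), mul_zero] at h1
  exact norm_le_zero_iff.1 h1

/-- The integrand may be exchanged for the polar derivative of the orbit by dominated convergence,
and the Cauchy formula evaluates the latter at `ζ = 1`. The boundary enters through `bkern`, an
empty sum for `k = 0`, so that all dimensions are treated at once. -/
theorem NormalForm.tendsto_integral_kern_add_bkern (hS : NormalForm S ρ μ) {ϱ : ℝ} (hϱ : 0 < ϱ)
    (f : qLipAlg E) (π : Fin k → qLipAlg E)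
    (h0 : ∀ p : ℝ × ℝ, ϱ ≤ p.1 → ∀ᵐ x ∂μ, (f : E → ℂ) (zeta p.1 p.2 • x) = 0)
    (hm : ∀ n, Measurable fun p => bkern S n p f π)
    (hb : ∃ C, ∀ n, ∀ᵐ p ∂parMeasure ϱ, ‖bkern S n p f π‖ ≤ C) :
    Tendsto (fun n => coneSeq S ϱ n 1 (Fin.cons (α := fun _ => qLipAlg E) f π) +
      -(1 / (2 * Real.pi) : ℂ) * ∫ p, bkern S n p f π ∂parMeasure ϱ) atTop (𝓝 (S f π)) := by
  set Z : ℝ≥0 := (ϱ + 2).toNNReal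
  have hZ : ϱ + 2 ≤ Z := Real.le_coe_toNNReal _
  have hZ0 : 0 < Z := Real.toNNReal_pos.2 (by positivity)
  obtain ⟨C, hC, hl⟩ := hS.exists_lip_orbit f π hZ0
  obtain ⟨B, hB⟩ := hb
  obtain ⟨D, hD⟩ := hS.exists_kern_bound ϱ 1 (Fin.cons (α := fun _ => qLipAlg E) f π)
  have hF := hS.continuous_orbit f π
  set F := orbit S f π with hFd
  set g : ℕ → ℝ × ℝ → ℂ := fun n p => radD F n p + Complex.I / p.1 * angD F n p
  set h : ℕ → ℝ × ℝ → ℂ := fun n p =>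
    kern S n p 1 (Fin.cons (α := fun _ => qLipAlg E) f π) + bkern S n p f π
  have mg : ∀ n, Measurable (g n) := fun n => (continuous_radD hF n).measurable.add
    ((measurable_const.div (Complex.measurable_ofReal.comp measurable_fst)).mul
      (continuous_angD hF n).measurable)
  have mh : ∀ n, Measurable (h n) := fun n => (hS.measurable_kern n _ _).add (hm n)
  have bg : ∀ n, ∀ᵐ p ∂parMeasure ϱ, ‖g n p‖ ≤ C + C := fun n => by
    filter_upwards [ae_parMeasure ϱ] with p hp
    exact (norm_add_le _ _).trans (add_le_add (norm_radD_le hC hZ hl n hp.1 hp.2)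
      (norm_angD_le hC hZ hl n hp.1 hp.2))
  have bh : ∀ n, ∀ᵐ p ∂parMeasure ϱ, ‖h n p‖ ≤ D + B := fun n => by
    filter_upwards [hB n, hD n] with p h1 h2
    exact (norm_add_le _ _).trans (add_le_add h2 h1)
  have ib : ∀ n, Integrable (fun p => bkern S n p f π) (parMeasure ϱ) := fun n =>
    Integrable.of_bound (hm n).aestronglyMeasurable B (hB n)
  have ig : ∀ n, Integrable (g n) (parMeasure ϱ) := fun n =>
    Integrable.of_bound (mg n).aestronglyMeasurable _ (bg n)
  have ih : ∀ n, Integrable (h n) (parMeasure ϱ) := fun n =>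
    Integrable.of_bound (mh n).aestronglyMeasurable _ (bh n)
  have t1 := tendsto_integral_of_dominated_convergence (μ := parMeasure ϱ)
    (F := fun n p => g n p - h n p) (f := fun _ => 0) (fun _ => C + C + (D + B))
    (fun n => ((mg n).sub (mh n)).aestronglyMeasurable) (integrable_const _) (fun n => by
      filter_upwards [bg n, bh n] with p h1 h2
      exact (norm_sub_le _ _).trans (add_le_add h1 h2)) (hS.ae_tendsto_kern_sub ϱ f π)
  have t2 := tendsto_integral_polar hF hϱ hZ hC hl fun r θ hr =>
    hS.orbit_eq_zero f π (h0 (r, θ) hr)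
  have t3 := ((t2.sub t1).const_mul (-(1 / (2 * Real.pi) : ℂ)))
  have hpi : (Real.pi : ℂ) ≠ 0 := by exact_mod_cast Real.pi_ne_zero
  have e : -(1 / (2 * Real.pi) : ℂ) * (-(2 * Real.pi * F 1) - ∫ _p : ℝ × ℝ, (0 : ℂ) ∂parMeasure ϱ) =
      S f π := by
    have e1 : F 1 = S f π := by
      have h1 : ∀ g : qLipAlg E, pull 1 g = g := fun g => Subtype.ext (by ext x; simp)
      rw [hFd, orbit]; simp only [h1]
    rw [integral_zero, sub_zero, e1]
    field_simp
  rw [e] at t3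
  refine t3.congr fun n => ?_
  rw [integral_sub (ig n) (ih n)]
  change _ * (∫ p, g n p ∂parMeasure ϱ - _) = _
  rw [sub_sub_cancel, coneSeq, ← mul_add, ← integral_add (hS.integrable_kern ϱ n _ _) (ib n)]

theorem NormalForm.cone_cons_zero {S : Form E 0} (hS : NormalForm S ρ μ) {ϱ : ℝ} (hϱ : 0 < ϱ)
    (f : qLipAlg E) (π : Fin 0 → qLipAlg E)
    (h0 : ∀ p : ℝ × ℝ, ϱ ≤ p.1 → ∀ᵐ x ∂μ, (f : E → ℂ) (zeta p.1 p.2 • x) = 0) :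
    hS.cone ϱ 1 (Fin.cons (α := fun _ => qLipAlg E) f π) = S f π := by
  have hb : ∀ n p, bkern S n p f π = 0 := fun n p => by simp [bkern]
  have h := hS.tendsto_integral_kern_add_bkern hϱ f π h0 (fun n => by simp only [hb]; fun_prop)
    ⟨0, fun n => ae_of_all _ fun p => by rw [hb, norm_zero]⟩
  simp only [hb, integral_zero, mul_zero, add_zero] at h
  exact tendsto_nhds_unique (hS.tendsto_cone ϱ _ _) h

theorem NormalForm.cone_cons {S : Form E (k + 1)} (hS : NormalForm S ρ μ) {B : Form E k}
    {ν : Measure E} (hB : NormalForm B ρ ν)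
    (hBS : ∀ f π, B f π = S 1 (Fin.cons (α := fun _ => qLipAlg E) f π)) {ϱ : ℝ} (hϱ : 0 < ϱ)
    (f : qLipAlg E) (π : Fin (k + 1) → qLipAlg E)
    (h0 : ∀ p : ℝ × ℝ, ϱ ≤ p.1 → ∀ᵐ x ∂μ, (f : E → ℂ) (zeta p.1 p.2 • x) = 0) :
    hS.cone ϱ 1 (Fin.cons (α := fun _ => qLipAlg E) f π) + hB.cone ϱ f π = S f π := by
  have hb : ∀ n p, bkern S n p f π = kern B n p f π := fun n p => bkern_eq_kern hBS n p f π
  have h := hS.tendsto_integral_kern_add_bkern hϱ f π h0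
    (fun n => by simp only [hb]; exact hB.measurable_kern n f π)
    (by simp only [hb]; exact hB.exists_kern_bound ϱ f π)
  simp only [hb] at h
  exact tendsto_nhds_unique ((hS.tendsto_cone ϱ _ _).add (hB.tendsto_cone ϱ _ _)) h

end Homotopy

/-! ### Quasi-local currents assembled from forms on balls. -/

section QuasiLocal

variable {E : Type*} [NormedAddCommGroup E] {k : ℕ}

/-- `f` vanishes off the open ball of radius `R`. -/
def VanishOff (R : ℝ) (f : E → ℂ) : Prop := ∀ x, R ≤ ‖x‖ → f x = 0

theorem vanishOff_of_tsupport_subset {R : ℝ} {f : E → ℂ} (h : tsupport f ⊆ Metric.ball 0 R) :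
    VanishOff R f := fun x hx => image_eq_zero_of_notMem_tsupport fun hf => by
  have := mem_ball_zero_iff.1 (h hf)
  linarith

/-- Sequential continuity for functions supported in a ball. -/
def QCont (G : qLipAlg E → (Fin k → qLipAlg E) → ℂ) (R : ℝ) : Prop :=
  ∀ (fs : ℕ → qLipAlg E) (f : qLipAlg E) (πs : ℕ → Fin k → qLipAlg E) (π : Fin k → qLipAlg E),
    (∀ n, VanishOff R (fs n : E → ℂ)) → VanishOff R (f : E → ℂ) →
    (∀ r : ℝ, ∃ C : ℝ≥0, ∀ n, LipschitzOnWith C (fs n : E → ℂ) (Metric.ball 0 r)) →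
    (∀ x, Tendsto (fun n => (fs n : E → ℂ) x) atTop (𝓝 ((f : E → ℂ) x))) →
    EquiLip πs → TendsPt πs π → Tendsto (fun n => G (fs n) (πs n)) atTop (𝓝 (G f π))

theorem exists_uniform_bound {gs : ℕ → qLipAlg E} {g : qLipAlg E}
    (hL : ∀ r : ℝ, ∃ C : ℝ≥0, ∀ n, LipschitzOnWith C (gs n : E → ℂ) (Metric.ball 0 r))
    (hg : ∀ x, Tendsto (fun n => (gs n : E → ℂ) x) atTop (𝓝 ((g : E → ℂ) x))) (r : ℝ) :
    ∃ M : ℝ, ∀ n x, ‖x‖ < r → ‖(gs n : E → ℂ) x‖ ≤ M := by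
  obtain ⟨C, hC⟩ := hL r
  obtain ⟨B, hB⟩ := (hg 0).norm.bddAbove_range
  refine ⟨B + C * r, fun n x hx => ?_⟩
  have h1 := (hC n).dist_le_mul x (mem_ball_zero_iff.2 hx) 0
    (by simpa using (norm_nonneg x).trans_lt hx)
  rw [dist_zero_right, dist_eq_norm] at h1
  have h2 : ‖(gs n : E → ℂ) x‖ ≤ ‖(gs n : E → ℂ) 0‖ + ‖(gs n : E → ℂ) x - (gs n : E → ℂ) 0‖ := by
    simpa using norm_add_le ((gs n : E → ℂ) 0) ((gs n : E → ℂ) x - (gs n : E → ℂ) 0)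
  have h3 : ‖(gs n : E → ℂ) 0‖ ≤ B := hB ⟨n, rfl⟩
  have h4 : (C : ℝ) * ‖x‖ ≤ C * r := by gcongr
  linarith

variable [MeasurableSpace E] [BorelSpace E] {ρ : ℝ} {μ ν : Measure E}

theorem tendsto_integral_norm_zero [IsFiniteMeasure μ] (hμ : ∀ᵐ x ∂μ, ‖x‖ < ρ) {g : ℕ → qLipAlg E}
    {M : ℝ} (hM : ∀ n x, ‖x‖ < ρ → ‖(g n : E → ℂ) x‖ ≤ M)
    (hg : ∀ x, Tendsto (fun n => (g n : E → ℂ) x) atTop (𝓝 0)) :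
    Tendsto (fun n => ∫ x, ‖(g n : E → ℂ) x‖ ∂μ) atTop (𝓝 0) := by
  have := tendsto_integral_of_dominated_convergence (μ := μ)
    (F := fun n x => ‖(g n : E → ℂ) x‖) (f := fun _ => (0 : ℝ)) (fun _ => M)
    (fun n => (continuousQ (g n)).norm.measurable.aestronglyMeasurable) (integrable_const _)
    (fun n => by filter_upwards [hμ] with x hx; rw [norm_norm]; exact hM n x hx)
    (ae_of_all _ fun x => by simpa using (hg x).norm)
  rwa [integral_zero] at this

omit [BorelSpace E] in
theorem Tame.congr_of_local {Φ : Form E k} (h : Tame (fun f => ⇑(Φ f)) ρ μ) (f : qLipAlg E)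
    {π π' : Fin k → qLipAlg E} {W : Set E} (hW : IsOpen W) (hfW : tsupport (f : E → ℂ) ⊆ W)
    (hπ : ∀ i, ∀ x ∈ W, (π i : E → ℂ) x = (π' i : E → ℂ) x) : Φ f π = Φ f π' := by
  refine (sub_eq_zero.1 ?_).symm
  rw [Φ.map_sub_eq_sum]
  refine Finset.sum_eq_zero fun j _ => h.loc f _ j 0 W hW hfW fun x hx => ?_
  rw [Function.update_self, Subalgebra.coe_sub, Pi.sub_apply, hπ j x hx, sub_self]

/-- The hypothesis `hbd` is a mass bound for the boundary of `U`, tested on functions supported in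
the ball. It allows each increment `πs n j - π j` to be moved out of its slot; what remains tends to
0 by dominated convergence. -/
theorem qCont_of_bound {U : Form E (k + 1)} (hU : Tame (fun f => ⇑(U f)) ρ ν) [IsFiniteMeasure μ]
    (hμ : ∀ᵐ x ∂μ, ‖x‖ < ρ) {R : ℝ}
    (hbd : ∀ (f : qLipAlg E) (π : Fin k → qLipAlg E) (L : Fin k → ℝ≥0), VanishOff R (f : E → ℂ) →
      (∀ i, LipschitzOnWith (L i) (π i : E → ℂ) (Metric.ball 0 ρ)) →
      ‖U 1 (Fin.cons (α := fun _ => qLipAlg E) f π)‖ ≤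
        (∏ i, (L i : ℝ)) * ∫ x, ‖(f : E → ℂ) x‖ ∂μ) :
    QCont (fun f => ⇑(U f)) R := by
  intro fs f πs π hfs hf hfL hft hE hT
  have := hU.finite
  choose L₁ hL₁ using fun i => hE i ρ
  choose L₂ hL₂ using fun i => exists_lipQ (π i) ρ
  obtain ⟨Lf, hLf⟩ := exists_lipQ f ρ
  obtain ⟨Mf, hMf⟩ := exists_boundQ f ρ
  set L : Fin (k + 1) → ℝ≥0 := fun i => max (L₁ i) (L₂ i)
  have hs : ∀ n i, LipschitzOnWith (L i) (πs n i : E → ℂ) (Metric.ball 0 ρ) :=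
    fun n i => (hL₁ i n).weaken (le_max_left _ _)
  have h0 : ∀ i, LipschitzOnWith (L i) (π i : E → ℂ) (Metric.ball 0 ρ) :=
    fun i => (hL₂ i).weaken (le_max_right _ _)
  have hsub : ∀ {gs : ℕ → qLipAlg E} {g : qLipAlg E},
      (∀ r : ℝ, ∃ C : ℝ≥0, ∀ n, LipschitzOnWith C (gs n : E → ℂ) (Metric.ball 0 r)) →
      (∀ x, Tendsto (fun n => (gs n : E → ℂ) x) atTop (𝓝 ((g : E → ℂ) x))) →
      (∃ M : ℝ, ∀ n x, ‖x‖ < ρ → ‖((gs n - g : qLipAlg E) : E → ℂ) x‖ ≤ M) ∧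
      ∀ x, Tendsto (fun n => ((gs n - g : qLipAlg E) : E → ℂ) x) atTop (𝓝 0) := by
    intro gs g h1 h2
    obtain ⟨M, hM⟩ := exists_uniform_bound h1 h2 ρ
    obtain ⟨N, hN⟩ := exists_boundQ g ρ
    refine ⟨⟨M + N, fun n x hx => ?_⟩, fun x => ?_⟩
    · exact (norm_sub_le _ _).trans (add_le_add (hM n x hx) (hN x hx.le))
    · simpa using (h2 x).sub_const ((g : E → ℂ) x)
  have e : ∀ n, U (fs n) (πs n) = U f π + (U (fs n - f) (πs n) + ∑ j : Fin (k + 1),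
      (U 1 (Function.update (splice π (πs n) j) j (f * (πs n j - π j))) -
        U (πs n j - π j) (Function.update (splice π (πs n) j) j f))) := by
    intro n
    have h1 : U (fs n) (πs n) = U f π + (U (fs n - f) (πs n) + (U f (πs n) - U f π)) := by
      rw [map_sub, AlternatingMap.sub_apply]; ring
    rw [h1, U.map_sub_eq_sum]
    simp only [← hU.map_update_left]
  simp only [e]
  have t1 : Tendsto (fun n => U (fs n - f) (πs n)) atTop (𝓝 0) := by
    obtain ⟨⟨M, hM⟩, h2⟩ := hsub hfL hft
    refine squeeze_zero_norm (fun n => hU.bound _ _ _ (hs n)) ?_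
    simpa using (tendsto_integral_norm_zero hU.conc hM h2).const_mul (∏ i, (L i : ℝ))
  have t2 : ∀ j : Fin (k + 1), Tendsto (fun n =>
      U (πs n j - π j) (Function.update (splice π (πs n) j) j f)) atTop (𝓝 0) := by
    intro j
    obtain ⟨⟨M, hM⟩, h2⟩ := hsub (hE j) (hT j)
    refine squeeze_zero_norm (fun n => hU.bound _ _ _
      (lip_update (lip_splice h0 (hs n) j) hLf)) ?_
    simpa using (tendsto_integral_norm_zero hU.conc hM h2).const_mul
      (∏ i, (Function.update L j Lf i : ℝ))
  have t3 : ∀ j : Fin (k + 1), Tendsto (fun n =>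
      U 1 (Function.update (splice π (πs n) j) j (f * (πs n j - π j)))) atTop (𝓝 0) := by
    intro j
    obtain ⟨⟨M, hM⟩, h2⟩ := hsub (hE j) (hT j)
    refine squeeze_zero_norm (a := fun n => (∏ i, (L (j.succAbove i) : ℝ)) *
      -- The factor `f` keeps the product supported in the ball, which is what `hbd` asks for.
      ∫ x, ‖((f * (πs n j - π j) : qLipAlg E) : E → ℂ) x‖ ∂μ) (fun n => ?_) ?_
    · rw [U.map_update_eq, norm_mul, norm_pow, norm_neg, norm_one, one_pow, one_mul]
      refine hbd _ _ _ (fun x hx => ?_) fun i => lip_splice h0 (hs n) j _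
      rw [Subalgebra.coe_mul, Pi.mul_apply, hf x hx, zero_mul]
    · have := tendsto_integral_norm_zero (g := fun n => f * (πs n j - π j)) (M := Mf * M) hμ
        (fun n x hx => by
          rw [Subalgebra.coe_mul, Pi.mul_apply, norm_mul]
          exact mul_le_mul (hMf x hx.le) (hM n x hx) (norm_nonneg _) Mf.2)
        (fun x => by simpa using (h2 x).const_mul ((f : E → ℂ) x))
      simpa using this.const_mul (∏ i, (L (j.succAbove i) : ℝ))
  have t4 := (t1.add (tendsto_finsetSum Finset.univ fun j _ => (t3 j).sub (t2 j))).const_add (U f π)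
  simpa using t4

theorem NormalForm.qCont {S : Form E k} (hS : NormalForm S ρ μ) (R : ℝ) :
    QCont (fun f => ⇑(S f)) R := by
  intro fs f πs π _ _ hL hf hE hT
  obtain ⟨M, hM⟩ := exists_uniform_bound hL hf ρ
  exact hS.tendsto_joint hE hT (fun n => by filter_upwards [hS.conc] with x hx using hM n x hx)
    (ae_of_all _ hf)

omit [MeasurableSpace E] [BorelSpace E] in
theorem QCont.sub {G H : qLipAlg E → (Fin k → qLipAlg E) → ℂ} {R : ℝ} (hG : QCont G R)
    (hH : QCont H R) : QCont (G - H) R := fun fs f πs π h1 h2 h3 h4 h5 h6 =>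
  (hG fs f πs π h1 h2 h3 h4 h5 h6).sub (hH fs f πs π h1 h2 h3 h4 h5 h6)

omit [BorelSpace E] in
theorem Tame.mono {G : qLipAlg E → (Fin k → qLipAlg E) → ℂ} (h : Tame G ρ μ) {ρ' : ℝ}
    (hρ : ρ ≤ ρ') : Tame G ρ' μ :=
  ⟨h.finite, h.inner, h.conc.mono fun _ hx => hx.trans_le hρ, fun f π L hL =>
    h.bound f π L fun i => (hL i).mono (Metric.ball_subset_ball hρ), h.loc⟩

theorem Tame.sub {G H : qLipAlg E → (Fin k → qLipAlg E) → ℂ} (hG : Tame G ρ μ) (hH : Tame H ρ ν) :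
    Tame (G - H) ρ (μ + ν) := by
  have := hG.finite
  have := hH.finite
  have := hG.inner
  have := hH.inner
  refine ⟨inferInstance, innerRegular_add _ _, ae_add_measure_iff.2 ⟨hG.conc, hH.conc⟩,
    fun f π L hL => ?_, fun f π i c W hW hf h => ?_⟩
  · rw [integral_add_measure (integrableQ hG.conc f).norm (integrableQ hH.conc f).norm, mul_add]
    exact (norm_sub_le _ _).trans (add_le_add (hG.bound f π L hL) (hH.bound f π L hL))
  · rw [Pi.sub_apply, Pi.sub_apply, hG.loc f π i c W hW hf h, hH.loc f π i c W hW hf h, sub_zero]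

omit [MeasurableSpace E] [BorelSpace E] in
theorem FamBound.sub {G H : qLipAlg E → (Fin k → qLipAlg E) → ℂ} {ρ' : ℝ} {m m' : ℝ≥0∞}
    (hG : FamBound G ρ m) (hH : FamBound H ρ' m') (hρ : ρ ≤ ρ') : FamBound (G - H) ρ' (m + m') := by
  intro n f π c L hc hL hf hπ
  have h1 := hG n f π c L hc hL (fun x hx => hf x (hx.trans_le hρ)) fun j i =>
    (hπ j i).mono (Metric.ball_subset_ball hρ)
  have h2 := hH n f π c L hc hL hf hπ
  rw [mul_add]
  refine le_trans ?_ (add_le_add h1 h2)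
  rw [← Finset.sum_add_distrib]
  exact Finset.sum_le_sum fun j _ => enorm_sub_le

omit [MeasurableSpace E] [BorelSpace E] in
theorem coe_update (π : Fin k → qLipAlg E) (i : Fin k) (g : qLipAlg E) :
    (fun j => (Function.update π i g j : E → ℂ)) =
      Function.update (fun j => (π j : E → ℂ)) i (g : E → ℂ) := by
  ext1 j
  by_cases hj : j = i
  · subst hj; simp
  · simp [Function.update_of_ne hj]

/-- `Ψ` coincides with `Φ` on functions supported in the ball of radius `R`. -/
def Represents (Φ : Form E k) (R : ℝ) (Ψ : Functional E k) : Prop :=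
  ∀ (f : qLipAlg E) (π : Fin k → qLipAlg E), VanishOff R (f : E → ℂ) →
    Ψ (f : E → ℂ) (fun i => (π i : E → ℂ)) = Φ f π

omit [MeasurableSpace E] [BorelSpace E] in
theorem exists_coe_eq_of_qTest {f : E → ℂ} (hf : f ∈ qTest E) : ∃ F : qLipAlg E, (F : E → ℂ) = f :=
  ⟨⟨f, mem_qLip_of_qTest hf⟩, rfl⟩

omit [MeasurableSpace E] [BorelSpace E] in
theorem exists_coe_eq {ι : Type*} {π : ι → E → ℂ} (h : ∀ i, π i ∈ qLip E) :
    ∃ P : ι → qLipAlg E, (fun i => (P i : E → ℂ)) = π :=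
  ⟨fun i => ⟨π i, h i⟩, rfl⟩

omit [MeasurableSpace E] [BorelSpace E] in
theorem isMultilinearOn_of_represents {Ψ : Functional E k}
    (h : ∀ R : ℝ, 0 < R → ∃ Φ : Form E k, Represents Φ R Ψ) :
    IsMultilinearOn (qTest E) (qLip E) Ψ where
  add_left f hf g hg π hπ := by
    obtain ⟨P, rfl⟩ := exists_coe_eq hπ
    obtain ⟨-, R, hR, hfR⟩ := id hf
    obtain ⟨-, R', hR', hgR⟩ := id hg
    obtain ⟨F, rfl⟩ := exists_coe_eq_of_qTest hf
    obtain ⟨G, rfl⟩ := exists_coe_eq_of_qTest hg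
    obtain ⟨Φ, hΦ⟩ := h (max R R') (lt_max_of_lt_left hR)
    have h1 : VanishOff (max R R') (F : E → ℂ) := fun x hx =>
      vanishOff_of_tsupport_subset hfR x ((le_max_left _ _).trans hx)
    have h2 : VanishOff (max R R') (G : E → ℂ) := fun x hx =>
      vanishOff_of_tsupport_subset hgR x ((le_max_right _ _).trans hx)
    have h3 : VanishOff (max R R') ((F + G : qLipAlg E) : E → ℂ) := fun x hx => by
      rw [Subalgebra.coe_add, Pi.add_apply, h1 x hx, h2 x hx, add_zero]
    rw [← Subalgebra.coe_add, hΦ _ _ h1, hΦ _ _ h2, hΦ _ _ h3, map_add, AlternatingMap.add_apply]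
  smul_left c f hf π hπ := by
    obtain ⟨P, rfl⟩ := exists_coe_eq hπ
    obtain ⟨-, R, hR, hfR⟩ := id hf
    obtain ⟨F, rfl⟩ := exists_coe_eq_of_qTest hf
    obtain ⟨Φ, hΦ⟩ := h R hR
    have h1 := vanishOff_of_tsupport_subset hfR
    have h3 : VanishOff R ((c • F : qLipAlg E) : E → ℂ) := fun x hx => by
      rw [Subalgebra.coe_smul, Pi.smul_apply, h1 x hx, smul_zero]
    rw [← Subalgebra.coe_smul, hΦ _ _ h1, hΦ _ _ h3, map_smul, AlternatingMap.smul_apply,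
      smul_eq_mul]
  add_right f hf π hπ i u hu v hv := by
    obtain ⟨P, rfl⟩ := exists_coe_eq hπ
    obtain ⟨-, R, hR, hfR⟩ := id hf
    obtain ⟨F, rfl⟩ := exists_coe_eq_of_qTest hf
    obtain ⟨Φ, hΦ⟩ := h R hR
    have h1 := vanishOff_of_tsupport_subset hfR
    have e1 := coe_update P i ⟨u, hu⟩
    have e2 := coe_update P i ⟨v, hv⟩
    have e3 := coe_update P i (⟨u, hu⟩ + ⟨v, hv⟩)
    rw [Subalgebra.coe_add] at e3
    dsimp only at e1 e2 e3
    rw [← e1, ← e2, ← e3, hΦ _ _ h1, hΦ _ _ h1, hΦ _ _ h1, AlternatingMap.map_update_add]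
  smul_right c f hf π hπ i u hu := by
    obtain ⟨P, rfl⟩ := exists_coe_eq hπ
    obtain ⟨-, R, hR, hfR⟩ := id hf
    obtain ⟨F, rfl⟩ := exists_coe_eq_of_qTest hf
    obtain ⟨Φ, hΦ⟩ := h R hR
    have h1 := vanishOff_of_tsupport_subset hfR
    have e1 := coe_update P i ⟨u, hu⟩
    have e3 := coe_update P i (c • ⟨u, hu⟩)
    rw [Subalgebra.coe_smul] at e3
    dsimp only at e1 e3
    rw [← e1, ← e3, hΦ _ _ h1, hΦ _ _ h1, AlternatingMap.map_update_smul, smul_eq_mul]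

omit [BorelSpace E] in
theorem isQLocCurrent_of_represents {Ψ : Functional E k}
    (h : ∀ R : ℝ, 0 < R → ∃ (Φ : Form E k) (ρ : ℝ) (μ : Measure E), Represents Φ R Ψ ∧
      Tame (fun f => ⇑(Φ f)) ρ μ ∧ QCont (fun f => ⇑(Φ f)) R) : IsQLocCurrent Ψ where
  multilinear := isMultilinearOn_of_represents fun R hR => by
    obtain ⟨Φ, -, -, hΦ, -⟩ := h R hR
    exact ⟨Φ, hΦ⟩
  continuous fs f πs π hL hs hf hπL hπ := by
    obtain ⟨C, hC, hCs⟩ := hL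
    obtain ⟨R, hR, hfR, hfsR⟩ := hs
    obtain ⟨Φ, ρ, μ, hΦ, -, hc⟩ := h R hR
    have hq : ∀ i, π i ∈ qLip E := fun i r hr => (hπL i r hr).imp fun _ h => h.1
    have hqs : ∀ n i, πs n i ∈ qLip E := fun n i r hr => (hπL i r hr).imp fun _ h => h.2 n
    let F : qLipAlg E := ⟨f, mem_qLip_of_lip ⟨C, hC⟩⟩
    let Fs : ℕ → qLipAlg E := fun n => ⟨fs n, mem_qLip_of_lip ⟨C, hCs n⟩⟩
    let P : Fin k → qLipAlg E := fun i => ⟨π i, hq i⟩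
    let Ps : ℕ → Fin k → qLipAlg E := fun n i => ⟨πs n i, hqs n i⟩
    have h1 := vanishOff_of_tsupport_subset hfR
    have h2 := fun n => vanishOff_of_tsupport_subset (hfsR n)
    have key := hc Fs F Ps P h2 h1 (fun r => ⟨C, fun n => (hCs n).lipschitzOnWith⟩) hf
      (fun i r => by
        obtain ⟨C, -, hC⟩ := hπL i (max r 1) (by positivity)
        exact ⟨C, fun n => (hC n).mono (Metric.ball_subset_ball (le_max_left _ _))⟩) hπ
    have e : Ψ f π = Φ F P := hΦ F P h1
    rw [e]
    exact key.congr fun n => (hΦ (Fs n) (Ps n) (h2 n)).symm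
  isLocal f hf π hπ hloc := by
    obtain ⟨i, c, W, hW, hfW, hc⟩ := hloc
    obtain ⟨P, rfl⟩ := exists_coe_eq hπ
    obtain ⟨-, R, hR, hfR⟩ := id hf
    obtain ⟨F, rfl⟩ := exists_coe_eq_of_qTest hf
    obtain ⟨Φ, ρ, μ, hΦ, ht, -⟩ := h R hR
    rw [hΦ _ _ (vanishOff_of_tsupport_subset hfR)]
    exact ht.loc F P i c W hW hfW hc
  locally_finite_mass R hR := by
    obtain ⟨Φ, ρ, μ, hΦ, ht, -⟩ := h R hR
    have := ht.finite
    have := ht.inner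
    set e := lipschitzExtensionConstant ℂ
    -- The form is bounded through Lipschitz constants on its own ball of radius `ρ`, whereas the `π
    -- i` are controlled on the ball of radius `R` only; replacing them by extensions costs `e ^ k`.
    refine ⟨e ^ k • μ, inferInstance, inferInstance, fun f hf hfR π hπ L hL => ?_⟩
    obtain ⟨P, rfl⟩ := exists_coe_eq hπ
    obtain ⟨F, rfl⟩ := exists_coe_eq_of_qTest hf
    obtain ⟨P', h1, h2⟩ := exists_extension_family hL
    have h0 := vanishOff_of_tsupport_subset hfR
    rw [hΦ _ _ h0, ht.congr_of_local F Metric.isOpen_ball hfR fun i x hx => (h2 i x hx).symm]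
    refine (ht.bound F P' _ fun i => (h1 i).lipschitzOnWith).trans (le_of_eq ?_)
    rw [setIntegral_eq_integral_of_forall_compl_eq_zero fun x hx => ?_,
      integral_smul_nnreal_measure, NNReal.smul_def, smul_eq_mul]
    · push_cast
      rw [Finset.prod_mul_distrib, Finset.prod_const, Finset.card_univ, Fintype.card_fin]
      ring
    · rw [h0 x (by simpa using hx), norm_zero]

omit [BorelSpace E] in
theorem qMass_le_of_represents {Ψ : Functional E k} {Φ : Form E k} {R ρ' : ℝ} {m : ℝ≥0∞}
    (hΦ : Represents Φ R Ψ) (ht : Tame (fun f => ⇑(Φ f)) ρ μ)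
    (hm : FamBound (fun f => ⇑(Φ f)) ρ' m) :
    qMass R Ψ ≤ lipschitzExtensionConstant ℂ ^ k * m := by
  refine iSup_le fun n => iSup_le fun f => iSup_le fun π => iSup_le fun ⟨h1, h2, h3⟩ => ?_
  obtain ⟨F, rfl⟩ := exists_coe_eq (π := f) fun j => mem_qLip_of_qTest (h1 j).1
  choose P hP using fun j => exists_coe_eq (π := π j) fun i => (h2 j i).1
  obtain rfl : (fun j i => (P j i : E → ℂ)) = π := funext hP
  choose P' h4 h5 using fun j => exists_extension_family fun i => (h2 j i).2
  have e : ∀ j, Ψ (F j : E → ℂ) (fun i => (P j i : E → ℂ)) = Φ (F j) (P' j) := fun j => by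
    rw [hΦ _ _ (vanishOff_of_tsupport_subset (h1 j).2)]
    exact ht.congr_of_local (F j) Metric.isOpen_ball (h1 j).2 fun i x hx => (h5 j i x hx).symm
  have := hm n F P' 1 (lipschitzExtensionConstant ℂ) one_pos (lipschitzExtensionConstant_pos ℂ)
    (fun x _ => by simpa using h3 x) fun j i => by simpa using (h4 j i).lipschitzOnWith
  simp only [e]
  simpa using this

omit [MeasurableSpace E] [BorelSpace E] in
theorem hasBidimension_of_represents [NormedSpace ℂ E] {Ψ : Functional E k} {p q : ℤ}
    (h : ∀ R : ℝ, 0 < R → ∃ Φ : Form E k, Represents Φ R Ψ ∧ BidimQ (fun f => ⇑(Φ f)) p q) :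
    HasBidimension (qTest E) (qLip E) p q Ψ := by
  intro f hf π hπ I hI
  obtain ⟨P, rfl⟩ := exists_coe_eq hπ
  obtain ⟨-, R, hR, hfR⟩ := id hf
  obtain ⟨F, rfl⟩ := exists_coe_eq_of_qTest hf
  obtain ⟨Φ, hΦ, hb⟩ := h R hR
  rw [hΦ _ _ (vanishOff_of_tsupport_subset hfR)]
  exact hb F P I hI

end QuasiLocal

/-! ### Boundaries of normal currents, and bidimension of extensions. -/

section Metric

variable {E : Type*} [NormedAddCommGroup E] {k : ℕ}

theorem isMetricCurrent_of_eq_zero [MeasurableSpace E] {T : Functional E k}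
    (h : ∀ f ∈ lipB E, ∀ π : Fin k → E → ℂ, (∀ i, π i ∈ lip E) → T f π = 0) :
    IsMetricCurrent T := by
  have hu : ∀ (π : Fin k → E → ℂ), (∀ i, π i ∈ lip E) → ∀ (i : Fin k), ∀ u ∈ lip E,
      ∀ j, Function.update π i u j ∈ lip E := by
    intro π hπ i u hu j
    by_cases hj : j = i
    · subst hj; simpa using hu
    · simpa [Function.update_of_ne hj] using hπ j
  refine ⟨⟨?_, ?_, ?_, ?_⟩, ?_, ?_, ⟨0, inferInstance, inferInstance, ?_⟩⟩
  · intro f hf g hg π hπ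
    have h3 : f + g ∈ lipB E := by
      obtain ⟨h1, M, hM⟩ := hf
      obtain ⟨h2, N, hN⟩ := hg
      exact ⟨lip_add h1 h2, M + N, fun x => (norm_add_le _ _).trans (add_le_add (hM x) (hN x))⟩
    rw [h f hf π hπ, h g hg π hπ, h _ h3 π hπ, add_zero]
  · intro c f hf π hπ
    have h3 : c • f ∈ lipB E := by
      have hc : (fun _ => c : E → ℂ) ∈ lipB E := ⟨⟨0, LipschitzWith.const c⟩, ‖c‖, fun _ => le_rfl⟩
      exact lipB_mul hc hf
    rw [h f hf π hπ, h _ h3 π hπ, mul_zero]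
  · intro f hf π hπ i u hu' v hv
    rw [h f hf _ (hu π hπ i _ (lip_add hu' hv)), h f hf _ (hu π hπ i _ hu'),
      h f hf _ (hu π hπ i _ hv), add_zero]
  · intro c f hf π hπ i u hu'
    have h3 : c • u ∈ lip E := by
      obtain ⟨K, hK⟩ := hu'
      exact ⟨_, (lipschitzWith_smul c).comp hK⟩
    rw [h f hf _ (hu π hπ i _ h3), h f hf _ (hu π hπ i _ hu'), mul_zero]
  · intro f hf πs π hL _
    rw [h f hf π fun i => (hL i).imp fun _ h => h.1]
    refine tendsto_const_nhds.congr fun n => ?_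
    rw [h f hf _ fun i => (hL i).imp fun _ h => h.2 n]
  · intro f hf π hπ _
    exact h f hf π hπ
  · intro f hf π L hL
    rw [h f hf π fun i => ⟨_, hL i⟩]
    simp

theorem cons_mem_lip {f : E → ℂ} (hf : f ∈ lip E) {π : Fin k → E → ℂ} (hπ : ∀ i, π i ∈ lip E)
    (i : Fin (k + 1)) : (Fin.cons (α := fun _ => E → ℂ) f π : Fin (k + 1) → E → ℂ) i ∈ lip E := by
  refine Fin.cases ?_ (fun j => ?_) i
  · rwa [Fin.cons_zero]
  · rw [Fin.cons_succ]; exact hπ j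

/-- The boundary of the boundary carries the constant 1 in a slot and so vanishes by locality; in
dimensions 0 and 1 it is zero by definition. -/
theorem isNormal_boundary [MeasurableSpace E] {T : Functional E k} (hT : IsNormal T) :
    IsNormal (boundary T) := by
  refine ⟨hT.2, isMetricCurrent_of_eq_zero fun f hf π hπ => ?_⟩
  match k, T, hT, π, hπ with
  | 0, T, hT, π, hπ => rfl
  | 1, T, hT, π, hπ => rfl
  | k + 2, T, hT, π, hπ =>
    have h1 := (one_mem_lipB (E := E)).1
    exact hT.1.isLocal _ one_mem_lipB _ (cons_mem_lip h1 (cons_mem_lip hf.1 hπ))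
      ⟨0, 1, Set.univ, isOpen_univ, Set.subset_univ _, fun x _ => rfl⟩

theorem extendFun_bidimQ [NormedSpace ℂ E] {T : Functional E k} {d b : ℝ} (hd : 0 < d) {p q : ℤ}
    (hT : HasBidimension (lipB E) (lip E) p q T) : BidimQ (extendFun d b T) p q := by
  intro f π I hI
  have hsub := tsupport_cut_mul_subset (b := b) hd (f : E → ℂ)
  have key : ∀ (g h : E → ℂ), (∀ x, ‖x‖ < b + d → h x = g x) →
      HolomorphicNear g (tsupport (f : E → ℂ)) →
      HolomorphicNear h (tsupport (cutFn (annDist d b) (d / 4) * (f : E → ℂ))) := by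
    rintro g h hgh ⟨W, hW, hfW, hg⟩
    refine ⟨W ∩ Metric.ball 0 (b + d), hW.inter Metric.isOpen_ball, fun x hx => ?_,
      (hg.mono Set.inter_subset_left).congr fun x hx => hgh x (mem_ball_zero_iff.1 hx.2)⟩
    exact ⟨hfW (hsub hx).1, mem_ball_zero_iff.2 (norm_lt_of_annDist_le hd (hsub hx).2)⟩
  have hone : ∀ (g : qLipAlg E) (x : E), ‖x‖ < b + d →
      (cutFn (annDist d b) d * (g : E → ℂ) : E → ℂ) x = (g : E → ℂ) x := fun g x hx => by
    rw [Pi.mul_apply, cutFn_eq_one hd (annDist_le_of_norm_lt hx), one_mul]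
  refine hT _ (cutFn_ann_mul_mem_lipB d b (by positivity) f) _
    (fun i => (cutFn_ann_mul_mem_lipB d b hd _).1) I ?_
  rcases hI with ⟨h1, h2⟩ | ⟨h1, h2⟩
  · exact Or.inl ⟨h1, fun i hi => key _ _ (hone (π i)) (h2 i hi)⟩
  · exact Or.inr ⟨h1, fun i hi => key _ _ (fun x hx => congrArg _ (hone (π i) x hx)) (h2 i hi)⟩

end Metric

/-! ### The prescribed cutoffs, and metric currents seen as quasi-local ones. -/

section Cutoff

variable {E : Type*} [NormedAddCommGroup E] {k : ℕ}

theorem cutoff_eq_cutFn (f : E → ℂ) :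
    cutoff f = cutFn (fun x => ‖x‖ - sSup (norm '' tsupport f)) 1 := by
  ext x
  have : sSup (norm '' tsupport f) + 2 - ‖x‖ = 2 - (‖x‖ - sSup (norm '' tsupport f)) / 1 := by ring
  rw [cutoff, cutFn, this]

theorem cutoff_mem_lipB (f : E → ℂ) : cutoff f ∈ lipB E := by
  rw [cutoff_eq_cutFn]
  refine cutFn_mem_lipB ?_ one_pos
  simpa using (lipschitzWith_one_norm (E := E)).sub (LipschitzWith.const (sSup (norm '' tsupport f)))

theorem cutoff_eq_one {f : E → ℂ} {x : E} (hx : ‖x‖ < sSup (norm '' tsupport f) + 1) :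
    cutoff f x = 1 := by
  rw [cutoff_eq_cutFn]
  exact cutFn_eq_one one_pos (by linarith)

theorem cutoff_eq_zero {f : E → ℂ} {x : E} (hx : sSup (norm '' tsupport f) + 2 ≤ ‖x‖) :
    cutoff f x = 0 := by
  rw [cutoff_eq_cutFn]
  exact cutFn_eq_zero one_pos (by linarith)

theorem norm_le_sSup_of_mem_tsupport {f : E → ℂ} {R : ℝ} (h : VanishOff R f) {x : E}
    (hx : x ∈ tsupport f) : ‖x‖ ≤ sSup (norm '' tsupport f) := by
  refine le_csSup ⟨R, ?_⟩ ⟨x, hx, rfl⟩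
  rintro - ⟨y, hy, rfl⟩
  refine closure_minimal (t := {z : E | ‖z‖ ≤ R}) (fun z hz => ?_)
    (isClosed_le continuous_norm continuous_const) hy
  by_contra hcon
  exact hz (h z (not_le.1 hcon).le)

theorem sSup_norm_nonneg (s : Set E) : 0 ≤ sSup (norm '' s) :=
  Real.sSup_nonneg (by rintro - ⟨y, -, rfl⟩; exact norm_nonneg y)

variable [NormedSpace ℂ E] [MeasurableSpace E] [BorelSpace E]

omit [NormedSpace ℂ E] in
omit [BorelSpace E] in
theorem represents_toQLoc {T : Functional E k} (hT : IsMetricCurrent T) {d b : ℝ} (hd : 0 < d)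
    (ha : AnnSupported d b T) {S : Form E k} (hS : ∀ f π, S f π = extendFun d b T f π) (R : ℝ) :
    Represents S R (toQLoc T) := by
  intro f π hf
  have hfq : (f : E → ℂ) ∈ lipB E := lipB_of_qTest (mem_qTest_of_zero_off f.2 (R := R)
    fun x hx => hf x hx.le)
  have hπ : ∀ i, (fun x => cutoff (f : E → ℂ) x * (π i : E → ℂ) x) ∈ lip E := fun i =>
    (lipB_of_qTest (mem_qTest_of_zero_off ((qLipAlg E).mul_mem (x := cutoff (f : E → ℂ))
      (mem_qLip_of_lipB (cutoff_mem_lipB _)) (π i).2)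
      (R := sSup (norm '' tsupport (f : E → ℂ)) + 2) fun x hx => by
        rw [Pi.mul_apply, cutoff_eq_zero hx.le, zero_mul])).1
  rw [toQLoc, ha.cut hT.multilinear (c := d / 4) (by positivity) hfq hπ, hS]
  refine (extendFun_eq hT hd f π hπ (W := Metric.ball 0 (sSup (norm '' tsupport (f : E → ℂ)) + 1))
    Metric.isOpen_ball (fun x hx => ?_) fun i x hx _ => ?_).symm
  · have := norm_le_sSup_of_mem_tsupport hf (tsupport_cut_mul_subset hd _ hx).1
    exact mem_ball_zero_iff.2 (by linarith)
  · rw [cutoff_eq_one (mem_ball_zero_iff.1 hx), one_mul]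

end Cutoff

/-! ### The untruncated cone and the solution of the equation. -/

section Cone

variable {E : Type*} [NormedAddCommGroup E] [NormedSpace ℂ E] {k : ℕ}

/-- A functional on `qLipAlg E` as a functional on all functions. -/
noncomputable def liftQ (G : qLipAlg E → (Fin k → qLipAlg E) → ℂ) : Functional E k := by
  classical exact fun f π =>
    if h : f ∈ qLip E ∧ ∀ i, π i ∈ qLip E then G ⟨f, h.1⟩ fun i => ⟨π i, h.2 i⟩ else 0

omit [NormedSpace ℂ E] in
theorem liftQ_apply (G : qLipAlg E → (Fin k → qLipAlg E) → ℂ) (f : qLipAlg E)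
    (π : Fin k → qLipAlg E) : liftQ G (f : E → ℂ) (fun i => (π i : E → ℂ)) = G f π :=
  dif_pos ⟨f.2, fun i => (π i).2⟩

variable [MeasurableSpace E] [BorelSpace E] {S : Form E k} {ρ a : ℝ} {μ : Measure E}

omit [BorelSpace E] in
-- On the carrier `‖x‖ ≥ a`, and `‖ζ‖ ≥ r - 1 ≥ R / a`, so `ζ x` has left the ball of radius `R`.
-- Here the positive distance to the origin enters.
theorem ae_vanish_of_vanishOff (ha : 0 < a) (hμa : ∀ᵐ x ∂μ, a ≤ ‖x‖) {R : ℝ}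
    {f : E → ℂ} (hf : VanishOff R f) {p : ℝ × ℝ} (hp : R / a + 1 ≤ p.1) :
    ∀ᵐ x ∂μ, f (zeta p.1 p.2 • x) = 0 := by
  filter_upwards [hμa] with x hx
  refine hf _ ?_
  have h1 : R / a ≤ ‖zeta p.1 p.2‖ := by
    have := le_norm_zeta p.1 p.2
    have := le_abs_self p.1
    linarith
  rw [norm_smul]
  calc R = R / a * a := by field_simp
    _ ≤ _ := by gcongr

/-- The cone over `S` as a functional. -/
noncomputable def NormalForm.qCone (hS : NormalForm S ρ μ) : Functional E (k + 1) :=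
  liftQ fun f π => limUnder atTop fun n : ℕ => hS.cone n f π

theorem NormalForm.represents_qCone (hS : NormalForm S ρ μ) (ha : 0 < a)
    (hμa : ∀ᵐ x ∂μ, a ≤ ‖x‖) {R : ℝ} {ϱ : ℝ} (hϱ : R / a + 1 ≤ ϱ) :
    Represents (hS.cone ϱ) R hS.qCone := by
  intro f π hf
  rw [qCone, liftQ_apply]
  refine Tendsto.limUnder_eq (tendsto_const_nhds.congr' ?_)
  filter_upwards [eventually_ge_atTop ⌈ϱ⌉₊] with n hn
  exact hS.cone_eq_cone ((Nat.le_ceil ϱ).trans (by exact_mod_cast hn)) f π fun p hp =>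
    ae_vanish_of_vanishOff ha hμa hf (hϱ.trans hp.le)

theorem NormalForm.cone_congr (hS : NormalForm S ρ μ) (ha : 0 < a)
    (hμa : ∀ᵐ x ∂μ, a ≤ ‖x‖) {R : ℝ} {ϱ ϱ' : ℝ} (hϱ : R / a + 1 ≤ ϱ)
    (hϱ' : R / a + 1 ≤ ϱ') {f : qLipAlg E} (hf : VanishOff R (f : E → ℂ))
    (π : Fin (k + 1) → qLipAlg E) : hS.cone ϱ f π = hS.cone ϱ' f π :=
  (hS.represents_qCone ha hμa hϱ f π hf).symm.trans (hS.represents_qCone ha hμa hϱ' f π hf)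

/-- The function `1 - g` lives where `f` is locally 0, so locality in the slot of `f` lets the
cutoff be replaced by 1. -/
theorem NormalForm.cone_cutoff (hS : NormalForm S ρ μ) (ϱ : ℝ) {R : ℝ} {f : qLipAlg E}
    (hf : VanishOff R (f : E → ℂ)) (π : Fin k → qLipAlg E) {g : qLipAlg E}
    (hg : (g : E → ℂ) = cutoff (f : E → ℂ)) :
    hS.cone ϱ g (Fin.cons (α := fun _ => qLipAlg E) f π) =
      hS.cone ϱ 1 (Fin.cons (α := fun _ => qLipAlg E) f π) := by
  refine (sub_eq_zero.1 ?_).symm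
  rw [← AlternatingMap.sub_apply, ← map_sub]
  set s := sSup (norm '' tsupport (f : E → ℂ))
  refine hS.cone_loc ϱ (1 - g) _ 0 0 {x | s < ‖x‖} (isOpen_lt continuous_const continuous_norm)
    (fun x hx => ?_) fun x hx => ?_
  · have : tsupport ((1 - g : qLipAlg E) : E → ℂ) ⊆ {x | s + 1 ≤ ‖x‖} := by
      refine closure_minimal (fun x hx => ?_) (isClosed_le continuous_const continuous_norm)
      by_contra hcon
      apply hx
      rw [Subalgebra.coe_sub, Pi.sub_apply, hg, cutoff_eq_one (not_le.1 hcon)]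
      exact sub_self _
    have h1 : s + 1 ≤ ‖x‖ := this hx
    change s < ‖x‖
    linarith
  · rw [Fin.cons_zero]
    refine image_eq_zero_of_notMem_tsupport fun h => ?_
    have h1 : s < ‖x‖ := hx
    have := norm_le_sSup_of_mem_tsupport hf h
    linarith

theorem NormalForm.qBoundary_qCone (hS : NormalForm S ρ μ) (ha : 0 < a)
    (hμa : ∀ᵐ x ∂μ, a ≤ ‖x‖) {R : ℝ} {f : qLipAlg E}
    (hf : VanishOff R (f : E → ℂ)) (π : Fin k → qLipAlg E) :
    ∃ ϱ₀ : ℝ, ∀ ϱ, ϱ₀ ≤ ϱ → qBoundary hS.qCone (f : E → ℂ) (fun i => (π i : E → ℂ)) =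
      hS.cone ϱ 1 (Fin.cons (α := fun _ => qLipAlg E) f π) := by
  set s := sSup (norm '' tsupport (f : E → ℂ))
  have hs : 0 ≤ s := sSup_norm_nonneg _
  -- The cutoff `cutoff f` vanishes off the ball of radius `s + 2`, which determines the radius of
  -- truncation.
  refine ⟨(s + 2) / a + 1, fun ϱ hϱ => ?_⟩
  let g : qLipAlg E := ⟨cutoff (f : E → ℂ), mem_qLip_of_lipB (cutoff_mem_lipB _)⟩
  have hg : VanishOff (s + 2) (g : E → ℂ) := fun x hx => cutoff_eq_zero hx
  have e : (fun i => ((Fin.cons (α := fun _ => qLipAlg E) f π : Fin (k + 1) → qLipAlg E) i : E → ℂ)) =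
      Fin.cons (α := fun _ => E → ℂ) (f : E → ℂ) fun i => (π i : E → ℂ) := by
    ext1 i
    refine Fin.cases ?_ (fun j => ?_) i <;> rfl
  have h := hS.represents_qCone ha hμa hϱ g
    (Fin.cons (α := fun _ => qLipAlg E) f π) hg
  rw [e] at h
  rw [← hS.cone_cutoff ϱ hf π (g := g) rfl]
  exact h

/-- The radius at which the cone may be truncated for functions supported in the ball of
radius `R`. -/
noncomputable def truncRadius (a R : ℝ) : ℝ := R / a + 1

/-- The bound for the Lipschitz constants of the dilations. -/
noncomputable def dilBound (a R : ℝ) : ℝ≥0 := (truncRadius a R + 2).toNNReal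

theorem truncRadius_pos (ha : 0 < a) {R : ℝ} (hR : 0 < R) : 0 < truncRadius a R := by
  unfold truncRadius; positivity

theorem le_dilBound (a R : ℝ) : truncRadius a R + 2 ≤ dilBound a R := Real.le_coe_toNNReal _

theorem one_le_dilBound (ha : 0 < a) {R : ℝ} (hR : 0 < R) : 1 ≤ dilBound a R := by
  have h1 := le_dilBound a R
  have h2 := truncRadius_pos ha hR
  have : (1 : ℝ) ≤ dilBound a R := by linarith
  exact_mod_cast this

theorem dilBound_pos (ha : 0 < a) {R : ℝ} (hR : 0 < R) : 0 < dilBound a R :=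
  one_pos.trans_le (one_le_dilBound ha hR)

theorem le_dilBound_mul (ha : 0 < a) {R : ℝ} (hR : 0 < R) (hρ : 0 ≤ ρ) :
    ρ ≤ dilBound a R * ρ := by
  have h1 : (1 : ℝ) ≤ dilBound a R := by exact_mod_cast one_le_dilBound ha hR
  nlinarith

theorem NormalForm.qCont_cone_zero {S : Form E 0} (hS : NormalForm S ρ μ) (hρ : 0 ≤ ρ) (ha : 0 < a)
    (hμa : ∀ᵐ x ∂μ, a ≤ ‖x‖) {R : ℝ} (hR : 0 < R) :
    QCont (fun f => ⇑(hS.cone (truncRadius a R) f)) R := by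
  have := hS.finite
  have hle := le_dilBound_mul ha hR hρ
  refine qCont_of_bound (hS.tame_cone hρ (le_dilBound a R) (dilBound_pos ha hR))
    (hS.toTame.mono hle).conc fun f π L hf hL => ?_
  rw [hS.cone_cons_zero (truncRadius_pos ha hR) f π fun p hp =>
    ae_vanish_of_vanishOff ha hμa hf hp]
  exact (hS.toTame.mono hle).bound f π L hL

/-- The homotopy formula writes the boundary of the cone as `S` minus the cone over `B`, both of
finite mass; this is the bound that yields continuity. -/
theorem NormalForm.qCont_cone_succ {S : Form E (k + 1)} (hS : NormalForm S ρ μ) {B : Form E k}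
    {ν : Measure E} (hB : NormalForm B ρ ν)
    (hBS : ∀ f π, B f π = S 1 (Fin.cons (α := fun _ => qLipAlg E) f π)) (hρ : 0 ≤ ρ) (ha : 0 < a)
    (hμa : ∀ᵐ x ∂μ, a ≤ ‖x‖) {R : ℝ} (hR : 0 < R) :
    QCont (fun f => ⇑(hS.cone (truncRadius a R) f)) R := by
  have hle := le_dilBound_mul ha hR hρ
  have ht := (hS.toTame.mono hle).sub (hB.tame_cone hρ (le_dilBound a R) (dilBound_pos ha hR))
  have := ht.finite
  refine qCont_of_bound (hS.tame_cone hρ (le_dilBound a R) (dilBound_pos ha hR))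
    ht.conc fun f π L hf hL => ?_
  rw [eq_sub_of_add_eq (hS.cone_cons hB hBS (truncRadius_pos ha hR) f π fun p hp =>
    ae_vanish_of_vanishOff ha hμa hf hp)]
  exact ht.bound f π L hL

theorem NormalForm.qCont_cone {T : Functional E k} (hT : IsNormal T) {d b : ℝ} (hd : 0 < d)
    (hb : 0 < b) (hA : AnnSupported d b T) (hS : NormalForm S (b + d) μ)
    (hST : ∀ f π, S f π = extendFun d b T f π) (ha : 0 < a) (hμa : ∀ᵐ x ∂μ, a ≤ ‖x‖) {R : ℝ}
    (hR : 0 < R) : QCont (fun f => ⇑(hS.cone (truncRadius a R) f)) R := by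
  cases k with
  | zero => exact hS.qCont_cone_zero (by positivity) ha hμa hR
  | succ k =>
    obtain ⟨B, ν, hBT, hB, -⟩ := exists_normalForm (isNormal_boundary hT) hd (hA.boundary hT.1)
    refine hS.qCont_cone_succ hB (fun f π => ?_) (by positivity) ha hμa hR
    rw [hBT, hST]
    exact (extendFun_boundary hT.1 hd hA f π).symm

/-- The constant in the mass bound for the cone over a `k`-dimensional current. -/
noncomputable def coneConst (k : ℕ) (ρ a R : ℝ) : ℝ≥0 :=
  (k + 1) * (2 * ρ.toNNReal * dilBound a R ^ k) *
    (parMeasure (truncRadius a R) Set.univ).toNNReal * lipschitzExtensionConstant ℂ ^ k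

theorem NormalForm.famBound_cone_mass {T : Functional E k} (hT : IsMetricCurrent T) {d b : ℝ}
    (hd : 0 < d) (hb : 0 < b) (hS : NormalForm S (b + d) μ)
    (hST : ∀ f π, S f π = extendFun d b T f π) (ha : 0 < a) {R : ℝ} (hR : 0 < R) :
    FamBound (fun f => ⇑(hS.cone (truncRadius a R) f)) (dilBound a R * (b + d))
      (coneConst k (b + d) a R * mass T) := by
  have h1 : FamBound (fun f => ⇑(S f)) (b + d) (lipschitzExtensionConstant ℂ ^ k * mass T) := by
    have : (fun f => ⇑(S f)) = extendFun d b T := by ext f π; exact hST f π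
    rw [this]
    exact extendFun_famBound hT hd
  have h2 := hS.famBound_cone (by positivity) (le_dilBound a R) (dilBound_pos ha hR) h1
  convert h2 using 1
  rw [coneConst]
  push_cast
  rw [ENNReal.coe_toNNReal (measure_ne_top _ _)]
  ring

/-- The mass constant of the cone over the boundary of a `k`-dimensional current. -/
noncomputable def bdConst (k : ℕ) (ρ a R : ℝ) : ℝ≥0 := if k = 0 then 0 else coneConst (k - 1) ρ a R

/-- `V` is the truncated cone over `dT`, and 0 in dimension 0, where there is no boundary.
Collecting its properties here lets the subsequent argument ignore the dimension. -/
theorem NormalForm.exists_boundary_form {T : Functional E k} (hT : IsNormal T) {d b : ℝ}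
    (hd : 0 < d) (hb : 0 < b) (hA : AnnSupported d b T) (hS : NormalForm S (b + d) μ)
    (hST : ∀ f π, S f π = extendFun d b T f π) (hμa : ∀ᵐ x ∂μ, d / 2 ≤ ‖x‖) {p q : ℤ}
    (hbi : HasBidimension (lipB E) (lip E) p q (boundary T)) {R : ℝ} (hR : 0 < R) :
    ∃ (V : Form E k) (ν : Measure E),
      Tame (fun f => ⇑(V f)) (dilBound (d / 2) R * (b + d)) ν ∧
      FamBound (fun f => ⇑(V f)) (dilBound (d / 2) R * (b + d))
        (bdConst k (b + d) (d / 2) R * mass (boundary T)) ∧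
      QCont (fun f => ⇑(V f)) R ∧ BidimQ (fun f => ⇑(V f)) p (q + 1) ∧
      ∀ (f : qLipAlg E) (π : Fin k → qLipAlg E) (ϱ : ℝ), VanishOff R (f : E → ℂ) →
        truncRadius (d / 2) R ≤ ϱ → hS.cone ϱ 1 (Fin.cons (α := fun _ => qLipAlg E) f π) =
          S f π - V f π := by
  have ha : 0 < d / 2 := by positivity
  have hpos := truncRadius_pos ha hR
  cases k with
  | zero =>
    refine ⟨0, 0, ⟨inferInstance, inferInstance, by simp, fun f π L _ => by simp,
      fun f π i c W _ _ _ => rfl⟩, fun n f π c L _ _ _ _ => by simp,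
      fun fs f πs π _ _ _ _ _ _ => tendsto_const_nhds, fun f π I _ => rfl,
      fun f π ϱ hf hϱ => ?_⟩
    rw [hS.cone_cons_zero (hpos.trans_le hϱ) f π fun p hp =>
      ae_vanish_of_vanishOff ha hμa hf (hϱ.trans hp)]
    simp
  | succ k =>
    have hT' := isNormal_boundary hT
    have hA' := hA.boundary hT.1
    obtain ⟨B, ν, hBT, hB, hνa⟩ := exists_normalForm hT' hd hA'
    have hBS : ∀ f π, B f π = S 1 (Fin.cons (α := fun _ => qLipAlg E) f π) := fun f π => by
      rw [hBT, hST]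
      exact (extendFun_boundary hT.1 hd hA f π).symm
    refine ⟨hB.cone (truncRadius (d / 2) R), _,
      hB.tame_cone (by positivity) (le_dilBound _ R) (dilBound_pos ha hR),
      hB.famBound_cone_mass hT'.1 hd hb hBT ha hR, hB.qCont_cone hT' hd hb hA' hBT ha hνa hR,
      hB.bidimQ_cone _ ?_, fun f π ϱ hf hϱ => ?_⟩
    · have : (fun f => ⇑(B f)) = extendFun d b (boundary T) := by ext f π; exact hBT f π
      rw [this]
      exact extendFun_bidimQ hd hbi
    · rw [hB.cone_congr (ϱ := truncRadius (d / 2) R) ha hνa le_rfl hϱ hf]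
      exact eq_sub_of_add_eq (hS.cone_cons hB hBS (hpos.trans_le hϱ) f π fun p hp =>
        ae_vanish_of_vanishOff ha hμa hf (hϱ.trans hp))

/-- With `U` the cone over `T`, the boundary of `U` is represented on each ball by `S - V`: the part
`S` stands for `T` and `-V` is of bidimension `(p - 1, q + 1)`. -/
theorem exists_dbar_primitive (k : ℕ) (p q : ℤ) {d b : ℝ} (hd : 0 < d) (hb : 0 < b) :
    ∃ A B : ℝ → ℝ≥0, ∀ T : Functional E k, IsNormal T → AnnSupported d b T →
      HasBidimension (lipB E) (lip E) p q T →
      HasBidimension (lipB E) (lip E) (p - 1) q (boundary T) →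
      ∃ U : Functional E (k + 1), IsQLocNormal U ∧
        HasBidimension (qTest E) (qLip E) p (q + 1) U ∧ IsQLocDbar p (q + 1) U (toQLoc T) ∧
        ∀ R : ℝ, 0 < R → qMass R U + qMass R (qBoundary U) ≤
          A R * mass T + B R * mass (boundary T) := by
  set e := lipschitzExtensionConstant ℂ
  -- The first summand bounds the mass of `U`, the second that of `T` as a part of `dU`; the
  -- coefficient of `mass (boundary T)` bounds the cone over `dT`.
  refine ⟨fun R => e ^ (k + 1) * coneConst k (b + d) (d / 2) R + e ^ k * e ^ k,
    fun R => e ^ k * bdConst k (b + d) (d / 2) R, fun T hT hA hT1 hT2 => ?_⟩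
  obtain ⟨S, μ, hST, hS, hμa⟩ := exists_normalForm hT hd hA
  have ha : 0 < d / 2 := by positivity
  have hρ : 0 ≤ b + d := by positivity
  have hSbi : BidimQ (fun f => ⇑(S f)) p q := by
    have : (fun f => ⇑(S f)) = extendFun d b T := by ext f π; exact hST f π
    rw [this]
    exact extendFun_bidimQ hd hT1
  have hSfam : FamBound (fun f => ⇑(S f)) (b + d) (e ^ k * mass T) := by
    have : (fun f => ⇑(S f)) = extendFun d b T := by ext f π; exact hST f π
    rw [this]
    exact extendFun_famBound hT.1 hd
  have hrT := represents_toQLoc hT.1 hd hA hST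
  have hrU : ∀ R : ℝ, 0 < R → Represents (hS.cone (truncRadius (d / 2) R)) R hS.qCone :=
    fun R hR => hS.represents_qCone ha hμa le_rfl
  have hrB : ∀ {R : ℝ} {V : Form E k}, (∀ (f : qLipAlg E) (π : Fin k → qLipAlg E) (ϱ : ℝ),
      VanishOff R (f : E → ℂ) → truncRadius (d / 2) R ≤ ϱ →
        hS.cone ϱ 1 (Fin.cons (α := fun _ => qLipAlg E) f π) = S f π - V f π) →
      Represents (S - V) R (qBoundary hS.qCone) := by
    intro R V hV f π hf
    obtain ⟨ϱ₀, h⟩ := hS.qBoundary_qCone ha hμa hf π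
    exact (h _ (le_max_left ϱ₀ (truncRadius (d / 2) R))).trans (hV f π _ hf (le_max_right _ _))
  refine ⟨hS.qCone, ⟨isQLocCurrent_of_represents fun R hR => ?_,
    isQLocCurrent_of_represents fun R hR => ?_⟩, hasBidimension_of_represents fun R hR => ?_,
    ⟨isQLocCurrent_of_represents fun R hR => ?_, hasBidimension_of_represents fun R hR => ?_,
      isQLocCurrent_of_represents fun R hR => ?_, hasBidimension_of_represents fun R hR => ?_⟩,
    fun R hR => ?_⟩
  · exact ⟨_, _, _, hrU R hR, hS.tame_cone hρ (le_dilBound _ R) (dilBound_pos ha hR),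
      hS.qCont_cone hT hd hb hA hST ha hμa hR⟩
  · obtain ⟨V, ν, h1, -, h3, -, h5⟩ := hS.exists_boundary_form hT hd hb hA hST hμa hT2 hR
    exact ⟨S - V, _, _, hrB h5, (hS.toTame.mono (le_dilBound_mul ha hR hρ)).sub h1,
      (hS.qCont R).sub h3⟩
  · exact ⟨_, hrU R hR, hS.bidimQ_cone _ hSbi⟩
  · exact ⟨S, _, _, hrT R, hS.toTame, hS.qCont R⟩
  · rw [add_sub_cancel_right]
    exact ⟨S, hrT R, hSbi⟩
  · obtain ⟨V, ν, h1, -, h3, -, h5⟩ := hS.exists_boundary_form hT hd hb hA hST hμa hT2 hR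
    have hS' := hS.toTame.mono (le_dilBound_mul ha hR hρ)
    exact ⟨S - V - S, _, _, fun f π hf => congrArg₂ (· - ·) (hrB h5 f π hf) (hrT R f π hf),
      (hS'.sub h1).sub hS', ((hS.qCont R).sub h3).sub (hS.qCont R)⟩
  · obtain ⟨V, ν, -, -, -, h4, h5⟩ := hS.exists_boundary_form hT hd hb hA hST hμa hT2 hR
    refine ⟨S - V - S, fun f π hf => ?_, fun f π I hI => ?_⟩
    · exact congrArg₂ (· - ·) (hrB h5 f π hf) (hrT R f π hf)
    · have h6 : V f π = 0 := h4 f π I hI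
      change S f π - V f π - S f π = 0
      rw [h6, sub_zero, sub_self]
  · obtain ⟨V, ν, h1, h2, -, -, h5⟩ := hS.exists_boundary_form hT hd hb hA hST hμa hT2 hR
    have m1 := qMass_le_of_represents (hrU R hR)
      (hS.tame_cone hρ (le_dilBound _ R) (dilBound_pos ha hR))
      (hS.famBound_cone_mass hT.1 hd hb hST ha hR)
    have hle := le_dilBound_mul ha hR hρ
    have m2 := qMass_le_of_represents (hrB h5) ((hS.toTame.mono hle).sub h1)
      (hSfam.sub h2 hle)
    refine (add_le_add m1 m2).trans (le_of_eq ?_)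
    push_cast
    ring

end Cone

end MetricCurrents

/-! ### The theorem. -/

theorem mainTheorem1 {E : Type*} [NormedAddCommGroup E] [NormedSpace ℂ E] [CompleteSpace E]
    [MeasurableSpace E] [BorelSpace E] (p q : ℕ) (K : Set E)
    (hK : Bornology.IsBounded K) (hK0 : ∃ d : ℝ, 0 < d ∧ ∀ x ∈ K, d ≤ ‖x‖) :
    ∃ A B : ℝ → ℝ≥0, ∀ T : MetricCurrents.Functional E (p + q),
      MetricCurrents.IsNormal T →
      MetricCurrents.HasBidimension (MetricCurrents.lipB E) (MetricCurrents.lip E) p q T →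
      MetricCurrents.IsDbar p q T 0 →
      MetricCurrents.supp T ⊆ K →
      ∃ U : MetricCurrents.Functional E (p + q + 1),
        MetricCurrents.IsQLocNormal U ∧
        MetricCurrents.HasBidimension (MetricCurrents.qTest E) (MetricCurrents.qLip E)
          p (q + 1) U ∧
        MetricCurrents.IsQLocDbar p (q + 1) U (MetricCurrents.toQLoc T) ∧
        ∀ R : ℝ, 0 < R →
          MetricCurrents.qMass R U + MetricCurrents.qMass R (MetricCurrents.qBoundary U) ≤
            A R * MetricCurrents.mass T + B R * MetricCurrents.mass (MetricCurrents.boundary T) := by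
  obtain ⟨d, hd, hdK⟩ := hK0
  obtain ⟨b, hb, hbK⟩ := hK.exists_pos_norm_le
  obtain ⟨A, B, h⟩ := MetricCurrents.exists_dbar_primitive (E := E) (p + q) p q hd hb
  refine ⟨A, B, fun T hT hb hdbar hK => h T hT ?_ hb ?_⟩
  · exact MetricCurrents.annSupported_of_supp hT.1 fun x hx => ⟨hdK x (hK hx), hbK x (hK hx)⟩
  -- With `∂̄T = 0` the remaining component of `dT` is `dT` itself, so `dT` has bidimension `(p - 1,
  -- q)`.
  · simpa only [sub_zero] using hdbar.bidim_del
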